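/- **Model.** Programs run on a randomized unit-cost random access machine: reading or writing a memory cell, drawing a uniformly random integer from $\{0,\dots,k-1\}$, and starting a loop iteration each take one step, with only boundedly many register operations between consecutive steps. The initial memory contents are arbitrary apart from the input. A simple graph $G$ on $n$ vertices with $m\ge 1$ edges is given as a list of edge records (two endpoints and a color field), and $d$ denotes its maximum degree. A *partial edge-coloring* with $k$ colors assigns to each edge at most one of $k$ colors such that no two adjacent edges have the same color; $\ell$ denotes the number of uncolored edges. A color is *missing* at $v$ if no edge at $v$ has it; $M(v)\subseteq\{1,\dots,d+1\}$ is the set of colors missing at $v$. **Random-Color-One** (for a graph with a partial $(d+1)$-edge-coloring $c$ and $\ell\ge 1$). Choose an uncolored edge $vx_0$ uniformly at random, with the center $v$ uniform among its two endpoints, and then $\alpha\in M(v)$ uniformly at random. * *Make a primed fan:* given $x_0,\dots,x_k$, pick some $\beta\in M(x_k)$. If $\beta\in M(v)$, or if $\beta=c(vx_j)$ for some $1\le j\le k$, stop; otherwise let $x_{k+1}$ be the neighbour of $v$ with $c(vx_{k+1})=\beta$ and continue. * *Activate it.* Shifting from $x_i$ means giving $vx_{0},\dots,vx_{i-1}$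 the colors of $vx_1,\dots,vx_i$, respectively, and uncoloring $vx_i$. If $\beta\in M(v)$, shift from $x_k$ and color $vx_k$ by $\beta$. Otherwise $\beta=c(vx_j)$; flip (interchange the two colors on) the maximal path starting at $v$ whose edges are colored $\alpha$ or $\beta$, and let $w$ be its other end. If $w\neq x_{j-1}$, shift from $x_{j-1}$ and color $vx_{j-1}$ by $\beta$; if $w=x_{j-1}$, shift from $x_k$ and color $vx_k$ by $\beta$. The data structures used are: the vertex degrees; a dictionary that maps $(v,\gamma)$ to the edge at $v$ of color $\gamma$; for each vertex $v$ a list of $M(v)\cap\{1,\dots,\deg v+1\}$ with positions; and a list of the uncolored edges with positions. **Random-Euler-Color** on $G$. If $d\le 1$, give all edges one color. Otherwise: * *Partition:* decompose the edges into tours, by removing maximal tours, such that every odd-degree vertex is an endpoint of exactly one open tour and all other tours are closed; list the edges tour by tour, and put the edges at even and at odd positions of the list into subgraphs $G_1$ and $G_2$. * *Recurse* on $G_1$ and on $G_2$, using disjoint sets of colors, and take the union of the colorings. * *Prune:* while there are more than $d+1$ colors, uncolor all edges of the least common color. * *Repair:* set up the data structures, and call Random-Color-One as long as there are uncolored edges.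 **Lemma.** There are absolute constants $C,C'$ such that the following holds. 1. For every simple graph $G$ with $n$ vertices, $m\ge1$ edges and maximum degree $d$, and for every listing of its edges as the input, Random-Euler-Color always ends with a proper edge-coloring of all edges of $G$ by $d+1$ colors, and its expected running time is at most $C\,m\sqrt n$. 2. For every simple graph $G$ with $n$ vertices, $m$ edges and maximum degree $d$, every partial edge-coloring of $G$ with $d+1$ colors and $\ell\ge 1$ uncolored edges, and every state of the machine in which the data structures correctly represent them, Random-Color-One always ends in a state that correctly represents a partial edge-coloring of $G$ with $d+1$ colors in which all previously colored edges are still colored and exactly $\ell-1$ edges are uncolored, and its expected running time is at most $C'\min(n,\,md/\ell)$. -/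

import Mathlib

open scoped ENNReal

namespace EdgeColoringRAM

/-! ### The machine

A random access machine whose memory consists of finitely many named arrays of natural numbers, with
a step counter.  Reading a cell, writing a cell, drawing a uniform random integer and starting an
iteration of a loop cost one step each.  All programs below do only a bounded number of register
operations (comparisons and `+`, `-`, `*`, `/ 2` on numbers polynomial in the size of the input)
between two charged steps, so that the step count is the running time on a unit-cost
RAM up to a constant factor.  Nothing is assumed about the initial contents of the memory except for
the input cells; in particular no array is assumed to be cleared. -/

/-- The names of the arrays. -/
inductive Arr
  | src | dst | col
  | deg
  | head | nxt | vis | tour | tourLen | tmpSrc | tmpDst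
  | classSize
  | dict
  | muArr | muPos | muCnt
  | unArr | unPos | unCnt
  | fan | fanPos | path | scratch
  deriving DecidableEq

/-- Memory contents. -/
abbrev Mem := Arr → ℕ → ℕ

structure Machine where
  mem : Mem
  time : ℕ

/-- Deterministic programs. -/
abbrev Det := StateM Machine

/-- Randomized programs: a state transformer whose outcome is a probability distribution. -/
abbrev Rand := StateT Machine PMF

def tick : Det Unit := fun s => ((), ⟨s.mem, s.time + 1⟩)

def read (a : Arr) (i : ℕ) : Det ℕ := fun s => (s.mem a i, ⟨s.mem, s.time + 1⟩)

def write (a : Arr) (i x : ℕ) : Det Unit :=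
  fun s => ((), ⟨Function.update s.mem a (Function.update (s.mem a) i x), s.time + 1⟩)

/-- `for i = 0, …, k - 1`, with a register of type `α` passed from iteration to iteration. -/
def loop {α : Type} : ℕ → α → (ℕ → α → Det α) → Det α
  | 0, a, _ => pure a
  | k + 1, a, body => do
    let b ← loop k a body
    tick
    body k b

/-- `for i = lo, …, hi - 1`. -/
def forRange (lo hi : ℕ) (body : ℕ → Det Unit) : Det Unit :=
  loop (hi - lo) () fun i _ => body (lo + i)

/-! ### Edge records and degrees

The edge with index `e` has its endpoints in `src e` and `dst e` and its color in `col e`; colors are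
positive and `0` means uncolored.  A subgraph is given by the records `lo, …, hi - 1`. -/

/-- The endpoint of `e` other than `v`. -/
def other (e v : ℕ) : Det ℕ := do
  let a ← read .src e
  let b ← read .dst e
  return if a = v then b else a

/-- Stores the degree of each vertex of the subgraph in `deg`, and returns the maximum. -/
def maxDegree (lo hi : ℕ) : Det ℕ := do
  forRange lo hi fun e => do
    write .deg (← read .src e) 0
    write .deg (← read .dst e) 0
  loop (hi - lo) 0 fun i best => do
    let a ← read .src (lo + i)
    let b ← read .dst (lo + i)
    let da ← read .deg a
    write .deg a (da + 1)
    let db ← read .deg b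
    write .deg b (db + 1)
    return max best (max (da + 1) (db + 1))

/-! ### Partition

The edges are listed in `tour`, one maximal tour after the other, and the edges at even and at odd
positions of that list go to the two subgraphs.  Every edge `e` has the two half-edges `2 * e + 1` and
`2 * e + 2`; the incidence list of `v` is the linked list of half-edges starting at `head v` (`0` is
the end of a list). -/

def pushHalfEdge (v h : ℕ) : Det Unit := do
  write .nxt h (← read .head v)
  write .head v h

def buildIncidence (lo hi : ℕ) : Det Unit := do
  write .tourLen 0 0
  forRange lo hi fun e => do
    write .head (← read .src e) 0
    write .head (← read .dst e) 0
    write .vis e 0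
  forRange lo hi fun e => do
    pushHalfEdge (← read .src e) (2 * e + 1)
    pushHalfEdge (← read .dst e) (2 * e + 2)

/-- Removes a maximal tour starting at `v` from what is left of the graph, and appends its edges to the
list; `deg` is kept up to date.  Every iteration but the last removes a half-edge from an incidence
list, so that twice the number of edges plus one is enough for the iteration bound. -/
def walkTour : ℕ → ℕ → Det Unit
  | 0, _ => pure ()
  | b + 1, v => do
    let h ← read .head v
    if h = 0 then
      return ()
    else
      write .head v (← read .nxt h)
      let e := (h - 1) / 2
      let visited ← read .vis e
      if visited = 1 then
        walkTour b v
      else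
        write .vis e 1
        let k ← read .tourLen 0
        write .tour k e
        write .tourLen 0 (k + 1)
        let w ← other e v
        write .deg v ((← read .deg v) - 1)
        write .deg w ((← read .deg w) - 1)
        walkTour b w

def walkIfOdd (b v : ℕ) : Det Unit := do
  let d ← read .deg v
  if d % 2 = 1 then walkTour b v else return ()

/-- Partition step.  Expects the degrees in `deg`.  The records are rearranged such that the two
subgraphs are `lo, …, mid - 1` and `mid, …, hi - 1` where `mid = lo + (hi - lo + 1) / 2`. -/
def partition (lo hi : ℕ) : Det Unit := do
  buildIncidence lo hi
  let b := 2 * (hi - lo) + 1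
  forRange lo hi fun e => do
    walkIfOdd b (← read .src e)
    walkIfOdd b (← read .dst e)
  forRange lo hi fun e => do
    walkTour b (← read .src e)
  forRange 0 (hi - lo) fun i => do
    let e ← read .tour i
    let p := if i % 2 = 0 then lo + i / 2 else lo + (hi - lo + 1) / 2 + i / 2
    write .tmpSrc p (← read .src e)
    write .tmpDst p (← read .dst e)
  forRange lo hi fun e => do
    write .src e (← read .tmpSrc e)
    write .dst e (← read .tmpDst e)

/-! ### Recoloring whole color classes: base case, relabeling, Prune -/

/-- Colors every edge by the color `1`. -/
def colorAll (lo hi : ℕ) : Det Unit :=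
  forRange lo hi fun e => write .col e 1

/-- Replaces each color `γ` by `γ + k`. -/
def relabel (lo hi k : ℕ) : Det Unit :=
  forRange lo hi fun e => do
    write .col e ((← read .col e) + k)

/-- The least common one among the colors `1, …, q`. -/
def leastCommon (lo hi q : ℕ) : Det ℕ := do
  forRange 1 (q + 1) fun γ => write .classSize γ 0
  forRange lo hi fun e => do
    let γ ← read .col e
    if γ = 0 then return () else write .classSize γ ((← read .classSize γ) + 1)
  loop (q - 1) 1 fun i best => do
    let x ← read .classSize (i + 2)
    let y ← read .classSize best
    return if x < y then i + 2 else best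

/-- Uncolors the color class `γ`, and gives the now free name `γ` to the color `q`. -/
def eliminate (lo hi q γ : ℕ) : Det Unit :=
  forRange lo hi fun e => do
    let x ← read .col e
    if x = γ then write .col e 0
    else if x = q then write .col e γ
    else return ()

/-- Prune step: while there are more than `k` colors `1, …, q`, the least common color is
eliminated. -/
def prune (lo hi k q : ℕ) : Det Unit := do
  let _ ← loop (q - k) q fun _ q' => do
    let γ ← leastCommon lo hi q'
    eliminate lo hi q' γ
    return q' - 1
  return ()

/-! ### Data structures of the Repair step -/

/-- A set of numbers, its elements listed in the `count` first cells of `arr` (from `off` on), with the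
position of each element `x` in that list stored in the cell `off + x` of `pos`. -/
def setInsert (arr pos cnt : Arr) (off c x : ℕ) : Det Unit := do
  let k ← read cnt c
  write arr (off + k) x
  write pos (off + x) k
  write cnt c (k + 1)

/-- Removes `x` from the set: the last element of the list takes its place. -/
def setRemove (arr pos cnt : Arr) (off c x : ℕ) : Det Unit := do
  let k ← read cnt c
  let p ← read pos (off + x)
  let y ← read arr (off + (k - 1))
  write arr (off + p) y
  write pos (off + y) p
  write cnt c (k - 1)

/-- Address belonging to the vertex `v` and the number `γ ≤ d + 1` in a two-dimensional table. -/
def cell (d v γ : ℕ) : ℕ := v * (d + 2) + γ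

/-- The dictionary: the edge at `v` colored by `γ`, if there is one.  The table entry is checked
against the edge records, and so the table need not be initialized. -/
def search (lo hi d v γ : ℕ) : Det (Option ℕ) := do
  let e ← read .dict (cell d v γ)
  if lo ≤ e ∧ e < hi then
    let x ← read .col e
    let a ← read .src e
    let b ← read .dst e
    return if x = γ ∧ (a = v ∨ b = v) then some e else none
  else
    return none

/-- The data structure `μ(v)` holds those colors missing at `v` that are at most `deg v + 1`. -/
def muInsert (d v γ : ℕ) : Det Unit := do
  let k ← read .deg v
  if γ ≤ k + 1 then setInsert .muArr .muPos .muCnt (cell d v 0) v γ else return ()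

def muRemove (d v γ : ℕ) : Det Unit := do
  let k ← read .deg v
  if γ ≤ k + 1 then setRemove .muArr .muPos .muCnt (cell d v 0) v γ else return ()

/-- Some color missing at `v`. -/
def someMissing (d v : ℕ) : Det ℕ := read .muArr (cell d v 0)

/-- Colors the uncolored edge `e` by `γ`. -/
def colorEdge (d e γ : ℕ) : Det Unit := do
  let a ← read .src e
  let b ← read .dst e
  write .col e γ
  write .dict (cell d a γ) e
  write .dict (cell d b γ) e
  muRemove d a γ
  muRemove d b γ
  setRemove .unArr .unPos .unCnt 0 0 e

/-- Uncolors the colored edge `e`. -/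
def uncolorEdge (d e : ℕ) : Det Unit := do
  let a ← read .src e
  let b ← read .dst e
  let γ ← read .col e
  write .col e 0
  muInsert d a γ
  muInsert d b γ
  setInsert .unArr .unPos .unCnt 0 0 e

/-- Fills `μ(v)` with all colors `1, …, deg v + 1`, unless this has been done already. -/
def muFill (d v : ℕ) : Det Unit := do
  let c ← read .muCnt v
  if c = 0 then
    let k ← read .deg v
    forRange 1 (k + 2) fun γ => setInsert .muArr .muPos .muCnt (cell d v 0) v γ
  else return ()

/-- Sets up the data structures for the partially colored subgraph `lo, …, hi - 1`. -/
def initRepair (lo hi d : ℕ) : Det Unit := do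
  let _ ← maxDegree lo hi
  write .unCnt 0 0
  forRange lo hi fun e => do
    write .muCnt (← read .src e) 0
    write .muCnt (← read .dst e) 0
  forRange lo hi fun e => do
    muFill d (← read .src e)
    muFill d (← read .dst e)
  forRange lo hi fun e => do
    let γ ← read .col e
    write .col e 0
    setInsert .unArr .unPos .unCnt 0 0 e
    if γ = 0 then return () else colorEdge d e γ

/-! ### Make-Primed-Fan

The fan `(α, v, x₀, …, x_k)` is stored as the list of the edges `v x₀, …, v x_k` in `fan`. -/

/-- Extends the fan with leaves `x₀, …, x_k` until it is primed.  Returns `(k, β, none)` if the fan is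
primed by a color `β` missing at `v`, and `(k, β, some j)` if `β` is the color of `v x_j`.
The argument after `v` bounds the number of iterations. -/
def growFan (lo hi d v : ℕ) : ℕ → ℕ → Det (ℕ × ℕ × Option ℕ)
  | 0, k => pure (k, 0, none)
  | b + 1, k => do
    let e ← read .fan k
    let x ← other e v
    let β ← someMissing d x
    let r ← search lo hi d v β
    match r with
    | none => return (k, β, none)
    | some f =>
      let j ← read .fanPos f
      let g ← read .fan j
      if j ≤ k ∧ g = f then
        return (k, β, some j)
      else
        write .fan (k + 1) f
        write .fanPos f (k + 1)
        growFan lo hi d v b (k + 1)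

def makePrimedFan (lo hi d v e : ℕ) : Det (ℕ × ℕ × Option ℕ) := do
  write .fan 0 e
  write .fanPos e 0
  growFan lo hi d v (d + 1) 0

/-! ### Activate-c-Fan -/

/-- Shifts the fan from `x_j`. -/
def shiftFan (d j : ℕ) : Det Unit :=
  forRange 0 j fun i => do
    let e ← read .fan i
    let f ← read .fan (i + 1)
    let γ ← read .col f
    uncolorEdge d f
    colorEdge d e γ

/-- Follows the alternating path that leaves `u` by an edge of color `γ` and continues with the colors
`δ, γ, δ, …`; its edges are stored in `path` from position `i` on.  Returns the length of the path and
its last vertex.  The first explicit argument after `d` bounds the number of iterations. -/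
def tracePath (lo hi d : ℕ) : ℕ → ℕ → ℕ → ℕ → ℕ → Det (ℕ × ℕ)
  | 0, i, u, _, _ => pure (i, u)
  | b + 1, i, u, γ, δ => do
    let r ← search lo hi d u γ
    match r with
    | none => return (i, u)
    | some e =>
      write .path i e
      let w ← other e u
      tracePath lo hi d b (i + 1) w δ γ

/-- Flips the path stored in `path`, of length `len`, whose first edge has the color `β` and whose
other color is `α`. -/
def flipPath (d len α β : ℕ) : Det Unit := do
  forRange 0 len fun i => do
    uncolorEdge d (← read .path i)
  forRange 0 len fun i => do
    colorEdge d (← read .path i) (if i % 2 = 0 then α else β)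

/-- Shifts the fan from `x_j` and colors `v x_j` by `β`. -/
def shiftAndColor (d j β : ℕ) : Det Unit := do
  shiftFan d j
  colorEdge d (← read .fan j) β

/-- Activates the fan `(α, v, x₀, …, x_k)` primed by `β`, as returned by `makePrimedFan`. -/
def activateFan (lo hi d α v : ℕ) : ℕ × ℕ × Option ℕ → Det Unit
  | (k, β, none) => shiftAndColor d k β
  | (k, β, some j) => do
    let (len, w) ← tracePath lo hi d (hi - lo) 0 v β α
    flipPath d len α β
    let e ← read .fan (j - 1)
    let x ← other e v
    if w = x then shiftAndColor d k β else shiftAndColor d (j - 1) β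

/-- Lists all colors of `1, …, d + 1` missing at `v` in `scratch`, and returns their number. -/
def listMissing (lo hi d v : ℕ) : Det ℕ :=
  loop (d + 1) 0 fun i k => do
    let r ← search lo hi d v (i + 1)
    match r with
    | none => do
      write .scratch k (i + 1)
      return k + 1
    | some _ => return k

/-! ### The randomized algorithms -/

/-- A deterministic program as a randomized program. -/
noncomputable instance : MonadLift Det Rand where
  monadLift p := fun s => (pure (p s) : PMF _)

/-- A uniformly random element of `{0, …, k - 1}`, for `0 < k`. -/
noncomputable def randBelow (k : ℕ) : Rand ℕ := fun s =>
  if h : 0 < k then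
    (PMF.uniformOfFinset (Finset.range k) (Finset.nonempty_range_iff.mpr h.ne')).map
      fun i => (i, ⟨s.mem, s.time + 1⟩)
  else pure (0, ⟨s.mem, s.time + 1⟩)

/-- Random-Color-One, on the subgraph `lo, …, hi - 1` of maximum degree `d`: picks a uniformly random
uncolored edge, a uniformly random endpoint `v` of it as the center, a uniformly random color among the
colors of `1, …, d + 1` missing at `v`, builds a primed fan and activates it. -/
noncomputable def randomColorOne (lo hi d : ℕ) : Rand Unit := do
  let ℓ ← read .unCnt 0
  let i ← randBelow ℓ
  let e ← read .unArr i
  let side ← randBelow 2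
  let v ← read (if side = 0 then Arr.src else Arr.dst) e
  let k ← listMissing lo hi d v
  let r ← randBelow k
  let α ← read .scratch r
  let F ← makePrimedFan lo hi d v e
  activateFan lo hi d α v F

/-- While there are uncolored edges (and for at most the given number of times), Random-Color-One is
called. -/
noncomputable def repairLoop (lo hi d : ℕ) : ℕ → Rand Unit
  | 0 => pure ()
  | b + 1 => do
    let ℓ ← read .unCnt 0
    if ℓ = 0 then
      return ()
    else
      randomColorOne lo hi d
      repairLoop lo hi d b

/-- Repair step. -/
noncomputable def repair (lo hi d : ℕ) : Rand Unit := do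
  initRepair lo hi d
  repairLoop lo hi d (hi - lo)

/-- Random-Euler-Color on the subgraph `lo, …, hi - 1`.  Returns a number `q` such that the colors used
are among `1, …, q`.  (The test `hi - lo ≤ 1` is redundant: a graph with at most one edge has maximum
degree at most one.) -/
noncomputable def eulerColor (lo hi : ℕ) : Rand ℕ := do
  let d ← maxDegree lo hi
  if h : d ≤ 1 ∨ hi - lo ≤ 1 then
    colorAll lo hi
    return 1
  else
    partition lo hi
    let mid := lo + (hi - lo + 1) / 2
    let q₁ ← eulerColor lo mid
    let q₂ ← eulerColor mid hi
    relabel mid hi q₁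
    prune lo hi (d + 1) (q₁ + q₂)
    repair lo hi d
    return d + 1
termination_by hi - lo
decreasing_by all_goals omega

/-- Random-Euler-Color on a graph given by the edge records `0, …, m - 1`. -/
noncomputable def randomEulerColor (m : ℕ) : Rand Unit := do
  let _ ← eulerColor 0 m
  return ()

/-- The distribution of the result of `p` and the final state of the machine, if `p` is started with
memory contents `mem` and the step counter at `0`. -/
noncomputable def exec {α : Type} (p : Rand α) (mem : Mem) : PMF (α × Machine) := p.run ⟨mem, 0⟩

/-- The expected number of steps of `p`, started with memory contents `mem`. -/
noncomputable def expectedTime {α : Type} (p : Rand α) (mem : Mem) : ℝ≥0∞ :=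
  ∑' ω, exec p mem ω * (ω.2.time : ℝ≥0∞)

/-! ### Graphs, partial colorings and their representation -/

/-- A partial edge-coloring of `G` with `k` colors: adjacent edges never have the same color. -/
structure PartialEdgeColoring {n : ℕ} (G : SimpleGraph (Fin n)) (k : ℕ) where
  color : G.edgeSet → Option (Fin k)
  proper : ∀ e f, G.lineGraph.Adj e f → ∀ γ, color e = some γ → color f ≠ some γ

namespace PartialEdgeColoring

variable {n : ℕ} {G : SimpleGraph (Fin n)} {k : ℕ}

/-- Every edge is colored. -/
def IsComplete (c : PartialEdgeColoring G k) : Prop := ∀ e, (c.color e).isSome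

/-- The number of uncolored edges. -/
noncomputable def uncolored (c : PartialEdgeColoring G k) : ℕ := {e | c.color e = none}.ncard

/-- The color `γ` is missing at the vertex `v`. -/
def Missing (c : PartialEdgeColoring G k) (v : Fin n) (γ : Fin k) : Prop :=
  ∀ e : G.edgeSet, v ∈ (e : Sym2 (Fin n)) → c.color e ≠ some γ

end PartialEdgeColoring

section Representation

variable {n : ℕ} {G : SimpleGraph (Fin n)}

/-- The record with index `i` has the endpoints of `e`. -/
def IsRecord (mem : Mem) (i : ℕ) (e : Sym2 (Fin n)) : Prop :=
  ∃ u v : Fin n, mem .src i = u ∧ mem .dst i = v ∧ e = s(u, v)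

/-- The records `lo, …, hi - 1` are a list of the edges of `G`, each of them occurring once. -/
structure StoresGraph (mem : Mem) (lo hi : ℕ) (G : SimpleGraph (Fin n)) : Prop where
  le : lo ≤ hi
  sound : ∀ i, lo ≤ i → i < hi → ∃ e ∈ G.edgeSet, IsRecord mem i e
  complete : ∀ e ∈ G.edgeSet, ∃! i, (lo ≤ i ∧ i < hi) ∧ IsRecord mem i e

/-- The number standing for a color, or for no color, in a color field. -/
def colorCode {k : ℕ} : Option (Fin k) → ℕ
  | none => 0
  | some γ => γ + 1

/-- The records `lo, …, hi - 1` store the graph `G` together with its partial edge-coloring `c`. -/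
structure StoresColoring (mem : Mem) (lo hi : ℕ) {k : ℕ} (c : PartialEdgeColoring G k) : Prop
    extends StoresGraph mem lo hi G where
  col : ∀ i, lo ≤ i → i < hi → ∀ e : G.edgeSet, IsRecord mem i (e : Sym2 (Fin n)) →
    mem .col i = colorCode (c.color e)

/-- The arrays `arr`, `pos`, `cnt` store the set `S`. -/
structure StoresSet (mem : Mem) (arr pos cnt : Arr) (off c : ℕ) (S : Set ℕ) : Prop where
  elem : ∀ i < mem cnt c, mem arr (off + i) ∈ S ∧ mem pos (off + mem arr (off + i)) = i
  index : ∀ x ∈ S, mem pos (off + x) < mem cnt c ∧ mem arr (off + mem pos (off + x)) = x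

/-- The machine holds the graph `G` with the partial edge-coloring `c` in the records
`lo, …, hi - 1`, and its data structures are up to date: the degrees, the dictionary, the sets
`μ(v)` of the missing colors that are at most `deg v + 1`, and the set of uncolored edges. -/
structure RepairState (mem : Mem) (lo hi d : ℕ) {k : ℕ} (c : PartialEdgeColoring G k) : Prop
    extends StoresColoring mem lo hi c where
  deg : ∀ v : Fin n, (G.neighborSet v).Nonempty → mem .deg v = (G.neighborSet v).ncard
  dict : ∀ i, lo ≤ i → i < hi → mem .col i ≠ 0 →
    mem .dict (cell d (mem .src i) (mem .col i)) = i ∧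
    mem .dict (cell d (mem .dst i) (mem .col i)) = i
  mu : ∀ v : Fin n, (G.neighborSet v).Nonempty →
    StoresSet mem .muArr .muPos .muCnt (cell d v 0) v
      {x | ∃ γ : Fin k, x = γ + 1 ∧ x ≤ (G.neighborSet v).ncard + 1 ∧ c.Missing v γ}
  unc : StoresSet mem .unArr .unPos .unCnt 0 0 {i | lo ≤ i ∧ i < hi ∧ mem .col i = 0}

end Representation

end EdgeColoringRAM

open EdgeColoringRAM

set_option linter.unusedSimpArgs false
set_option linter.unusedVariables false

namespace EdgeColoringRAM

/-! Random-Color-One. Correctness is Vizing's fan argument (`activateFan_wp`). Apart from O(d) steps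
for the fan and for listing missing colors, the time is proportional to the length of one
alternating path. Such a path repeats no vertex, which gives the bound n
(`Walk.length_le_vertices`). For the bound md/ℓ, a path is determined by its start v, a color α ∈
M(v) and the second color β. An edge together with a direction and the other color of the pair
occurs in at most one position of at most one of these paths, because the way back along a path is
forced until its start, where α is missing (`Walk.unique`). Hence all path lengths sum to at most
2m(d+1) (`sum_pathLen_le`). If u uncolored edges meet v, the pair (v, α) is drawn with probability
u/(2ℓ|M(v)|), and u < |M(v)| (`card_missing`). So every pair has probability at most 1/(2ℓ), and the
expected length is at most m(d+1)/ℓ (`average_pathLen_le`). As β depends on the fan and is not drawn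
at random, the length is bounded by its sum over all β.

Partition. Consecutive edges of a tour have opposite parity in the list, so they cancel at inner
vertices. A vertex is an endpoint of at most one open tour (error 1) and the start of at most one
nontrivial closed tour (error at most 2). So twice the degree in either half differs from the degree
by at most 3 (`partition_halves_spec`). With k edges, the union of the recursive colorings then has
at most d + 5 colors. Prune removes at most four classes of at most k/(d+2) edges each, and at most
4k/(d+2) edges remain to be repaired.

Running time. Up to constants, a Repair step costs the sum of min(n, kd/ℓ) over ℓ ≤ 4k/(d+2),
besides linear work. Interpolating min(n, A/ℓ) ≤ n^(1/4) (A/ℓ)^(3/4) bounds the sum by O(k √(√n d))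
without a logarithm, and taking n for every term gives O(k n/d). Along the recursion d is roughly
halved while the edge numbers of a level add up to m. Both bounds decay geometrically away from d ≈
√n, and the total is O(m√n). The geometric sums are replaced by a bounded potential √x/(1+√x), x =
D/√n, whose drop under D ↦ D/2 pays for the repair (`sum_min_le_drop`, `timeBound_step`). Here D is
a real number that is halved exactly and stays within 3 of the true maximum degree. For small D a
level costs O(n^(1/4)) per edge instead, and there are only O(log m) = O(n^(1/4)) levels. -/

/-- Memory contents after writing `x` to the cell `i` of the array `a`. -/
def Mem.set (m : Mem) (a : Arr) (i x : ℕ) : Mem := Function.update m a (Function.update (m a) i x)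

theorem Mem.set_self (m : Mem) (a : Arr) (i x : ℕ) :
    m.set a i x a = Function.update (m a) i x := by
  simp [Mem.set]

theorem Mem.set_of_ne (m : Mem) {a b : Arr} (h : b ≠ a) (i x : ℕ) : m.set a i x b = m b := by
  simp [Mem.set, h]

/-! ### Weakest preconditions and step bounds for deterministic programs. -/

/-- Weakest precondition of a deterministic program, for postconditions on the result, the memory and
the step counter. -/
def wp {α : Type} (p : Det α) (m : Mem) (t : ℕ) (Q : α → Mem → ℕ → Prop) : Prop :=
  Q (p ⟨m, t⟩).1 (p ⟨m, t⟩).2.mem (p ⟨m, t⟩).2.time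

section wp
variable {α β : Type} {m : Mem} {t : ℕ}

theorem wp_bind (p : Det α) (f : α → Det β) (Q : β → Mem → ℕ → Prop) :
    wp (p >>= f) m t Q ↔ wp p m t fun a m' t' => wp (f a) m' t' Q := Iff.rfl

theorem wp_pure (a : α) (Q : α → Mem → ℕ → Prop) : wp (pure a) m t Q ↔ Q a m t := Iff.rfl

theorem wp_tick (Q : Unit → Mem → ℕ → Prop) : wp tick m t Q ↔ Q () m (t + 1) := Iff.rfl

theorem wp_read (a : Arr) (i : ℕ) (Q : ℕ → Mem → ℕ → Prop) :
    wp (read a i) m t Q ↔ Q (m a i) m (t + 1) := Iff.rfl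

theorem wp_write (a : Arr) (i x : ℕ) (Q : Unit → Mem → ℕ → Prop) :
    wp (write a i x) m t Q ↔ Q () (m.set a i x) (t + 1) := Iff.rfl

theorem wp_ite (c : Prop) [Decidable c] (p q : Det α) (Q : α → Mem → ℕ → Prop) :
    wp (if c then p else q) m t Q ↔ (c → wp p m t Q) ∧ (¬c → wp q m t Q) := by
  by_cases h : c <;> simp [h]

theorem wp_mono {p : Det α} {Q R : α → Mem → ℕ → Prop} (h : wp p m t Q)
    (hQR : ∀ a m' t', Q a m' t' → R a m' t') : wp p m t R := hQR _ _ _ h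

theorem wp_loop (body : ℕ → α → Det α) (k : ℕ) (a : α) (I : ℕ → α → Mem → ℕ → Prop)
    (h0 : I 0 a m t)
    (hs : ∀ i < k, ∀ b m' t', I i b m' t' → wp (body i b) m' (t' + 1) (I (i + 1))) :
    wp (loop k a body) m t (I k) := by
  induction k with
  | zero => exact h0
  | succ k ih =>
    have := ih fun i hi => hs i (by omega)
    unfold loop
    rw [wp_bind]
    refine wp_mono this fun b m' t' h => ?_
    rw [wp_bind, wp_tick]
    exact hs k (by omega) b m' t' h

theorem wp_forRange (body : ℕ → Det Unit) (lo hi : ℕ) (hle : lo ≤ hi) (I : ℕ → Mem → ℕ → Prop)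
    (h0 : I lo m t)
    (hs : ∀ i, lo ≤ i → i < hi → ∀ m' t', I i m' t' →
      wp (body i) m' (t' + 1) fun _ m'' t'' => I (i + 1) m'' t'') :
    wp (forRange lo hi body) m t fun _ m' t' => I hi m' t' := by
  have := wp_loop (m := m) (t := t) (fun i (_ : Unit) => body (lo + i)) (hi - lo) ()
    (fun i _ m' t' => I (lo + i) m' t') (by simpa using h0)
    (fun i hi' b m' t' h => hs (lo + i) (by omega) (by omega) m' t' h)
  rw [show lo + (hi - lo) = hi by omega] at this
  exact this

end wp

/-- The program takes at most `T` steps, and the postcondition holds. -/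
def Spec {α : Type} (p : Det α) (m : Mem) (T : ℕ) (Q : α → Mem → Prop) : Prop :=
  ∀ t, wp p m t fun a m' t' => t' ≤ t + T ∧ Q a m'

section Spec
variable {α β : Type} {m : Mem} {T : ℕ}

theorem Spec.mono {p : Det α} {Q R : α → Mem → Prop} {T' : ℕ} (h : Spec p m T Q) (hT : T ≤ T')
    (hQR : ∀ a m', Q a m' → R a m') : Spec p m T' R :=
  fun t => wp_mono (h t) fun _ _ _ h => ⟨by omega, hQR _ _ h.2⟩

theorem Spec.bind {p : Det α} {f : α → Det β} {R : α → Mem → Prop} {Q : β → Mem → Prop} {T₁ : ℕ}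
    (T₂ : ℕ) (h : Spec p m T₁ R) (hf : ∀ a m', R a m' → Spec (f a) m' T₂ Q)
    (hT : T₁ + T₂ ≤ T) : Spec (p >>= f) m T Q := fun t => by
  rw [wp_bind]
  refine wp_mono (h t) fun a m' t' ⟨h1, h2⟩ => wp_mono (hf a m' h2 t') fun _ _ _ h => ⟨?_, h.2⟩
  omega

theorem Spec.wp_bind {p : Det α} {f : α → Det β} {R : α → Mem → Prop} {t : ℕ}
    {Q : β → Mem → ℕ → Prop} (h : Spec p m T R)
    (hf : ∀ a m' t', R a m' → t' ≤ t + T → wp (f a) m' t' Q) : wp (p >>= f) m t Q :=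
  (EdgeColoringRAM.wp_bind p f Q).2 (wp_mono (h t) fun a m' t' h => hf a m' t' h.2 h.1)

/-- The extra unit per iteration is the `tick` charged by `loop`. -/
theorem Spec.loop (body : ℕ → α → Det α) (k : ℕ) (a : α) (I : ℕ → α → Mem → Prop) (T : ℕ)
    (h0 : I 0 a m) (hs : ∀ i < k, ∀ b m', I i b m' → Spec (body i b) m' T (I (i + 1))) :
    Spec (loop k a body) m (k * (T + 1)) (I k) := fun t => by
  refine wp_mono (wp_loop (m := m) (t := t) body k a
    (fun i b m' t' => t' ≤ t + i * (T + 1) ∧ I i b m') ⟨by simp, h0⟩ ?_) fun _ _ _ h => h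
  rintro i hi b m' t' ⟨h1, h2⟩
  refine wp_mono (hs i hi b m' h2 (t' + 1)) fun _ _ _ h => ⟨?_, h.2⟩
  have := h.1
  rw [add_mul]
  omega

theorem Spec.forRange (body : ℕ → Det Unit) (lo hi : ℕ) (hle : lo ≤ hi) (I : ℕ → Mem → Prop)
    (T : ℕ) (h0 : I lo m)
    (hs : ∀ i, lo ≤ i → i < hi → ∀ m', I i m' → Spec (body i) m' T fun _ m'' => I (i + 1) m'') :
    Spec (forRange lo hi body) m ((hi - lo) * (T + 1)) fun _ m' => I hi m' := by
  have := Spec.loop (m := m) (fun i (_ : Unit) => body (lo + i)) (hi - lo) ()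
    (fun i _ m' => I (lo + i) m') T (by simpa using h0)
    (fun i hi' b m' h => hs (lo + i) (by omega) (by omega) m' h)
  rw [show lo + (hi - lo) = hi by omega] at this
  exact this

end Spec

/-! ### Edge lists and colorings of edge indices -/

/-- A list of edge records: the edges are the indices `lo, …, hi - 1`, and `s`, `t` are the endpoints. -/
structure EdgeList where
  lo : ℕ
  hi : ℕ
  s : ℕ → ℕ
  t : ℕ → ℕ

namespace EdgeList

variable (g : EdgeList)

def E : Finset ℕ := Finset.Ico g.lo g.hi

def Inc (e v : ℕ) : Prop := g.s e = v ∨ g.t e = v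

instance (e v : ℕ) : Decidable (g.Inc e v) := inferInstanceAs (Decidable (_ ∨ _))

/-- The endpoint of `e` other than `v`. -/
def oth (e v : ℕ) : ℕ := if g.s e = v then g.t e else g.s e

/-- The edges at `v`. -/
def star (v : ℕ) : Finset ℕ := g.E.filter fun e => g.Inc e v

def deg (v : ℕ) : ℕ := (g.star v).card

/-- The records belong to a simple graph, and no edge occurs twice. -/
structure Simple : Prop where
  ne : ∀ e ∈ g.E, g.s e ≠ g.t e
  inj : ∀ e ∈ g.E, ∀ f ∈ g.E,
    (g.s e = g.s f ∧ g.t e = g.t f) ∨ (g.s e = g.t f ∧ g.t e = g.s f) → e = f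

/-- The color `γ` does not occur at `v`. -/
def Miss (c : ℕ → ℕ) (v γ : ℕ) : Prop := ∀ e ∈ g.E, g.Inc e v → c e ≠ γ

/-- `c` is a partial edge-coloring by the colors `1, …, q`, where `0` stands for uncolored. -/
structure Proper (q : ℕ) (c : ℕ → ℕ) : Prop where
  le : ∀ e ∈ g.E, c e ≤ q
  ne : ∀ e ∈ g.E, ∀ f ∈ g.E, e ≠ f → ∀ v, g.Inc e v → g.Inc f v → c e ≠ 0 → c e ≠ c f

/-- The uncolored edges. -/
def unc (c : ℕ → ℕ) : Finset ℕ := g.E.filter fun e => c e = 0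

variable {g} {c : ℕ → ℕ} {q : ℕ}

theorem mem_E {e : ℕ} : e ∈ g.E ↔ g.lo ≤ e ∧ e < g.hi := Finset.mem_Ico

theorem mem_star {e v : ℕ} : e ∈ g.star v ↔ e ∈ g.E ∧ g.Inc e v := Finset.mem_filter

theorem mem_unc {e : ℕ} : e ∈ g.unc c ↔ e ∈ g.E ∧ c e = 0 := Finset.mem_filter

theorem card_E : g.E.card = g.hi - g.lo := by simp [E]

theorem inc_oth {e v : ℕ} (h : g.Inc e v) : g.Inc e (g.oth e v) := by
  unfold Inc oth at *; split <;> simp_all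

theorem inc_s (e : ℕ) : g.Inc e (g.s e) := Or.inl rfl

theorem inc_t (e : ℕ) : g.Inc e (g.t e) := Or.inr rfl

theorem Simple.oth_ne (hg : g.Simple) {e v : ℕ} (he : e ∈ g.E) : g.oth e v ≠ v := by
  have := hg.ne e he
  unfold oth; split <;> grind

theorem inc_iff {e v : ℕ} (h : g.Inc e v) (u : ℕ) : g.Inc e u ↔ u = v ∨ u = g.oth e v := by
  unfold Inc oth at *; split <;> grind

theorem oth_oth {e v : ℕ} (h : g.Inc e v) : g.oth e (g.oth e v) = v := by
  unfold Inc oth at *; grind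

theorem Simple.eq_of_inc (hg : g.Simple) {e f u v : ℕ} (he : e ∈ g.E) (hf : f ∈ g.E) (huv : u ≠ v)
    (heu : g.Inc e u) (hev : g.Inc e v) (hfu : g.Inc f u) (hfv : g.Inc f v) : e = f := by
  refine hg.inj e he f hf ?_
  unfold Inc at *; grind

theorem Proper.eq (hc : g.Proper q c) {e f v : ℕ} (he : e ∈ g.E) (hf : f ∈ g.E) (hev : g.Inc e v)
    (hfv : g.Inc f v) (h : c e = c f) (h0 : c e ≠ 0) : e = f := by
  by_contra hne
  exact hc.ne e he f hf hne v hev hfv h0 h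

/-- Uncoloring edges keeps a coloring proper. -/
theorem Proper.of_sub (hc : g.Proper q c) {c' : ℕ → ℕ}
    (h : ∀ e ∈ g.E, c' e = 0 ∨ c' e = c e) : g.Proper q c' where
  le e he := by have := hc.le e he; grind
  ne e he f hf hne v hev hfv h0 := by
    have := hc.ne e he f hf hne v hev hfv
    grind

theorem Proper.color (hc : g.Proper q c) {e γ : ℕ} (hγ : γ ≤ q)
    (hs : g.Miss c (g.s e) γ) (ht : g.Miss c (g.t e) γ) :
    g.Proper q (Function.update c e γ) where
  le f hf := by
    have := hc.le f hf
    by_cases h : f = e <;> simp [Function.update, h, hγ, this]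
  ne f hf f' hf' hne v hev hfv h0 := by
    have key : ∀ f ∈ g.E, g.Inc f v → g.Inc e v → c f ≠ γ := by
      intro f hf hfv hev
      rcases hev with h | h
      · exact hs f hf (h ▸ hfv)
      · exact ht f hf (h ▸ hfv)
    by_cases h : f = e
    · subst h
      have := key f' hf' hfv hev
      simp [Function.update, hne.symm]; exact this.symm
    · by_cases h' : f' = e
      · subst h'
        have := key f hf hev hfv
        simpa [Function.update, hne] using this
      · simp only [Function.update, h, h', eq_rec_constant, dite_eq_ite, if_false] at h0 ⊢
        exact hc.ne f hf f' hf' hne v hev hfv h0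

/-- The colors of the edges of a subcoloring's uncolored edge are missing at its endpoints. -/
theorem Proper.miss_of_sub (hc : g.Proper q c) {c' : ℕ → ℕ} (h : ∀ e ∈ g.E, c' e = 0 ∨ c' e = c e)
    {e v : ℕ} (he : e ∈ g.E) (hev : g.Inc e v) (h0 : c e ≠ 0) (h0' : c' e = 0) :
    g.Miss c' v (c e) := by
  intro f hf hfv hcf
  have hne : e ≠ f := by rintro rfl; exact h0 (hcf ▸ h0').symm.symm
  have := hc.ne e he f hf hne v hev hfv h0
  grind

/-- The colors of `1, …, k` missing at `v`. -/
noncomputable def missing (g : EdgeList) (c : ℕ → ℕ) (k v : ℕ) : Finset ℕ := by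
  classical exact (Finset.Icc 1 k).filter fun γ => g.Miss c v γ

theorem mem_missing {k v γ : ℕ} : γ ∈ g.missing c k v ↔ (1 ≤ γ ∧ γ ≤ k) ∧ g.Miss c v γ := by
  classical simp [missing]

/-- The number of colors missing at `v` exceeds the number of uncolored edges at `v`. -/
theorem card_missing (c : ℕ → ℕ) {k v : ℕ} (hk : g.deg v + 1 ≤ k) :
    ((g.star v).filter fun e => c e = 0).card + 1 ≤ (g.missing c k v).card := by
  classical
  -- A color that is not missing is carried by a colored edge at v, and only deg v minus the number
  -- of uncolored edges at v are available for this.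
  have h1 : Finset.Icc 1 k ⊆ g.missing c k v ∪ ((g.star v).filter fun e => ¬ c e = 0).image c := by
    intro γ hγ
    rw [Finset.mem_Icc] at hγ
    by_cases h : g.Miss c v γ
    · exact Finset.mem_union_left _ (mem_missing.2 ⟨hγ, h⟩)
    · refine Finset.mem_union_right _ ?_
      simp only [Miss, not_forall, not_not] at h
      obtain ⟨e, he, hev, rfl⟩ := h
      refine Finset.mem_image_of_mem _ (Finset.mem_filter.2 ⟨mem_star.2 ⟨he, hev⟩, by omega⟩)
  have h2 := (Finset.card_le_card h1).trans (Finset.card_union_le _ _)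
  have h3 : (((g.star v).filter fun e => ¬ c e = 0).image c).card ≤ _ := Finset.card_image_le
  have h4 := Finset.card_filter_add_card_filter_not (s := g.star v) (fun e => c e = 0)
  simp only [Nat.card_Icc] at h2
  unfold deg at hk
  omega

theorem exists_missing (c : ℕ → ℕ) {k v : ℕ} (hk : g.deg v + 1 ≤ k) :
    ∃ γ, (1 ≤ γ ∧ γ ≤ k) ∧ g.Miss c v γ := by
  have := card_missing c hk
  obtain ⟨γ, h⟩ := Finset.card_pos.1 (by omega : 0 < (g.missing c k v).card)
  exact ⟨γ, mem_missing.1 h⟩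

/-! ### Alternating walks -/

/-- The color of the edge number `i` on a walk alternating between `β` and `α`. -/
def alt (α β i : ℕ) : ℕ := if i % 2 = 0 then β else α

/-- The vertices `p 0, …, p L` and the edges `r 0, …, r (L - 1)` form a walk from `v` with the edge
colors `β, α, β, …`. -/
structure Walk (g : EdgeList) (c : ℕ → ℕ) (v α β L : ℕ) (p r : ℕ → ℕ) : Prop where
  start : p 0 = v
  mem : ∀ i < L, r i ∈ g.E
  fst : ∀ i < L, g.Inc (r i) (p i)
  snd : ∀ i < L, p (i + 1) = g.oth (r i) (p i)
  col : ∀ i < L, c (r i) = alt α β i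

theorem alt_eq_of_parity {α β i j : ℕ} (h : i % 2 = j % 2) : alt α β i = alt α β j := by
  unfold alt; rw [h]

theorem alt_eq_or (α β i : ℕ) : alt α β i = α ∨ alt α β i = β := by
  unfold alt; grind

theorem alt_swap (α β i : ℕ) : alt β α i = alt α β (i + 1) := by
  unfold alt; grind

variable {v α β L : ℕ} {p r : ℕ → ℕ}

theorem Walk.snd_inc (hw : g.Walk c v α β L p r) {i : ℕ} (hi : i < L) :
    g.Inc (r i) (p (i + 1)) := by
  rw [hw.snd i hi]; exact inc_oth (hw.fst i hi)

/-- An alternating walk from a vertex that misses `α` does not return to a vertex. -/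
theorem Walk.vertex_ne (hg : g.Simple) (hc : g.Proper q c) (hw : g.Walk c v α β L p r)
    (hα : α ≠ 0) (hβ : β ≠ 0) (hαβ : α ≠ β) (hv : g.Miss c v α) (j : ℕ) :
    j ≤ L → ∀ i < j, p i ≠ p j := by
  induction j using Nat.strong_induction_on with
  | _ j ih =>
    intro hj i hij heq
    obtain ⟨k, rfl⟩ : ∃ k, j = k + 1 := ⟨j - 1, by omega⟩
    have halt0 : ∀ i, alt α β i ≠ 0 := fun i => by unfold alt; grind
    have hk : k < L := by omega
    have hki : g.Inc (r k) (p i) := heq ▸ hw.snd_inc hk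
    have hadj : p k ≠ p (k + 1) := by
      rw [hw.snd k hk]; exact (hg.oth_ne (hw.mem k hk)).symm
    have hpk : p k = g.oth (r k) (p (k + 1)) := by
      rw [hw.snd k hk, oth_oth (hw.fst k hk)]
    -- The edge entering the repeated vertex has the color of r i or of r (i - 1), depending on
    -- parity. By properness it is that edge, and comparing the other ends gives an earlier
    -- repetition.
    by_cases hpar : k % 2 = i % 2
    · have hiL : i < L := by omega
      have : r k = r i := hc.eq (hw.mem k hk) (hw.mem i hiL) hki (hw.fst i hiL)
        (by rw [hw.col k hk, hw.col i hiL, alt_eq_of_parity hpar]) (by rw [hw.col k hk]; exact halt0 _)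
      have h2 : p k = p (i + 1) := by rw [hpk, ← heq, this, hw.snd i hiL]
      rcases Nat.lt_trichotomy (i + 1) k with h | h | h
      · exact ih k (by omega) (by omega) (i + 1) h h2.symm
      · omega
      · have : i = k := by omega
        subst this; exact hadj heq
    -- The start has no preceding edge; there the entering edge would have the color α, which is
    -- missing.
    · rcases Nat.eq_zero_or_pos i with rfl | hi0
      · refine hv (r k) (hw.mem k hk) (hw.start ▸ hki) ?_
        rw [hw.col k hk]; unfold alt; rw [if_neg (by omega)]
      · obtain ⟨i', rfl⟩ : ∃ i', i = i' + 1 := ⟨i - 1, by omega⟩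
        have hiL : i' < L := by omega
        have : r k = r i' := hc.eq (hw.mem k hk) (hw.mem i' hiL) hki (hw.snd_inc hiL)
          (by rw [hw.col k hk, hw.col i' hiL]; exact alt_eq_of_parity (by omega))
          (by rw [hw.col k hk]; exact halt0 _)
        have h2 : p k = p i' := by
          rw [hpk, ← heq, this, hw.snd i' hiL, oth_oth (hw.fst i' hiL)]
        exact ih k (by omega) (by omega) i' (by omega) h2.symm

theorem Walk.vertex_inj (hg : g.Simple) (hc : g.Proper q c) (hw : g.Walk c v α β L p r)
    (hα : α ≠ 0) (hβ : β ≠ 0) (hαβ : α ≠ β) (hv : g.Miss c v α) {i j : ℕ} (hi : i ≤ L) (hj : j ≤ L)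
    (h : p i = p j) : i = j := by
  rcases Nat.lt_trichotomy i j with hlt | h' | hlt
  · exact absurd h (hw.vertex_ne hg hc hα hβ hαβ hv j hj i hlt)
  · exact h'
  · exact absurd h.symm (hw.vertex_ne hg hc hα hβ hαβ hv i hi j hlt)

theorem Walk.edge_inj (hg : g.Simple) (hc : g.Proper q c) (hw : g.Walk c v α β L p r)
    (hα : α ≠ 0) (hβ : β ≠ 0) (hαβ : α ≠ β) (hv : g.Miss c v α) {i j : ℕ} (hi : i < L) (hj : j < L)
    (h : r i = r j) : i = j := by
  have key := @Walk.vertex_inj g c q v α β L p r hg hc hw hα hβ hαβ hv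
  have h1 := (inc_iff (hw.fst i hi) (p j)).1 (h ▸ hw.fst j hj)
  have h2 := (inc_iff (hw.fst i hi) (p (j + 1))).1 (h ▸ hw.snd_inc hj)
  rw [← hw.snd i hi] at h1 h2
  have e1 : p j = p i → j = i := key (by omega) (by omega)
  have e2 : p j = p (i + 1) → j = i + 1 := key (by omega) (by omega)
  have e3 : p (j + 1) = p i → j + 1 = i := key (by omega) (by omega)
  have e4 : p (j + 1) = p (i + 1) → j + 1 = i + 1 := key (by omega) (by omega)
  omega

/-- The edges of the walk are distinct. This makes the number of edges a sufficient iteration bound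
for tracing a path. -/
theorem Walk.length_le (hg : g.Simple) (hc : g.Proper q c) (hw : g.Walk c v α β L p r)
    (hα : α ≠ 0) (hβ : β ≠ 0) (hαβ : α ≠ β) (hv : g.Miss c v α) : L ≤ g.hi - g.lo := by
  rw [← card_E, ← Finset.card_range L]
  exact Finset.card_le_card_of_injOn r (fun i hi => hw.mem i (by simpa using hi))
    fun i hi j hj h => hw.edge_inj hg hc hα hβ hαβ hv (by simpa using hi) (by simpa using hj) h

/-- The vertices of the walk are distinct. This is the worst-case half of the bound for
Random-Color-One. -/
theorem Walk.length_le_vertices (hg : g.Simple) (hc : g.Proper q c) (hw : g.Walk c v α β L p r)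
    (hα : α ≠ 0) (hβ : β ≠ 0) (hαβ : α ≠ β) (hv : g.Miss c v α) {n : ℕ}
    (hn : ∀ e ∈ g.E, g.s e < n ∧ g.t e < n) : L ≤ n := by
  rw [← Finset.card_range L, ← Finset.card_range n]
  refine Finset.card_le_card_of_injOn p (fun i hi => ?_)
    fun i hi j hj h => hw.vertex_inj hg hc hα hβ hαβ hv (by simp at hi; omega)
      (by simp at hj; omega) h
  have hi : i < L := by simpa using hi
  have h1 := hn _ (hw.mem i hi)
  have h2 := hw.fst i hi
  unfold Inc at h2
  simp only [Finset.coe_range, Set.mem_Iio]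
  omega

/-- A walk is determined by one of its edges, its direction and its pair of colors. -/
theorem Walk.unique (hc : g.Proper q c) {v' α' β' L' : ℕ} {p' r' : ℕ → ℕ}
    (hw : g.Walk c v α β L p r) (hw' : g.Walk c v' α' β' L' p' r')
    (h0 : α ≠ 0 ∧ β ≠ 0 ∧ α' ≠ 0 ∧ β' ≠ 0)
    (hv : g.Miss c v α) (hv' : g.Miss c v' α') (i : ℕ) : ∀ i', i < L → i' < L' →
    p i = p' i' → alt α β i = alt α' β' i' → alt α β (i + 1) = alt α' β' (i' + 1) →
    i = i' ∧ v = v' ∧ α = α' ∧ β = β' := by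
  have h00 : ∀ i, alt α β i ≠ 0 ∧ alt α' β' i ≠ 0 := fun i => by unfold alt; grind
  induction i with
  | zero =>
    rintro (_ | i') hi hi' hp ha hb
    · exact ⟨rfl, by rw [← hw.start, ← hw'.start, hp], by simpa [alt] using hb,
        by simpa [alt] using ha⟩
    · exfalso
      -- Otherwise the second walk would enter the start of the first one by an edge of the color α,
      -- which is missing there.
      have : alt α' β' i' = α := by
        rw [alt_eq_of_parity (j := i' + 1 + 1) (by omega), ← hb]; simp [alt]
      refine hv (r' i') (hw'.mem i' (by omega)) ?_ (by rw [hw'.col i' (by omega), this])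
      rw [← hw.start, hp]; exact hw'.snd_inc (by omega)
  | succ i ih =>
    rintro (_ | i') hi hi' hp ha hb
    · exfalso
      have : alt α β i = α' := by
        rw [alt_eq_of_parity (j := i + 1 + 1) (by omega), hb]; simp [alt]
      refine hv' (r i) (hw.mem i (by omega)) ?_ (by rw [hw.col i (by omega), this])
      rw [← hw'.start, ← hp]; exact hw.snd_inc (by omega)
    -- Both walks enter the common vertex by an edge of the same color, hence by the same edge, and
    -- the comparison moves one step back.
    · have e : alt α β i = alt α' β' i' := by
        rw [alt_eq_of_parity (j := i + 1 + 1) (by omega), hb]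
        exact alt_eq_of_parity (by omega)
      have h1 : r i = r' i' := hc.eq (hw.mem i (by omega)) (hw'.mem i' (by omega))
        (hw.snd_inc (by omega)) (hp ▸ hw'.snd_inc (by omega))
        (by rw [hw.col i (by omega), hw'.col i' (by omega), e])
        (by rw [hw.col i (by omega)]; exact (h00 i).1)
      have h2 : p i = p' i' := by
        rw [← oth_oth (hw.fst i (by omega)), ← hw.snd i (by omega), h1, hp,
          hw'.snd i' (by omega), oth_oth (hw'.fst i' (by omega))]
      have := ih i' (by omega) (by omega) h2 e ha
      exact ⟨by omega, this.2⟩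

/-! ### Flipping a maximal alternating walk -/

/-- Interchanges the colors `α` and `β` on the edges `r 0, …, r (L - 1)`. -/
def flip (c r : ℕ → ℕ) (α β L e : ℕ) : ℕ :=
  if ∃ i < L, r i = e then (if c e = α then β else α) else c e

theorem flip_eq_zero (hw : g.Walk c v α β L p r) (hα : α ≠ 0) (hβ : β ≠ 0) (e : ℕ) :
    flip c r α β L e = 0 ↔ c e = 0 := by
  unfold flip
  split
  · rename_i h
    obtain ⟨i, hi, rfl⟩ := h
    have := hw.col i hi
    have := alt_eq_or α β i
    split <;> grind
  · rfl

theorem Walk.flip_edge (hw : g.Walk c v α β L p r) {i : ℕ} (hi : i < L) (hαβ : α ≠ β) :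
    flip c r α β L (r i) = alt β α i := by
  unfold flip
  rw [if_pos ⟨i, hi, rfl⟩, hw.col i hi]
  unfold alt; grind

theorem flip_eq_iff (hw : g.Walk c v α β L p r) {γ : ℕ} (h1 : γ ≠ α) (h2 : γ ≠ β) (e : ℕ) :
    flip c r α β L e = γ ↔ c e = γ := by
  unfold flip
  split
  · rename_i h
    obtain ⟨i, hi, rfl⟩ := h
    have := hw.col i hi
    have := alt_eq_or α β i
    split <;> grind
  · rfl

/-- The edges of a maximal alternating walk are closed under adjacency in the two colors. -/
theorem Walk.closed (hc : g.Proper q c) (hw : g.Walk c v α β L p r)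
    (hα : α ≠ 0) (hβ : β ≠ 0) (hαβ : α ≠ β) (hv : g.Miss c v α)
    (hmax : g.Miss c (p L) (alt α β L)) {i f x : ℕ} (hi : i < L) (hf : f ∈ g.E)
    (hix : g.Inc (r i) x) (hfx : g.Inc f x) (hcf : c f = alt α β (i + 1)) : ∃ j < L, r j = f := by
  have halt0 : ∀ i, alt α β i ≠ 0 := fun i => by unfold alt; grind
  rcases (inc_iff (hw.fst i hi) x).1 hix with rfl | hx
  · rcases Nat.eq_zero_or_pos i with rfl | hi0
    · refine absurd ?_ (hv f hf (hw.start ▸ hfx))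
      rw [hcf]; simp [alt]
    · obtain ⟨k, rfl⟩ : ∃ k, i = k + 1 := ⟨i - 1, by omega⟩
      refine ⟨k, by omega, hc.eq (hw.mem k (by omega)) hf (hw.snd_inc (by omega)) hfx ?_ ?_⟩
      · rw [hw.col k (by omega), hcf]; exact alt_eq_of_parity (by omega)
      · rw [hw.col k (by omega)]; exact halt0 _
  · rw [← hw.snd i hi] at hx
    subst hx
    by_cases hiL : i + 1 < L
    · exact ⟨i + 1, hiL, hc.eq (hw.mem _ hiL) hf (hw.fst _ hiL) hfx (by rw [hw.col _ hiL, hcf])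
        (by rw [hw.col _ hiL]; exact halt0 _)⟩
    · have : i + 1 = L := by omega
      subst this
      exact absurd hcf (hmax f hf hfx)

/-- Between two edges of the walk, exchanging α and β preserves distinctness. An adjacent edge off
the walk cannot have the new color of a walk edge, since by `Walk.closed` it would then belong to
the walk. -/
theorem Walk.flip_proper (hc : g.Proper q c) (hw : g.Walk c v α β L p r)
    (hα : α ≠ 0) (hβ : β ≠ 0) (hαβ : α ≠ β) (hα' : α ≤ q) (hβ' : β ≤ q) (hv : g.Miss c v α)
    (hmax : g.Miss c (p L) (alt α β L)) : g.Proper q (flip c r α β L) where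
  le e he := by
    have := hc.le e he
    unfold flip; split <;> [split; skip] <;> omega
  ne := by
    have key : ∀ e ∈ g.E, ∀ f ∈ g.E, ∀ x, g.Inc e x → g.Inc f x → (∃ i < L, r i = e) →
        ¬ (∃ i < L, r i = f) → flip c r α β L e ≠ c f := by
      rintro e he f hf x hex hfx ⟨i, hi, rfl⟩ hnf h
      rw [hw.flip_edge hi hαβ, alt_swap] at h
      exact hnf (hw.closed hc hα hβ hαβ hv hmax hi hf hex hfx h.symm)
    intro e he f hf hne x hex hfx h0 h
    by_cases h1 : ∃ i < L, r i = e <;> by_cases h2 : ∃ i < L, r i = f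
    · refine hne ?_
      obtain ⟨i, hi, rfl⟩ := h1
      obtain ⟨j, hj, rfl⟩ := h2
      rw [hw.flip_edge hi hαβ, hw.flip_edge hj hαβ] at h
      refine hc.eq he hf hex hfx ?_ ?_
      · rw [hw.col i hi, hw.col j hj]
        unfold alt at *; grind
      · rw [hw.col i hi]; unfold alt; grind
    · exact key e he f hf x hex hfx h1 h2 (by rw [h]; unfold flip; rw [if_neg h2])
    · exact key f hf e he x hfx hex h2 h1 (by rw [← h]; unfold flip; rw [if_neg h1])
    · unfold flip at h h0
      rw [if_neg h1, if_neg h2] at h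
      rw [if_neg h1] at h0
      exact hc.ne e he f hf hne x hex hfx h0 h

/-- After the flip, `β` is missing at the vertices other than the end of the walk where `β` was missing,
and at the start. -/
theorem Walk.flip_miss (hc : g.Proper q c) (hw : g.Walk c v α β L p r)
    (hα : α ≠ 0) (hβ : β ≠ 0) (hαβ : α ≠ β) (hv : g.Miss c v α)
    (hmax : g.Miss c (p L) (alt α β L)) {x : ℕ} (h : x = v ∨ g.Miss c x β ∧ x ≠ p L) :
    g.Miss (flip c r α β L) x β := by
  intro e he hex hce
  by_cases h1 : ∃ i < L, r i = e
  · obtain ⟨i, hi, rfl⟩ := h1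
    rw [hw.flip_edge hi hαβ] at hce
    -- An edge that turns β was an α-edge at an odd position, so each of its ends other than the end
    -- of the walk also met a neighbouring β-edge of the walk.
    have hodd : i % 2 = 1 := by unfold alt at hce; grind
    have hci : c (r i) = α := by rw [hw.col i hi]; unfold alt; grind
    rcases h with rfl | ⟨hm, hne⟩
    · exact hv _ he hex hci
    rcases (inc_iff (hw.fst i hi) x).1 hex with rfl | hx
    · obtain ⟨k, rfl⟩ : ∃ k, i = k + 1 := ⟨i - 1, by omega⟩
      refine hm (r k) (hw.mem k (by omega)) (hw.snd_inc (by omega)) ?_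
      rw [hw.col k (by omega)]; unfold alt; rw [if_pos (by omega)]
    · rw [← hw.snd i hi] at hx
      subst hx
      have hiL : i + 1 < L := by
        rcases Nat.lt_or_ge (i + 1) L with h | h
        · exact h
        · exact absurd (by rw [show i + 1 = L by omega]) hne
      refine hm (r (i + 1)) (hw.mem _ hiL) (hw.fst _ hiL) ?_
      rw [hw.col _ hiL]; unfold alt; rw [if_pos (by omega)]
  · have hce' : c e = β := by unfold flip at hce; rwa [if_neg h1] at hce
    rcases h with rfl | ⟨hm, hne⟩
    · refine h1 ?_
      rcases Nat.eq_zero_or_pos L with rfl | hL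
      · exact absurd (by rw [hce']; simp [alt]) (hmax e he (hw.start ▸ hex))
      · refine ⟨0, hL, hc.eq (hw.mem 0 hL) he (hw.start ▸ hw.fst 0 hL) hex ?_ ?_⟩
        · rw [hw.col 0 hL, hce']; simp [alt]
        · rw [hw.col 0 hL]; simpa [alt] using hβ
    · exact hm e he hex hce'

/-- After the flip, `α` is missing at the end of the walk if `β` was missing there. -/
theorem Walk.flip_miss_end (hc : g.Proper q c) (hw : g.Walk c v α β L p r)
    (hα : α ≠ 0) (hαβ : α ≠ β) (hm : g.Miss c (p L) β) (hL : p L ≠ v) :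
    g.Miss (flip c r α β L) (p L) α := by
  intro e he hex hce
  have hL0 : 0 < L := by
    rcases Nat.eq_zero_or_pos L with rfl | h
    · exact absurd hw.start hL
    · exact h
  by_cases h1 : ∃ i < L, r i = e
  · obtain ⟨i, hi, rfl⟩ := h1
    rw [hw.flip_edge hi hαβ] at hce
    refine hm _ he hex ?_
    rw [hw.col i hi]; unfold alt at *; grind
  · have hce' : c e = α := by unfold flip at hce; rwa [if_neg h1] at hce
    obtain ⟨k, rfl⟩ : ∃ k, L = k + 1 := ⟨L - 1, by omega⟩
    have hk := hw.snd_inc (Nat.lt_succ_self k)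
    have : c (r k) = α := by
      rcases alt_eq_or α β k with h | h
      · rw [hw.col k (by omega), h]
      · exact absurd (by rw [hw.col k (by omega), h]) (hm (r k) (hw.mem k (by omega)) hk)
    exact h1 ⟨k, by omega, hc.eq (hw.mem k (by omega)) he hk hex (by rw [this, hce'])
      (by rw [this]; exact hα)⟩

/-! ### Fans -/

/-- The edges `F 0, …, F k` are a fan with center `v`. -/
structure Fan (g : EdgeList) (c : ℕ → ℕ) (v k : ℕ) (F : ℕ → ℕ) : Prop where
  mem : ∀ i ≤ k, F i ∈ g.E
  inc : ∀ i ≤ k, g.Inc (F i) v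
  inj : ∀ i ≤ k, ∀ j ≤ k, F i = F j → i = j
  zero : c (F 0) = 0
  ne : ∀ i < k, c (F (i + 1)) ≠ 0
  miss : ∀ i < k, g.Miss c (g.oth (F i) v) (c (F (i + 1)))

variable {k : ℕ} {F : ℕ → ℕ}

/-- The k + 1 fan edges are distinct edges at the center; this bounds the number of iterations of
`growFan`. -/
theorem Fan.lt_deg (hF : g.Fan c v k F) : k < g.deg v := by
  have : (Finset.range (k + 1)).card ≤ (g.star v).card :=
    Finset.card_le_card_of_injOn F
      (fun i hi => mem_star.2 ⟨hF.mem i (by simp at hi; omega), hF.inc i (by simp at hi; omega)⟩)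
      fun i hi j hj h => hF.inj i (by simp at hi; omega) j (by simp at hj; omega) h
  simpa [deg] using this

/-- Shifting: the edges `F 0, …, F (i - 1)` get the colors of `F 1, …, F i`, and `F i` is uncolored. -/
def shift (c F : ℕ → ℕ) : ℕ → ℕ → ℕ
  | 0 => c
  | i + 1 => Function.update (Function.update (shift c F i) (F (i + 1)) 0) (F i) (c (F (i + 1)))

theorem shift_of_ne (i : ℕ) {e : ℕ} (h : ∀ j ≤ i, e ≠ F j) : shift c F i e = c e := by
  induction i with
  | zero => rfl
  | succ i ih =>
    rw [shift, Function.update_of_ne (h i (by omega)), Function.update_of_ne (h (i + 1) le_rfl),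
      ih fun j hj => h j (by omega)]

theorem Fan.shift_later (hF : g.Fan c v k F) {i j : ℕ} (hij : i < j) (hj : j ≤ k) :
    shift c F i (F j) = c (F j) := by
  refine shift_of_ne i fun l hl h => ?_
  have := hF.inj j hj l (by omega) h
  omega

theorem Fan.shift_self (hF : g.Fan c v k F) {i : ℕ} (hi : i ≤ k) : shift c F i (F i) = 0 := by
  cases i with
  | zero => exact hF.zero
  | succ i =>
    have : F (i + 1) ≠ F i := fun h => by have := hF.inj _ hi _ (by omega) h; omega
    simp [shift, this]

theorem Fan.shift_eq_zero (hF : g.Fan c v k F) {i : ℕ} (hi : i ≤ k) (e : ℕ) :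
    shift c F i e = 0 ↔ e = F i ∨ (c e = 0 ∧ e ≠ F 0) := by
  induction i generalizing e with
  | zero => have := hF.zero; simp only [shift]; grind
  | succ i ih =>
    have h1 : F (i + 1) ≠ F i := fun h => by have := hF.inj _ hi _ (by omega) h; omega
    have h2 : F (i + 1) ≠ F 0 := fun h => by have := hF.inj _ hi _ (by omega) h; omega
    have h3 := hF.ne i (by omega)
    have := ih (by omega) e
    by_cases he : e = F i
    · subst he
      rw [shift, Function.update_self]
      constructor
      · exact fun h => absurd h h3
      · rintro (h | ⟨h, h'⟩)
        · exact absurd h.symm h1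
        · obtain ⟨l, rfl⟩ : ∃ l, i = l + 1 := ⟨i - 1, by
            have : i ≠ 0 := by rintro rfl; exact h' rfl
            omega⟩
          exact absurd h (hF.ne l (by omega))
    · rw [shift, Function.update_of_ne he]
      by_cases he' : e = F (i + 1)
      · simp [he']
      · rw [Function.update_of_ne he', this]; simp [he, he']

/-- A shift only moves colors among the edges at the center, so no color appears there that was
absent before. -/
theorem Fan.shift_miss_center (hF : g.Fan c v k F) {i γ : ℕ} (hi : i ≤ k) (hγ : γ ≠ 0)
    (h : g.Miss c v γ) : g.Miss (shift c F i) v γ := by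
  induction i with
  | zero => exact h
  | succ i ih =>
    intro e he hev
    rw [shift, Function.update_apply, Function.update_apply]
    split
    · exact h _ (hF.mem _ hi) (hF.inc _ hi)
    · split
      · exact hγ.symm
      · exact ih (by omega) e he hev

/-- In a simple graph the only fan edge at the leaf of F j is F j itself. For j = i it has just
become uncolored, and for j > i it has not been touched. -/
theorem Fan.shift_miss_leaf (hF : g.Fan c v k F) (hg : g.Simple) {i j γ : ℕ} (hij : i ≤ j)
    (hj : j ≤ k) (hγ : γ ≠ 0) (h : g.Miss c (g.oth (F j) v) γ) :
    g.Miss (shift c F i) (g.oth (F j) v) γ := by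
  intro e he hev
  by_cases hl : ∃ l ≤ i, e = F l
  · obtain ⟨l, hl, rfl⟩ := hl
    have h1 : F l = F j := hg.eq_of_inc he (hF.mem j hj) (hg.oth_ne (hF.mem j hj)).symm
      (hF.inc l (by omega)) hev (hF.inc j hj) (inc_oth (hF.inc j hj))
    have h2 := hF.inj l (by omega) j hj h1
    have : l = i := by omega
    subst this
    rw [hF.shift_self (by omega)]; exact hγ.symm
  · rw [shift_of_ne i fun l hl' h => hl ⟨l, hl', h⟩]
    exact h e he hev

/-- One step at a time: uncoloring F (i + 1) frees its color at the center, and the fan condition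
says that this color is missing at the leaf of F i, so F i may receive it. -/
theorem Fan.shift_proper (hF : g.Fan c v k F) (hg : g.Simple) (hc : g.Proper q c) {i : ℕ}
    (hi : i ≤ k) : g.Proper q (shift c F i) := by
  induction i with
  | zero => exact hc
  | succ i ih =>
    have ih := ih (by omega)
    set c' := Function.update (shift c F i) (F (i + 1)) 0 with hc'
    have hsub : ∀ e ∈ g.E, c' e = 0 ∨ c' e = shift c F i e := by
      intro e he
      rw [hc', Function.update_apply]; split <;> simp
    have hcol := hF.shift_later (Nat.lt_succ_self i) hi
    have hv : g.Miss c' v (c (F (i + 1))) := by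
      rw [← hcol]
      exact ih.miss_of_sub hsub (hF.mem _ hi) (hF.inc _ hi) (by rw [hcol]; exact hF.ne i (by omega))
        (by simp [hc'])
    have hl : g.Miss c' (g.oth (F i) v) (c (F (i + 1))) := by
      intro e he hev
      rw [hc', Function.update_apply]
      split
      · exact (hF.ne i (by omega)).symm
      · exact hF.shift_miss_leaf hg le_rfl (by omega) (hF.ne i (by omega)) (hF.miss i (by omega))
          e he hev
    have hst : ∀ x, g.Inc (F i) x → g.Miss c' x (c (F (i + 1))) := by
      intro x hx
      rcases (inc_iff (hF.inc i (by omega)) x).1 hx with rfl | rfl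
      · exact hv
      · exact hl
    exact (ih.of_sub hsub).color (hc.le _ (hF.mem _ hi)) (hst _ (inc_s _)) (hst _ (inc_t _))

end EdgeList

/-! ### Sets stored in arrays -/

section StoresSet
variable {m m' : Mem} {arr pos cnt : Arr} {off c x : ℕ} {S : Set ℕ}

theorem StoresSet.arr_inj (h : StoresSet m arr pos cnt off c S) {i j : ℕ} (hi : i < m cnt c)
    (hj : j < m cnt c) (hij : m arr (off + i) = m arr (off + j)) : i = j := by
  rw [← (h.elem i hi).2, ← (h.elem j hj).2, hij]

theorem StoresSet.cnt_eq_card (h : StoresSet m arr pos cnt off c S) {F : Finset ℕ}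
    (hF : ∀ x, x ∈ S ↔ x ∈ F) : m cnt c = F.card := by
  rw [← Finset.card_range (m cnt c)]
  refine Finset.card_bij (fun i _ => m arr (off + i))
    (fun i hi => (hF _).1 (h.elem i (Finset.mem_range.1 hi)).1)
    (fun i hi j hj e => h.arr_inj (Finset.mem_range.1 hi) (Finset.mem_range.1 hj) e) fun x hx => ?_
  have := h.index x ((hF x).2 hx)
  exact ⟨_, Finset.mem_range.2 this.1, this.2⟩

theorem StoresSet.cnt_le (h : StoresSet m arr pos cnt off c S) {F : Finset ℕ}
    (hF : ∀ x ∈ S, x ∈ F) : m cnt c ≤ F.card := by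
  rw [← Finset.card_range (m cnt c)]
  exact Finset.card_le_card_of_injOn (fun i => m arr (off + i))
    (fun i hi => hF _ (h.elem i (by simpa using hi)).1)
    fun i hi j hj e => h.arr_inj (by simpa using hi) (by simpa using hj) e

theorem StoresSet.congr (h : StoresSet m arr pos cnt off c S) (h1 : m' arr = m arr)
    (h2 : m' pos = m pos) (h3 : m' cnt c = m cnt c) : StoresSet m' arr pos cnt off c S :=
  ⟨by rw [h1, h2, h3]; exact h.elem, by rw [h1, h2, h3]; exact h.index⟩

/-- A set of numbers at most k, with at most k elements, only involves the cells off, …, off + k.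
Writes into the blocks of other vertices therefore do no harm. -/
theorem StoresSet.congr_block (h : StoresSet m arr pos cnt off c S) {k : ℕ}
    (hS : ∀ x ∈ S, x ≤ k) (hk : m cnt c ≤ k) (h1 : ∀ i ≤ k, m' arr (off + i) = m arr (off + i))
    (h2 : ∀ i ≤ k, m' pos (off + i) = m pos (off + i)) (h3 : m' cnt c = m cnt c) :
    StoresSet m' arr pos cnt off c S where
  elem i hi := by
    rw [h3] at hi
    have := h.elem i hi
    rw [h1 i (by omega), h2 _ (hS _ this.1)]
    exact this
  index x hx := by
    have := h.index x hx
    rw [h2 x (hS x hx), h3, h1 _ (by omega)]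
    exact this

theorem StoresSet.insert (h : StoresSet m arr pos cnt off c S) (hx : x ∉ S)
    (h1 : m' arr = Function.update (m arr) (off + m cnt c) x)
    (h2 : m' pos = Function.update (m pos) (off + x) (m cnt c)) (h3 : m' cnt c = m cnt c + 1) :
    StoresSet m' arr pos cnt off c (insert x S) where
  elem i hi := by
    rw [h3] at hi
    rcases Nat.lt_succ_iff_lt_or_eq.1 hi with hi | rfl
    · have := h.elem i hi
      have hne : m arr (off + i) ≠ x := fun e => hx (e ▸ this.1)
      rw [h1, h2, Function.update_of_ne (by omega), Function.update_of_ne (by omega)]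
      exact ⟨Or.inr this.1, this.2⟩
    · simp [h1, h2]
  index y hy := by
    rcases hy with rfl | hy
    · simp [h1, h2, h3]
    · have := h.index y hy
      have hne : y ≠ x := fun e => hx (e ▸ hy)
      rw [h2, h3, h1, Function.update_of_ne (by omega), Function.update_of_ne (by omega)]
      exact ⟨by omega, this.2⟩

/-- The last element y fills the gap at position p. If x is itself the last element, both writes
change nothing and only the counter drops. -/
theorem StoresSet.remove (h : StoresSet m arr pos cnt off c S) (hx : x ∈ S)
    (h1 : m' arr = Function.update (m arr) (off + m pos (off + x)) (m arr (off + (m cnt c - 1))))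
    (h2 : m' pos = Function.update (m pos) (off + m arr (off + (m cnt c - 1))) (m pos (off + x)))
    (h3 : m' cnt c = m cnt c - 1) :
    StoresSet m' arr pos cnt off c (S \ {x}) := by
  have hp := h.index x hx
  have hl := h.elem (m cnt c - 1) (by omega)
  set k := m cnt c with hk
  set p := m pos (off + x) with hpdef
  set y := m arr (off + (k - 1)) with hy
  constructor
  · intro i hi
    rw [h3] at hi
    by_cases hip : i = p
    · subst hip
      rw [h1, h2, Function.update_self, Function.update_self]
      refine ⟨⟨hl.1, ?_⟩, rfl⟩
      rintro rfl
      omega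
    · have := h.elem i (by omega)
      have hne : m arr (off + i) ≠ y := fun e => by
        have := h.arr_inj (i := i) (j := k - 1) (by omega) (by omega) e
        omega
      rw [h1, h2, Function.update_of_ne (by omega), Function.update_of_ne (by omega)]
      refine ⟨⟨this.1, fun e => hip ?_⟩, this.2⟩
      rw [Set.mem_singleton_iff] at e
      rw [← this.2, e]
  · rintro z ⟨hz, hzx⟩
    have hzx : z ≠ x := hzx
    have hiz := h.index z hz
    have hpz : m pos (off + z) ≠ p := fun e => hzx (by rw [← hiz.2, e, hp.2])
    by_cases hzy : z = y
    · rw [h1, h2, h3, hzy, Function.update_self, Function.update_self]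
      refine ⟨?_, rfl⟩
      have : p ≠ k - 1 := fun e => hzx (by rw [hzy, ← hp.2, e])
      omega
    · rw [h1, h2, h3, Function.update_of_ne (by omega), Function.update_of_ne (by omega)]
      refine ⟨?_, hiz.2⟩
      have : m pos (off + z) ≠ k - 1 := fun e => hzy (by rw [← hiz.2, e])
      omega

end StoresSet

/-! ### Table addresses and the primitive set operations. -/

/-- Rules and simplifications for stepping through a program. -/
theorem cell_zero_add (d v γ : ℕ) : cell d v 0 + γ = cell d v γ := by simp [cell]

/-- Rows have length d + 2, which exceeds the largest admissible second coordinate d + 1, so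
different rows do not overlap. -/
theorem cell_inj {d v w γ δ : ℕ} (hγ : γ ≤ d + 1) (hδ : δ ≤ d + 1) (h : cell d v γ = cell d w δ) :
    v = w ∧ γ = δ := by
  unfold cell at h
  have h1 : v = w := by
    rcases Nat.lt_trichotomy v w with hlt | h' | hlt
    · have : (v + 1) * (d + 2) ≤ w * (d + 2) := Nat.mul_le_mul_right _ hlt
      rw [add_mul] at this; omega
    · exact h'
    · have : (w + 1) * (d + 2) ≤ v * (d + 2) := Nat.mul_le_mul_right _ hlt
      rw [add_mul] at this; omega
  subst h1
  exact ⟨rfl, by omega⟩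

theorem setInsert_wp (arr pos cnt : Arr) (off c x : ℕ) (m : Mem) (t : ℕ)
    (Q : Unit → Mem → ℕ → Prop) (hap : pos ≠ arr) (hac : cnt ≠ arr) (hpc : cnt ≠ pos) :
    wp (setInsert arr pos cnt off c x) m t Q ↔
      Q () (((m.set arr (off + m cnt c) x).set pos (off + x) (m cnt c)).set cnt c (m cnt c + 1))
        (t + 4) := Iff.rfl

theorem setRemove_wp (arr pos cnt : Arr) (off c x : ℕ) (m : Mem) (t : ℕ)
    (Q : Unit → Mem → ℕ → Prop) :
    wp (setRemove arr pos cnt off c x) m t Q ↔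
      Q () (((m.set arr (off + m pos (off + x)) (m arr (off + (m cnt c - 1)))).set pos
        (off + m arr (off + (m cnt c - 1))) (m pos (off + x))).set cnt c (m cnt c - 1))
        (t + 6) := Iff.rfl

/-! ### The sets `μ(v)` -/

variable {g : EdgeList} {d q : ℕ} {c : ℕ → ℕ} {m : Mem}

/-- The sets `M v` are stored as the sets `μ(v)`, and the degrees are known. -/
structure Mu (g : EdgeList) (d : ℕ) (M : ℕ → Set ℕ) (m : Mem) : Prop where
  deg : ∀ v, (g.star v).Nonempty → m .deg v = g.deg v
  le : ∀ v, (g.star v).Nonempty → g.deg v ≤ d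
  sub : ∀ v, (g.star v).Nonempty → ∀ x ∈ M v, 1 ≤ x ∧ x ≤ g.deg v + 1
  mu : ∀ v, (g.star v).Nonempty → StoresSet m .muArr .muPos .muCnt (cell d v 0) v (M v)

theorem Mu.congr {M M' : ℕ → Set ℕ} {m' : Mem} (h : Mu g d M m)
    (hM : ∀ v, (g.star v).Nonempty → M' v = M v)
    (h0 : m' .deg = m .deg) (h1 : m' .muArr = m .muArr) (h2 : m' .muPos = m .muPos)
    (h3 : m' .muCnt = m .muCnt) : Mu g d M' m' where
  deg v hv := by rw [h0]; exact h.deg v hv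
  le := h.le
  sub v hv := by rw [hM v hv]; exact h.sub v hv
  mu v hv := by rw [hM v hv]; exact (h.mu v hv).congr h1 h2 (by rw [h3])

theorem Mu.cnt_le {M : ℕ → Set ℕ} (h : Mu g d M m) {v : ℕ} (hv : (g.star v).Nonempty) :
    m .muCnt v ≤ d + 1 := by
  have := (h.mu v hv).cnt_le (F := Finset.Icc 1 (g.deg v + 1))
    fun x hx => Finset.mem_Icc.2 (h.sub v hv x hx)
  have := h.le v hv
  simp at *
  omega

/-- All writes go to the row of v, which is disjoint from the row of w. -/
theorem Mu.frame {M : ℕ → Set ℕ} (h : Mu g d M m) {v w i j x y z : ℕ} (hw : (g.star w).Nonempty)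
    (hne : w ≠ v) (hi : i ≤ d + 1) (hj : j ≤ d + 1) :
    StoresSet (((m.set .muArr (cell d v i) x).set .muPos (cell d v j) y).set .muCnt v z)
      .muArr .muPos .muCnt (cell d w 0) w (M w) := by
  refine (h.mu w hw).congr_block (k := d + 1) (fun x hx => ?_) (h.cnt_le hw) ?_ ?_ ?_
  · have := h.sub w hw x hx
    have := h.le w hw
    omega
  · intro l hl
    simp only [Mem.set_self, Mem.set_of_ne, ne_eq, reduceCtorEq, not_false_eq_true]
    rw [Function.update_of_ne]
    intro h
    rw [cell_zero_add] at h
    exact hne (cell_inj hl hi h).1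
  · intro l hl
    simp only [Mem.set_self, Mem.set_of_ne, ne_eq, reduceCtorEq, not_false_eq_true]
    rw [Function.update_of_ne]
    intro h
    rw [cell_zero_add] at h
    exact hne (cell_inj hl hj h).1
  · rw [Mem.set_self, Function.update_of_ne hne]; rfl

/-- The conditional singleton covers both branches of the program in one formula: colors above deg v
+ 1 are not recorded. -/
theorem muInsert_spec {M : ℕ → Set ℕ} (h : Mu g d M m) {v γ : ℕ} (hv : (g.star v).Nonempty)
    (h1 : 1 ≤ γ) (hγ : γ ∉ M v) :
    Spec (muInsert d v γ) m 5 fun _ m' =>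
      Mu g d (Function.update M v (M v ∪ {x | x = γ ∧ x ≤ g.deg v + 1})) m' ∧
      ∀ a, a ≠ .muArr → a ≠ .muPos → a ≠ .muCnt → m' a = m a := by
  intro t
  unfold muInsert
  simp only [wp_bind, wp_read, wp_ite, wp_pure]
  rw [setInsert_wp _ _ _ _ _ _ _ _ _ (by decide) (by decide) (by decide), h.deg v hv]
  refine ⟨fun hle => ⟨by omega, ?_, ?_⟩, fun hle => ⟨by omega, ?_, by simp⟩⟩
  · have hd := h.le v hv
    refine ⟨fun w hw => by rw [← h.deg w hw]; rfl, h.le, fun w hw x hx => ?_, fun w hw => ?_⟩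
    · by_cases hwv : w = v
      · subst hwv
        rw [Function.update_self] at hx
        rcases hx with hx | ⟨rfl, hx⟩
        · exact h.sub w hw x hx
        · exact ⟨h1, hx⟩
      · rw [Function.update_of_ne hwv] at hx
        exact h.sub w hw x hx
    · by_cases hwv : w = v
      · subst hwv
        rw [Function.update_self]
        have : M w ∪ {x | x = γ ∧ x ≤ g.deg w + 1} = insert γ (M w) := by
          ext x
          simp only [Set.mem_union, Set.mem_ofPred_eq, Set.mem_insert_iff]
          constructor
          · rintro (h | h); exacts [Or.inr h, Or.inl h.1]
          · rintro (rfl | h); exacts [Or.inr ⟨rfl, hle⟩, Or.inl h]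
        rw [this]
        refine (h.mu w hw).insert hγ ?_ ?_ ?_ <;>
        simp [Mem.set_self, Mem.set_of_ne]
      · rw [Function.update_of_ne hwv, cell_zero_add, cell_zero_add]
        exact h.frame hw hwv (h.cnt_le hv) (by omega)
  · intro a ha hb hc
    rw [Mem.set_of_ne _ hc, Mem.set_of_ne _ hb, Mem.set_of_ne _ ha]
  · refine h.congr (fun w hw => ?_) rfl rfl rfl rfl
    by_cases hwv : w = v
    · subst hwv
      rw [Function.update_self]
      ext x
      simp only [Set.mem_union, Set.mem_ofPred_eq]
      constructor
      · rintro (h | ⟨rfl, h⟩); exacts [h, absurd h hle]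
      · exact Or.inl
    · rw [Function.update_of_ne hwv]

theorem muRemove_spec {M : ℕ → Set ℕ} (h : Mu g d M m) {v γ : ℕ} (hv : (g.star v).Nonempty)
    (hγ : γ ≤ g.deg v + 1 → γ ∈ M v) :
    Spec (muRemove d v γ) m 7 fun _ m' =>
      Mu g d (Function.update M v (M v \ {γ})) m' ∧
      ∀ a, a ≠ .muArr → a ≠ .muPos → a ≠ .muCnt → m' a = m a := by
  intro t
  unfold muRemove
  simp only [wp_bind, wp_read, wp_ite, wp_pure]
  rw [setRemove_wp, h.deg v hv]
  refine ⟨fun hle => ⟨by omega, ?_, ?_⟩, fun hle => ⟨by omega, ?_, by simp⟩⟩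
  · have hd := h.le v hv
    have hidx := (h.mu v hv).index γ (hγ hle)
    have hcnt := h.cnt_le hv
    refine ⟨fun w hw => by rw [← h.deg w hw]; rfl, h.le, fun w hw x hx => ?_, fun w hw => ?_⟩
    · by_cases hwv : w = v
      · subst hwv
        rw [Function.update_self] at hx
        exact h.sub w hw x hx.1
      · rw [Function.update_of_ne hwv] at hx
        exact h.sub w hw x hx
    · by_cases hwv : w = v
      · subst hwv
        rw [Function.update_self]
        refine (h.mu w hw).remove (hγ hle) ?_ ?_ ?_ <;>
        simp [Mem.set_self, Mem.set_of_ne]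
      · rw [Function.update_of_ne hwv, cell_zero_add d v (m .muPos _), cell_zero_add d v (m .muArr _)]
        refine h.frame hw hwv (by omega) ?_
        have := h.sub v hv _ ((h.mu v hv).elem (m .muCnt v - 1) (by omega)).1
        omega
  · intro a ha hb hc
    rw [Mem.set_of_ne _ hc, Mem.set_of_ne _ hb, Mem.set_of_ne _ ha]
  · refine h.congr (fun w hw => ?_) rfl rfl rfl rfl
    by_cases hwv : w = v
    · subst hwv
      rw [Function.update_self]
      refine Set.sdiff_singleton_eq_self fun hm => hle (h.sub w hw _ hm).2
    · rw [Function.update_of_ne hwv]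

/-! ### The data structures -/

/-- The colors missing at `v` that are at most `deg v + 1`. -/
def muSet (g : EdgeList) (c : ℕ → ℕ) (v : ℕ) : Set ℕ := {x | (1 ≤ x ∧ x ≤ g.deg v + 1) ∧ g.Miss c v x}

theorem mem_muSet_update {e γ v x : ℕ} (he : e ∈ g.E) :
    x ∈ muSet g (Function.update c e γ) v ↔ (1 ≤ x ∧ x ≤ g.deg v + 1) ∧
      (∀ f ∈ g.E, g.Inc f v → f ≠ e → c f ≠ x) ∧ (g.Inc e v → x ≠ γ) := by
  refine and_congr_right fun _ => ⟨fun h => ⟨fun f hf hfv hfe => ?_, ?_⟩, fun h f hf hfv => ?_⟩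
  · have := h f hf hfv
    rwa [Function.update_of_ne hfe] at this
  · rintro hev rfl
    exact h e he hev (Function.update_self ..)
  · by_cases hfe : f = e
    · subst hfe
      rw [Function.update_self]
      exact (h.2 hfv).symm
    · rw [Function.update_of_ne hfe]
      exact h.1 f hf hfv hfe

/-- The data structures (without the color fields of the edge records) for the coloring `c`; the list
of uncolored edges holds the set `U`. -/
structure DS (g : EdgeList) (d : ℕ) (c : ℕ → ℕ) (U : Set ℕ) (m : Mem) : Prop where
  src : m .src = g.s
  dst : m .dst = g.t
  dict : ∀ e ∈ g.E, c e ≠ 0 → ∀ v, g.Inc e v → m .dict (cell d v (c e)) = e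
  mu : Mu g d (muSet g c) m
  unc : StoresSet m .unArr .unPos .unCnt 0 0 U

theorem DS.congr {c' : ℕ → ℕ} {U : Set ℕ} {m' : Mem} (h : DS g d c U m)
    (hc : ∀ e ∈ g.E, c' e = c e)
    (hm : ∀ a, a ≠ .col → a ≠ .fan → a ≠ .fanPos → a ≠ .path → a ≠ .scratch → m' a = m a) :
    DS g d c' U m' where
  src := by rw [hm _ (by decide) (by decide) (by decide) (by decide) (by decide), h.src]
  dst := by rw [hm _ (by decide) (by decide) (by decide) (by decide) (by decide), h.dst]
  dict := by
    rw [hm _ (by decide) (by decide) (by decide) (by decide) (by decide)]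
    intro e he
    rw [hc e he]
    exact h.dict e he
  mu := by
    refine h.mu.congr (fun v hv => ?_) ?_ ?_ ?_ ?_
    · ext x
      simp only [muSet, Set.mem_ofPred_eq, EdgeList.Miss]
      refine and_congr_right fun _ => forall_congr' fun e => forall_congr' fun he => ?_
      rw [hc e he]
    all_goals exact hm _ (by decide) (by decide) (by decide) (by decide) (by decide)
  unc := by
    refine h.unc.congr ?_ ?_ ?_ <;>
    rw [hm _ (by decide) (by decide) (by decide) (by decide) (by decide)]

/-- The arrays that are changed only outside the data structures. -/
def Frame (m m' : Mem) : Prop :=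
  ∀ a, a ≠ .col → a ≠ .dict → a ≠ .muArr → a ≠ .muPos → a ≠ .muCnt → a ≠ .unArr → a ≠ .unPos →
    a ≠ .unCnt → m' a = m a

theorem Frame.refl (m : Mem) : Frame m m := fun _ _ _ _ _ _ _ _ _ => rfl

theorem Frame.trans {m₁ m₂ m₃ : Mem} (h : Frame m₁ m₂) (h' : Frame m₂ m₃) : Frame m₁ m₃ :=
  fun a h1 h2 h3 h4 h5 h6 h7 h8 =>
    (h' a h1 h2 h3 h4 h5 h6 h7 h8).trans (h a h1 h2 h3 h4 h5 h6 h7 h8)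

theorem EdgeList.star_nonempty {e v : ℕ} (he : e ∈ g.E) (h : g.Inc e v) : (g.star v).Nonempty :=
  ⟨e, EdgeList.mem_star.2 ⟨he, h⟩⟩

/-- The coloring c and the list U are not tied to the color fields in memory. This generality is
needed while the structures are being set up, when the color fields of later edges are already
present but not yet entered. -/
theorem colorEdge_spec (hg : g.Simple) {U : Set ℕ} (h : DS g d c U m)
    (hc : g.Proper (d + 1) c) {e γ : ℕ} (he : e ∈ g.E) (hU : e ∈ U) (h0 : c e = 0)
    (h1 : 1 ≤ γ) (hγd : γ ≤ d + 1) (hγ : ∀ v, g.Inc e v → g.Miss c v γ) :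
    Spec (colorEdge d e γ) m 25 fun _ m' =>
      DS g d (Function.update c e γ) (U \ {e}) m' ∧ m' .col = Function.update (m .col) e γ ∧
      Frame m m' := by
  intro t
  unfold colorEdge
  simp only [wp_bind, wp_read, wp_write]
  rw [h.src, h.dst]
  have hs := EdgeList.star_nonempty he (g.inc_s e)
  have ht := EdgeList.star_nonempty he (g.inc_t e)
  have hne := hg.ne e he
  set m1 := ((m.set .col e γ).set .dict (cell d (g.s e) γ) e).set .dict (cell d (g.t e) γ) e with hm1
  have hMu1 : Mu g d (muSet g c) m1 := h.mu.congr (fun _ _ => rfl) rfl rfl rfl rfl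
  refine wp_mono (muRemove_spec hMu1 hs (fun hle => ⟨⟨h1, hle⟩, hγ _ (g.inc_s e)⟩) _) ?_
  rintro - m2 t2 ⟨ht2, hMu2, hf2⟩
  refine wp_mono (muRemove_spec hMu2 ht (fun hle => ?_) _) ?_
  · rw [Function.update_of_ne hne.symm]
    exact ⟨⟨h1, hle⟩, hγ _ (g.inc_t e)⟩
  rintro - m3 t3 ⟨ht3, hMu3, hf3⟩
  rw [setRemove_wp]
  have hf : ∀ a, a ≠ .muArr → a ≠ .muPos → a ≠ .muCnt → m3 a = m1 a := fun a h1 h2 h3 =>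
    (hf3 a h1 h2 h3).trans (hf2 a h1 h2 h3)
  have hunc : StoresSet m3 .unArr .unPos .unCnt 0 0 U := by
    refine h.unc.congr ?_ ?_ ?_ <;>
    rw [hf _ (by decide) (by decide) (by decide)] <;> rfl
  refine ⟨by omega, ⟨?_, ?_, ?_, ?_, ?_⟩, ?_, ?_⟩
  · simp only [Mem.set_of_ne, ne_eq, reduceCtorEq, not_false_eq_true]
    rw [hf _ (by decide) (by decide) (by decide), ← h.src]; rfl
  · simp only [Mem.set_of_ne, ne_eq, reduceCtorEq, not_false_eq_true]
    rw [hf _ (by decide) (by decide) (by decide), ← h.dst]; rfl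
  · intro f hf' hf0 v hfv
    simp only [Mem.set_of_ne, ne_eq, reduceCtorEq, not_false_eq_true]
    rw [hf _ (by decide) (by decide) (by decide), hm1]
    simp only [Mem.set_self, Mem.set_of_ne, ne_eq, reduceCtorEq, not_false_eq_true]
    rw [Function.update_apply] at hf0
    by_cases hfe : f = e
    · subst hfe
      rw [Function.update_self]
      rcases hfv with rfl | rfl
      · rw [Function.update_apply]; split <;> simp
      · rw [Function.update_self]
    · rw [if_neg hfe] at hf0
      have hle := hc.le f hf'
      rw [Function.update_of_ne hfe]
      -- No other edge owns one of the two overwritten dictionary cells, because γ is missing at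
      -- both endpoints of e.
      have key : ∀ u, g.Inc e u → cell d v (c f) ≠ cell d u γ := by
        intro u hu heq
        obtain ⟨rfl, heq'⟩ := cell_inj (by omega) hγd heq
        exact hγ v hu f hf' hfv heq'
      rw [Function.update_of_ne (key _ (g.inc_t e)), Function.update_of_ne (key _ (g.inc_s e))]
      exact h.dict f hf' hf0 v hfv
  · refine hMu3.congr (fun v hv => ?_) rfl rfl rfl rfl
    have key : ∀ v, muSet g (Function.update c e γ) v =
        if g.Inc e v then muSet g c v \ {γ} else muSet g c v := by
      intro v
      ext x
      rw [mem_muSet_update he]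
      split
      · rename_i hev
        simp only [hev, true_implies, muSet, Set.mem_sdiff, Set.mem_singleton_iff, Set.mem_ofPred_eq]
        refine ⟨fun h => ⟨⟨h.1, fun f hf hfv hcf => ?_⟩, h.2.2⟩, fun h => ⟨h.1.1, fun f hf hfv _ => h.1.2 f hf hfv, h.2⟩⟩
        by_cases hfe : f = e
        · subst hfe; omega
        · exact h.2.1 f hf hfv hfe hcf
      · rename_i hev
        simp only [hev, false_implies, and_true, muSet, Set.mem_ofPred_eq]
        refine ⟨fun h => ⟨h.1, fun f hf hfv => h.2 f hf hfv (by rintro rfl; exact hev hfv)⟩,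
          fun h => ⟨h.1, fun f hf hfv _ => h.2 f hf hfv⟩⟩
    rw [key]
    simp only [Function.update_apply, EdgeList.Inc]
    grind
  · refine hunc.remove hU ?_ ?_ ?_ <;>
    simp [Mem.set_self, Mem.set_of_ne]
  · simp only [Mem.set_of_ne, ne_eq, reduceCtorEq, not_false_eq_true]
    rw [hf _ (by decide) (by decide) (by decide)]; rfl
  · intro a h1 h2 h3 h4 h5 h6 h7 h8
    rw [Mem.set_of_ne _ h8, Mem.set_of_ne _ h7, Mem.set_of_ne _ h6, hf a h3 h4 h5, hm1,
      Mem.set_of_ne _ h2, Mem.set_of_ne _ h2, Mem.set_of_ne _ h1]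

/-- The dictionary is left alone: its invariant only concerns colored edges, and stale entries are
permitted. -/
theorem uncolorEdge_spec (hg : g.Simple) {U : Set ℕ} (h : DS g d c U m)
    (hc : g.Proper (d + 1) c) {e : ℕ} (he : e ∈ g.E) (hU : e ∉ U) (h0 : c e ≠ 0)
    (hcol : m .col e = c e) :
    Spec (uncolorEdge d e) m 20 fun _ m' =>
      DS g d (Function.update c e 0) (insert e U) m' ∧ m' .col = Function.update (m .col) e 0 ∧
      Frame m m' := by
  intro t
  unfold uncolorEdge
  simp only [wp_bind, wp_read, wp_write]
  rw [h.src, h.dst, hcol]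
  have hs := EdgeList.star_nonempty he (g.inc_s e)
  have ht := EdgeList.star_nonempty he (g.inc_t e)
  have hne := hg.ne e he
  set m1 := m.set .col e 0 with hm1
  have hMu1 : Mu g d (muSet g c) m1 := h.mu.congr (fun _ _ => rfl) rfl rfl rfl rfl
  refine wp_mono (muInsert_spec hMu1 hs (Nat.pos_of_ne_zero h0)
    (fun hm => hm.2 e he (g.inc_s e) rfl) _) ?_
  rintro - m2 t2 ⟨ht2, hMu2, hf2⟩
  refine wp_mono (muInsert_spec hMu2 ht (Nat.pos_of_ne_zero h0) ?_ _) ?_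
  · rw [Function.update_of_ne hne.symm]
    exact fun hm => hm.2 e he (g.inc_t e) rfl
  rintro - m3 t3 ⟨ht3, hMu3, hf3⟩
  rw [setInsert_wp _ _ _ _ _ _ _ _ _ (by decide) (by decide) (by decide)]
  have hf : ∀ a, a ≠ .muArr → a ≠ .muPos → a ≠ .muCnt → m3 a = m1 a := fun a h1 h2 h3 =>
    (hf3 a h1 h2 h3).trans (hf2 a h1 h2 h3)
  have hunc : StoresSet m3 .unArr .unPos .unCnt 0 0 U := by
    refine h.unc.congr ?_ ?_ ?_ <;>
    rw [hf _ (by decide) (by decide) (by decide)] <;> rfl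
  refine ⟨by omega, ⟨?_, ?_, ?_, ?_, ?_⟩, ?_, ?_⟩
  · simp only [Mem.set_of_ne, ne_eq, reduceCtorEq, not_false_eq_true]
    rw [hf _ (by decide) (by decide) (by decide), ← h.src]; rfl
  · simp only [Mem.set_of_ne, ne_eq, reduceCtorEq, not_false_eq_true]
    rw [hf _ (by decide) (by decide) (by decide), ← h.dst]; rfl
  · intro f hf' hf0 v hfv
    simp only [Mem.set_of_ne, ne_eq, reduceCtorEq, not_false_eq_true]
    rw [hf _ (by decide) (by decide) (by decide)]
    rw [Function.update_apply] at hf0 ⊢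
    by_cases hfe : f = e
    · simp [hfe] at hf0
    · rw [if_neg hfe] at hf0 ⊢
      exact h.dict f hf' hf0 v hfv
  · refine hMu3.congr (fun v hv => ?_) rfl rfl rfl rfl
    have key : ∀ v, muSet g (Function.update c e 0) v =
        if g.Inc e v then muSet g c v ∪ {x | x = c e ∧ x ≤ g.deg v + 1} else muSet g c v := by
      intro v
      ext x
      rw [mem_muSet_update he]
      split
      · rename_i hev
        simp only [hev, true_implies, muSet, Set.mem_union, Set.mem_ofPred_eq]
        constructor
        · intro h
          by_cases hx : x = c e
          · exact Or.inr ⟨hx, h.1.2⟩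
          · refine Or.inl ⟨h.1, fun f hf hfv => ?_⟩
            by_cases hfe : f = e
            · subst hfe; exact Ne.symm hx
            · exact h.2.1 f hf hfv hfe
        · rintro (h | ⟨rfl, h⟩)
          · exact ⟨h.1, fun f hf hfv _ => h.2 f hf hfv, by omega⟩
          · refine ⟨⟨Nat.pos_of_ne_zero h0, h⟩, fun f hf hfv hfe hcf => ?_, h0⟩
            exact hc.ne e he f hf (Ne.symm hfe) v hev hfv h0 hcf.symm
      · rename_i hev
        simp only [hev, false_implies, and_true, muSet, Set.mem_ofPred_eq]
        refine ⟨fun h => ⟨h.1, fun f hf hfv => h.2 f hf hfv (by rintro rfl; exact hev hfv)⟩,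
          fun h => ⟨h.1, fun f hf hfv _ => h.2 f hf hfv⟩⟩
    rw [key]
    simp only [Function.update_apply, EdgeList.Inc]
    grind
  · refine hunc.insert hU ?_ ?_ ?_ <;>
    simp [Mem.set_self, Mem.set_of_ne]
  · simp only [Mem.set_of_ne, ne_eq, reduceCtorEq, not_false_eq_true]
    rw [hf _ (by decide) (by decide) (by decide)]; rfl
  · intro a h1 h2 h3 h4 h5 h6 h7 h8
    rw [Mem.set_of_ne _ h8, Mem.set_of_ne _ h7, Mem.set_of_ne _ h6, hf a h3 h4 h5, hm1,
      Mem.set_of_ne _ h1]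

/-- An existing edge of color γ at v is the content of its dictionary cell. Any other content,
whether stale or uninitialized, is rejected by the test against the edge record, so a failed test
proves that γ is missing. -/
theorem search_spec {U : Set ℕ} (h : DS g d c U m) (hcol : ∀ e ∈ g.E, m .col e = c e)
    {γ : ℕ} (hγ : γ ≠ 0) (v : ℕ) :
    Spec (search g.lo g.hi d v γ) m 4 fun r m' =>
      m' = m ∧ ((∃ e, r = some e ∧ e ∈ g.E ∧ g.Inc e v ∧ c e = γ) ∨ (r = none ∧ g.Miss c v γ)) := by
  intro t
  unfold search
  simp only [wp_bind, wp_read, wp_ite, wp_pure]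
  rw [h.src, h.dst]
  have key : ∀ e ∈ g.E, g.Inc e v → c e = γ → m .dict (cell d v γ) = e := fun e he hev hce =>
    hce ▸ h.dict e he (hce ▸ hγ) v hev
  set e := m .dict (cell d v γ)
  refine ⟨fun he => ⟨by omega, trivial, ?_⟩, fun he => ⟨by omega, trivial, Or.inr ⟨trivial, ?_⟩⟩⟩
  · rw [hcol e (EdgeList.mem_E.2 he)]
    split
    · rename_i h2
      exact Or.inl ⟨e, rfl, EdgeList.mem_E.2 he, h2.2, h2.1⟩
    · rename_i h2
      refine Or.inr ⟨rfl, fun f hf hfv hcf => h2 ?_⟩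
      rw [key f hf hfv hcf]
      exact ⟨hcf, hfv⟩
  · intro f hf hfv hcf
    exact he (EdgeList.mem_E.1 (key f hf hfv hcf ▸ hf))

/-- Among deg v + 1 colors one is missing at v, so the stored list is nonempty and its first cell is
meaningful. -/
theorem someMissing_spec {U : Set ℕ} (h : DS g d c U m) {v : ℕ} (hv : (g.star v).Nonempty) :
    Spec (someMissing d v) m 1 fun β m' =>
      m' = m ∧ (1 ≤ β ∧ β ≤ d + 1) ∧ g.Miss c v β := by
  intro t
  unfold someMissing
  rw [wp_read]
  have hs := h.mu.mu v hv
  obtain ⟨γ, hγ, hm⟩ := EdgeList.exists_missing (g := g) c (v := v) le_rfl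
  have := hs.index γ ⟨hγ, hm⟩
  have h1 := (hs.elem 0 (by omega)).1
  rw [add_zero] at h1
  have := h.mu.le v hv
  exact ⟨le_rfl, rfl, ⟨h1.1.1, by have := h1.1.2; omega⟩, h1.2⟩

/-- The memory holds the coloring `c` and up-to-date data structures. -/
structure RS (g : EdgeList) (d : ℕ) (c : ℕ → ℕ) (m : Mem) : Prop where
  ds : DS g d c {e | e ∈ g.unc c} m
  col : m .col = c

theorem RS.congr {m' : Mem} (h : RS g d c m)
    (hm : ∀ a, a ≠ .fan → a ≠ .fanPos → a ≠ .path → a ≠ .scratch → m' a = m a) : RS g d c m' :=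
  ⟨h.ds.congr (fun _ _ => rfl) fun a h0 h1 h2 h3 h4 => hm a h1 h2 h3 h4, by
    rw [hm _ (by decide) (by decide) (by decide) (by decide)]; exact h.col⟩

theorem RS.colorEdge (hg : g.Simple) (h : RS g d c m) (hc : g.Proper (d + 1) c) {e γ : ℕ}
    (he : e ∈ g.E) (h0 : c e = 0) (h1 : 1 ≤ γ) (hγd : γ ≤ d + 1)
    (hγ : ∀ v, g.Inc e v → g.Miss c v γ) :
    Spec (colorEdge d e γ) m 25 fun _ m' => RS g d (Function.update c e γ) m' ∧ Frame m m' := by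
  refine (colorEdge_spec hg h.ds hc he (EdgeList.mem_unc.2 ⟨he, h0⟩) h0 h1 hγd hγ).mono le_rfl ?_
  rintro - m' ⟨h1', h2, h3⟩
  refine ⟨⟨?_, by rw [h2, h.col]⟩, h3⟩
  · convert h1' using 1
    ext f
    simp only [Set.mem_ofPred_eq, EdgeList.mem_unc, Function.update_apply, Set.mem_sdiff,
      Set.mem_singleton_iff]
    split <;> [skip; simp_all]
    constructor
    · intro h; omega
    · intro h; exact absurd ‹_› h.2

theorem RS.uncolorEdge (hg : g.Simple) (h : RS g d c m) (hc : g.Proper (d + 1) c) {e : ℕ}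
    (he : e ∈ g.E) (h0 : c e ≠ 0) :
    Spec (uncolorEdge d e) m 20 fun _ m' => RS g d (Function.update c e 0) m' ∧ Frame m m' := by
  refine (uncolorEdge_spec hg h.ds hc he (fun h => h0 (EdgeList.mem_unc.1 h).2) h0
    (congrFun h.col e)).mono le_rfl ?_
  rintro - m' ⟨h1', h2, h3⟩
  refine ⟨⟨?_, by rw [h2, h.col]⟩, h3⟩
  · convert h1' using 1
    ext f
    simp only [Set.mem_ofPred_eq, EdgeList.mem_unc, Function.update_apply, Set.mem_insert_iff]
    split <;> simp_all

/-! ### Making a fan -/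

theorem wp_other (e v : ℕ) (t : ℕ) (Q : ℕ → Mem → ℕ → Prop) :
    wp (other e v) m t Q ↔ Q (if m .src e = v then m .dst e else m .src e) m (t + 2) := Iff.rfl

theorem RS.wp_other (h : RS g d c m) (e v : ℕ) (t : ℕ) (Q : ℕ → Mem → ℕ → Prop) :
    wp (other e v) m t Q ↔ Q (g.oth e v) m (t + 2) := by
  rw [EdgeColoringRAM.wp_other, h.ds.src, h.ds.dst]; rfl

/-- The result `r` of growing a fan with center `v` and memory contents `m`. -/
structure Primed (g : EdgeList) (d : ℕ) (c : ℕ → ℕ) (v e : ℕ) (F : ℕ → ℕ) (r : ℕ × ℕ × Option ℕ) :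
    Prop where
  zero : F 0 = e
  fan : g.Fan c v r.1 F
  color : 1 ≤ r.2.1 ∧ r.2.1 ≤ d + 1
  miss : g.Miss c (g.oth (F r.1) v) r.2.1
  primed : (r.2.2 = none ∧ g.Miss c v r.2.1) ∨
    ∃ j, r.2.2 = some j ∧ 1 ≤ j ∧ j ≤ r.1 ∧ c (F j) = r.2.1

/-- The invariant says that the array of positions is correct for the edges now in the fan. Its
other entries are arbitrary, so membership is decided by looking up the claimed position and
comparing the edge stored there. -/
theorem growFan_spec (hg : g.Simple) (hc : g.Proper (d + 1) c) (v : ℕ) (b : ℕ) :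
    ∀ (k : ℕ) (m : Mem), RS g d c m → g.Fan c v k (m .fan) →
      (∀ i ≤ k, m .fanPos (m .fan i) = i) → b + k = d + 1 →
      Spec (growFan g.lo g.hi d v b k) m (12 * b) fun r m' =>
        Primed g d c v (m .fan 0) (m' .fan) r ∧ ∀ a, a ≠ .fan → a ≠ .fanPos → m' a = m a := by
  induction b with
  | zero =>
    intro k m h hF hpos hb
    -- The iteration bound is never exhausted: it would mean k = d + 1, but k is less than the
    -- degree of the center.
    have h1 := hF.lt_deg
    have h2 := h.ds.mu.le v (EdgeList.star_nonempty (hF.mem 0 (by omega)) (hF.inc 0 (by omega)))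
    omega
  | succ b ih =>
    intro k m h hF hpos hb t
    unfold growFan
    rw [wp_bind, wp_read, wp_bind, h.wp_other]
    have hx : (g.star (g.oth (m .fan k) v)).Nonempty :=
      EdgeList.star_nonempty (hF.mem k le_rfl) (EdgeList.inc_oth (hF.inc k le_rfl))
    refine (someMissing_spec h.ds hx).wp_bind ?_
    rintro β m t1 ⟨rfl, hβ, hmiss⟩ ht1
    refine (search_spec h.ds (fun e _ => congrFun h.col e) (by omega : β ≠ 0) v).wp_bind ?_
    rintro r m t2 ⟨rfl, ⟨f, rfl, hf, hfv, hcf⟩ | ⟨rfl, hmv⟩⟩ ht2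
    · simp only [wp_bind, wp_read, wp_write, wp_ite, wp_pure]
      refine ⟨fun hj => ⟨by omega, ⟨rfl, hF, hβ, hmiss, Or.inr ⟨_, rfl, ?_, hj.1, ?_⟩⟩, by simp⟩,
        fun hj => ?_⟩
      -- Position 0 is excluded because the first fan edge is uncolored while f has the positive
      -- color β.
      · rcases Nat.eq_zero_or_pos (m .fanPos f) with h0 | h0
        · rw [h0] at hj
          have := hF.zero
          rw [hj.2, hcf] at this
          omega
        · exact h0
      · dsimp only
        rw [hj.2, hcf]
      -- Had f been in the fan already, its stored position would have passed the test.
      · have hnew : ∀ i ≤ k, m .fan i ≠ f := by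
          rintro i hi rfl
          rw [hpos i hi] at hj
          exact hj ⟨hi, rfl⟩
        set m' := (m.set .fan (k + 1) f).set .fanPos f (k + 1) with hm'
        have hold : ∀ i ≤ k, m' .fan i = m .fan i := fun i hi => by
          simp only [hm', Mem.set_self, Mem.set_of_ne, ne_eq, reduceCtorEq, not_false_eq_true]
          rw [Function.update_of_ne (by omega)]
        have hlast : m' .fan (k + 1) = f := by
          simp [hm', Mem.set_self, Mem.set_of_ne]
        have hF' : g.Fan c v (k + 1) (m' .fan) := by
          refine ⟨fun i hi => ?_, fun i hi => ?_, fun i hi j hj hij => ?_, ?_, fun i hi => ?_,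
            fun i hi => ?_⟩
          · rcases Nat.lt_succ_iff_lt_or_eq.1 (Nat.lt_succ_of_le hi) with h | rfl
            · rw [hold i (by omega)]; exact hF.mem i (by omega)
            · rw [hlast]; exact hf
          · rcases Nat.lt_succ_iff_lt_or_eq.1 (Nat.lt_succ_of_le hi) with h | rfl
            · rw [hold i (by omega)]; exact hF.inc i (by omega)
            · rw [hlast]; exact hfv
          · rcases Nat.lt_succ_iff_lt_or_eq.1 (Nat.lt_succ_of_le hi) with hi' | rfl <;>
            rcases Nat.lt_succ_iff_lt_or_eq.1 (Nat.lt_succ_of_le hj) with hj' | rfl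
            · rw [hold i (by omega), hold j (by omega)] at hij
              exact hF.inj i (by omega) j (by omega) hij
            · rw [hlast, hold i (by omega)] at hij
              exact absurd hij (hnew i (by omega))
            · rw [hlast, hold j (by omega)] at hij
              exact absurd hij.symm (hnew j (by omega))
            · rfl
          · rw [hold 0 (by omega)]; exact hF.zero
          · rcases Nat.lt_succ_iff_lt_or_eq.1 hi with h | rfl
            · rw [hold _ (by omega)]; exact hF.ne i h
            · rw [hlast]; omega
          · rcases Nat.lt_succ_iff_lt_or_eq.1 hi with h | rfl
            · rw [hold _ (by omega), hold _ (by omega)]; exact hF.miss i h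
            · rw [hlast, hold _ le_rfl, hcf]; exact hmiss
        have hfr : ∀ a, a ≠ .fan → a ≠ .fanPos → m' a = m a := fun a h1 h2 => by
          rw [hm', Mem.set_of_ne _ h2, Mem.set_of_ne _ h1]
        refine wp_mono (ih (k + 1) m' (h.congr fun a h1 h2 _ _ => hfr a h1 h2) hF' ?_ (by omega) _) ?_
        · intro i hi
          have hp : m' .fanPos = Function.update (m .fanPos) f (k + 1) := by
            simp [hm', Mem.set_self, Mem.set_of_ne]
          rw [hp]
          rcases Nat.lt_succ_iff_lt_or_eq.1 (Nat.lt_succ_of_le hi) with hi' | rfl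
          · rw [hold i (by omega), Function.update_of_ne (hnew i (by omega))]
            exact hpos i (by omega)
          · rw [hlast, Function.update_self]
        · rintro r m'' t' ⟨ht', hp, hfr'⟩
          rw [hold 0 (by omega)] at hp
          exact ⟨by omega, hp, fun a h1 h2 => (hfr' a h1 h2).trans (hfr a h1 h2)⟩
    · rw [wp_pure]
      exact ⟨by omega, ⟨rfl, hF, hβ, hmiss, Or.inl ⟨rfl, hmv⟩⟩, fun _ _ _ => rfl⟩

theorem makePrimedFan_spec (hg : g.Simple) (hc : g.Proper (d + 1) c) (h : RS g d c m) {v e : ℕ}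
    (he : e ∈ g.E) (hv : g.Inc e v) (h0 : c e = 0) :
    Spec (makePrimedFan g.lo g.hi d v e) m (12 * (d + 1) + 2) fun r m' =>
      Primed g d c v e (m' .fan) r ∧ RS g d c m' := by
  intro t
  unfold makePrimedFan
  simp only [wp_bind, wp_write]
  set m' := (m.set .fan 0 e).set .fanPos e 0 with hm'
  have hfan : m' .fan 0 = e := by simp [hm', Mem.set_self, Mem.set_of_ne]
  have hfr : ∀ a, a ≠ .fan → a ≠ .fanPos → m' a = m a := fun a h1 h2 => by
    rw [hm', Mem.set_of_ne _ h2, Mem.set_of_ne _ h1]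
  have h' : RS g d c m' := h.congr fun a h1 h2 _ _ => hfr a h1 h2
  refine wp_mono (growFan_spec hg hc v (d + 1) 0 m' h' ⟨?_, ?_, ?_, ?_, ?_, ?_⟩ ?_ rfl _) ?_
  · intro i hi; rw [Nat.le_zero.1 hi, hfan]; exact he
  · intro i hi; rw [Nat.le_zero.1 hi, hfan]; exact hv
  · intro i hi j hj _; omega
  · rw [hfan, h0]
  · intro i hi; omega
  · intro i hi; omega
  · intro i hi; rw [Nat.le_zero.1 hi, hfan]; simp [hm', Mem.set_self]
  · rintro r m'' t' ⟨ht', hp, hfr'⟩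
    rw [hfan] at hp
    exact ⟨by omega, hp, h'.congr fun a h1 h2 _ _ => hfr' a h1 h2⟩

/-! ### Shifting -/

/-- After the shift the hole has moved from the first fan edge to F j. Since β is missing at both
ends of F j, it fills the hole, and in total only the first fan edge becomes newly colored. -/
theorem shiftAndColor_spec (hg : g.Simple) (hc : g.Proper (d + 1) c) (h : RS g d c m) {v j β : ℕ}
    (hF : g.Fan c v j (m .fan)) (hβ : 1 ≤ β ∧ β ≤ d + 1) (hv : g.Miss c v β)
    (hx : g.Miss c (g.oth (m .fan j) v) β) :
    Spec (shiftAndColor d j β) m (50 * j + 26) fun _ m' => ∃ c', RS g d c' m' ∧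
      g.Proper (d + 1) c' ∧ (∀ e, c' e = 0 ↔ c e = 0 ∧ e ≠ m .fan 0) ∧
      ∀ e ∉ g.E, c' e = c e := by
  set F := m .fan with hFdef
  unfold shiftAndColor
  refine Spec.bind 26 (T₁ := 50 * j)
    (R := fun _ m' => RS g d (EdgeList.shift c F j) m' ∧ Frame m m') ?_ ?_ (by omega)
  · unfold shiftFan
    refine (Spec.forRange _ 0 j (by omega)
      (fun i m' => RS g d (EdgeList.shift c F i) m' ∧ Frame m m') 49 ⟨h, Frame.refl m⟩ ?_).mono
      (by omega) fun _ _ h => h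
    rintro i - hi m' ⟨hRS, hfr⟩ t
    have hfan : m' .fan = F := hfr _ (by decide) (by decide) (by decide) (by decide) (by decide)
      (by decide) (by decide) (by decide)
    simp only [wp_bind, wp_read]
    rw [hfan, hRS.col, hF.shift_later (Nat.lt_succ_self i) hi]
    have hp := hF.shift_proper hg hc (i := i) (by omega)
    have hp1 := hF.shift_proper hg hc (i := i + 1) (by omega)
    have hcne := hF.ne i hi
    have hcol := hF.shift_later (Nat.lt_succ_self i) hi
    refine wp_mono (hRS.uncolorEdge hg hp (hF.mem _ hi) (by rw [hcol]; exact hcne) _) ?_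
    rintro - m1 t1 ⟨ht1, hRS1, hfr1⟩
    set c1 := Function.update (EdgeList.shift c F i) (F (i + 1)) 0 with hc1
    have hsub : ∀ e ∈ g.E, c1 e = 0 ∨ c1 e = EdgeList.shift c F i e := by
      intro e he
      rw [hc1, Function.update_apply]; split <;> simp
    have hne : F i ≠ F (i + 1) := fun h => by
      have := hF.inj _ (by omega) _ (by omega) h; omega
    have h0 : c1 (F i) = 0 := by
      rw [hc1, Function.update_of_ne hne]
      exact hF.shift_self (by omega)
    -- The intermediate coloring is also a subcoloring of the next shift, which is proper; this
    -- yields that the new color of F i is missing at both of its ends.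
    have hsub' : ∀ e ∈ g.E, c1 e = 0 ∨ c1 e = EdgeList.shift c F (i + 1) e := by
      intro e he
      rw [EdgeList.shift, Function.update_apply]
      split
      · rename_i h; rw [h]; exact Or.inl h0
      · exact Or.inr rfl
    have hval : EdgeList.shift c F (i + 1) (F i) = c (F (i + 1)) := by
      rw [EdgeList.shift, Function.update_self]
    refine wp_mono (hRS1.colorEdge hg (hp.of_sub hsub) (hF.mem i (by omega)) h0
      (Nat.pos_of_ne_zero hcne) (hc.le _ (hF.mem _ hi)) ?_ _) ?_
    · intro x hx
      rw [← hval]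
      exact hp1.miss_of_sub hsub' (hF.mem i (by omega)) hx (by rw [hval]; exact hcne) h0
    · rintro - m2 t2 ⟨ht2, hRS2, hfr2⟩
      exact ⟨by omega, hRS2, hfr.trans (hfr1.trans hfr2)⟩
  · rintro - m' ⟨hRS, hfr⟩ t
    have hfan : m' .fan = F := hfr _ (by decide) (by decide) (by decide) (by decide) (by decide)
      (by decide) (by decide) (by decide)
    simp only [wp_bind, wp_read]
    rw [hfan]
    have hp := hF.shift_proper hg hc (i := j) le_rfl
    have hm : ∀ x, g.Inc (F j) x → g.Miss (EdgeList.shift c F j) x β := by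
      intro x hxi
      rcases (EdgeList.inc_iff (hF.inc j le_rfl) x).1 hxi with rfl | rfl
      · exact hF.shift_miss_center le_rfl (by omega) hv
      · exact hF.shift_miss_leaf hg le_rfl le_rfl (by omega) hx
    refine wp_mono (hRS.colorEdge hg hp (hF.mem j le_rfl) (hF.shift_self le_rfl) hβ.1 hβ.2 hm _) ?_
    rintro - m1 t1 ⟨ht1, hRS1, hfr1⟩
    refine ⟨by omega, _, hRS1, hp.color hβ.2 (hm _ (g.inc_s _)) (hm _ (g.inc_t _)), fun e => ?_,
      fun e he => ?_⟩
    swap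
    · rw [Function.update_of_ne (by rintro rfl; exact he (hF.mem j le_rfl)),
        EdgeList.shift_of_ne j fun l hl => by rintro rfl; exact he (hF.mem l hl)]
    rw [Function.update_apply]
    have := hF.shift_eq_zero le_rfl e
    split
    · rename_i he
      subst he
      refine ⟨fun h => by omega, ?_⟩
      rintro ⟨h1, h2⟩
      obtain ⟨l, rfl⟩ : ∃ l, j = l + 1 := ⟨j - 1, by
        have : j ≠ 0 := by rintro rfl; exact h2 rfl
        omega⟩
      exact absurd h1 (hF.ne l (by omega))
    · rename_i he
      rw [this]; simp [he]

/-! ### Tracing and flipping the path -/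

theorem EdgeList.Walk.extend {v α β L : ℕ} {p r : ℕ → ℕ} (hw : g.Walk c v α β L p r) {f : ℕ}
    (hf : f ∈ g.E) (hfp : g.Inc f (p L)) (hcf : c f = alt α β L) :
    g.Walk c v α β (L + 1) (Function.update p (L + 1) (g.oth f (p L))) (Function.update r L f) := by
  refine ⟨?_, fun i hi => ?_, fun i hi => ?_, fun i hi => ?_, fun i hi => ?_⟩
  · rw [Function.update_of_ne (by omega), hw.start]
  · by_cases h : i = L
    · subst h; rwa [Function.update_self]
    · rw [Function.update_of_ne h]; exact hw.mem i (by omega)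
  · rw [Function.update_of_ne (show i ≠ L + 1 by omega)]
    by_cases h : i = L
    · subst h; rwa [Function.update_self]
    · rw [Function.update_of_ne h]; exact hw.fst i (by omega)
  · rw [Function.update_of_ne (show i ≠ L + 1 by omega)]
    by_cases h : i = L
    · subst h; rw [Function.update_self, Function.update_self]
    · rw [Function.update_of_ne h, Function.update_of_ne (by omega)]; exact hw.snd i (by omega)
  · by_cases h : i = L
    · subst h; rwa [Function.update_self]
    · rw [Function.update_of_ne h]; exact hw.col i (by omega)

/-- The invariant is an alternating walk stored in the path array. Each edge is charged 8 steps, and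
5 cover the final unsuccessful search. -/
theorem tracePath_wp (hg : g.Simple) (hc : g.Proper (d + 1) c) {v α β : ℕ} (hα : α ≠ 0)
    (hβ : β ≠ 0) (hαβ : α ≠ β) (hv : g.Miss c v α) (b : ℕ) :
    ∀ (i : ℕ) (p : ℕ → ℕ) (m : Mem) (t : ℕ), RS g d c m → g.Walk c v α β i p (m .path) →
      b + i = g.hi - g.lo →
      wp (tracePath g.lo g.hi d b i (p i) (EdgeList.alt α β i) (EdgeList.alt α β (i + 1))) m t
        fun r m' t' => (i ≤ r.1 ∧ t' + 8 * i ≤ t + 8 * r.1 + 5) ∧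
          (∃ p', g.Walk c v α β r.1 p' (m' .path) ∧ r.2 = p' r.1 ∧
            g.Miss c (p' r.1) (EdgeList.alt α β r.1)) ∧ ∀ a, a ≠ .path → m' a = m a := by
  induction b with
  | zero =>
    intro i p m t h hw hb
    unfold tracePath
    rw [wp_pure]
    refine ⟨⟨le_rfl, by omega⟩, ⟨p, hw, rfl, fun f hf hfp hcf => ?_⟩, fun _ _ => rfl⟩
    -- When the iteration bound runs out, the walk has as many edges as the graph; a further edge
    -- would contradict the length bound, so the path is maximal here too.
    have := (hw.extend hf hfp hcf).length_le hg hc hα hβ hαβ hv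
    omega
  | succ b ih =>
    intro i p m t h hw hb
    unfold tracePath
    have halt : EdgeList.alt α β i ≠ 0 := by unfold EdgeList.alt; split <;> assumption
    refine (search_spec h.ds (fun e _ => congrFun h.col e) halt (p i)).wp_bind ?_
    rintro r m t2 ⟨rfl, ⟨f, rfl, hf, hfv, hcf⟩ | ⟨rfl, hmv⟩⟩ ht2
    · simp only [wp_bind, wp_write]
      set m' := m.set .path i f with hm'
      have h' : RS g d c m' := h.congr fun a _ _ h3 _ => by rw [hm', Mem.set_of_ne _ h3]
      rw [h'.wp_other]
      have hw' := hw.extend hf hfv hcf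
      have hpath : m' .path = Function.update (m .path) i f := by rw [hm', Mem.set_self]
      rw [← hpath] at hw'
      have := ih (i + 1) _ m' (t2 + 1 + 2) h' hw' (by omega)
      rw [Function.update_self, ← EdgeList.alt_eq_of_parity (i := i) (j := i + 1 + 1) (by omega)] at this
      refine wp_mono this ?_
      rintro r m'' t' ⟨⟨h1, h2⟩, h3, h4⟩
      refine ⟨⟨by omega, by omega⟩, h3, fun a ha => (h4 a ha).trans ?_⟩
      rw [hm', Mem.set_of_ne _ ha]
    · rw [wp_pure]
      exact ⟨⟨le_rfl, by omega⟩, ⟨p, hw, rfl, hmv⟩, fun _ _ => rfl⟩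

/-- Recoloring edge by edge would create conflicts, so all path edges are uncolored first. The
colorings c₁ i on the way down are subcolorings of c, and the colorings c₂ i on the way up are
subcolorings of the flipped coloring; hence all are proper. The costs of 22 and 27 steps per edge
add up to 49. -/
theorem flipPath_spec (hg : g.Simple) (hc : g.Proper (d + 1) c) (h : RS g d c m) {v α β L : ℕ}
    {p : ℕ → ℕ} (hα : α ≠ 0) (hβ : β ≠ 0) (hαβ : α ≠ β) (hαd : α ≤ d + 1) (hβd : β ≤ d + 1)
    (hv : g.Miss c v α) (hw : g.Walk c v α β L p (m .path))
    (hmax : g.Miss c (p L) (EdgeList.alt α β L)) :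
    Spec (flipPath d L α β) m (49 * L) fun _ m' =>
      RS g d (EdgeList.flip c (m .path) α β L) m' ∧ Frame m m' := by
  classical
  set r := m .path with hr
  have hinj : ∀ {i j}, i < L → j < L → r i = r j → i = j :=
    fun hi hj h => hw.edge_inj hg hc hα hβ hαβ hv hi hj h
  have halt0 : ∀ i, EdgeList.alt α β i ≠ 0 := fun i => by unfold EdgeList.alt; split <;> assumption
  have halt0' : ∀ i, EdgeList.alt β α i ≠ 0 := fun i => by unfold EdgeList.alt; split <;> assumption
  unfold flipPath
  let c₁ : ℕ → ℕ → ℕ := fun i e => if ∃ k < i, r k = e then 0 else c e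
  let cF := EdgeList.flip c r α β L
  let c₂ : ℕ → ℕ → ℕ := fun i e => if ∃ k < L, i ≤ k ∧ r k = e then 0 else cF e
  refine Spec.bind (27 * L) (T₁ := 22 * L) (R := fun _ m' => RS g d (c₁ L) m' ∧ Frame m m') ?_ ?_
    (by omega)
  · refine (Spec.forRange _ 0 L (by omega) (fun i m' => RS g d (c₁ i) m' ∧ Frame m m') 21
      ⟨?_, Frame.refl m⟩ ?_).mono (by omega) fun _ _ h => h
    · have : c₁ 0 = c := by funext e; simp [c₁]
      rw [this]; exact h
    · rintro i - hi m' ⟨hRS, hfr⟩ t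
      have hpath : m' .path = r := hfr _ (by decide) (by decide) (by decide) (by decide) (by decide)
        (by decide) (by decide) (by decide)
      simp only [wp_bind, wp_read]
      rw [hpath]
      have hp : g.Proper (d + 1) (c₁ i) := hc.of_sub fun e he => by
        simp only [c₁]; split <;> simp
      have hci : c₁ i (r i) ≠ 0 := by
        have : ¬ ∃ k < i, r k = r i := by
          rintro ⟨k, hk, hki⟩
          have := hinj (by omega) hi hki
          omega
        simp only [c₁, if_neg this]
        rw [hw.col i hi]; exact halt0 i
      refine wp_mono (hRS.uncolorEdge hg hp (hw.mem i hi) hci _) ?_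
      rintro - m2 t2 ⟨ht2, hRS2, hfr2⟩
      have : Function.update (c₁ i) (r i) 0 = c₁ (i + 1) := by
        funext e
        simp only [Function.update_apply, c₁]
        by_cases he : e = r i
        · rw [if_pos he, if_pos ⟨i, by omega, he.symm⟩]
        · rw [if_neg he]
          refine if_congr ⟨fun ⟨k, hk, h⟩ => ⟨k, by omega, h⟩, fun ⟨k, hk, h⟩ => ⟨k, ?_, h⟩⟩ rfl rfl
          rcases Nat.lt_succ_iff_lt_or_eq.1 hk with hk | rfl
          · exact hk
          · exact absurd h.symm he
      rw [← this]
      exact ⟨by omega, hRS2, hfr.trans hfr2⟩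
  · rintro - m' ⟨hRS, hfr⟩
    have hFp : g.Proper (d + 1) cF := hw.flip_proper hc hα hβ hαβ hαd hβd hv hmax
    refine (Spec.forRange _ 0 L (by omega) (fun i m' => RS g d (c₂ i) m' ∧ Frame m m') 26
      ⟨?_, hfr⟩ ?_).mono (by omega) fun _ m2 h2 => ?_
    · have : c₁ L = c₂ 0 := by
        funext e
        simp only [c₁, c₂, cF, EdgeList.flip, Nat.zero_le, true_and]
        split <;> rfl
      rw [← this]; exact hRS
    · rintro i - hi m' ⟨hRS, hfr⟩ t
      have hpath : m' .path = r := hfr _ (by decide) (by decide) (by decide) (by decide) (by decide)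
        (by decide) (by decide) (by decide)
      simp only [wp_bind, wp_read]
      rw [hpath]
      have hsub : ∀ e ∈ g.E, c₂ i e = 0 ∨ c₂ i e = cF e := fun e he => by
        simp only [c₂]; split <;> simp
      have h0 : c₂ i (r i) = 0 := by
        simp only [c₂]; rw [if_pos ⟨i, hi, le_rfl, rfl⟩]
      have hval : cF (r i) = if i % 2 = 0 then α else β := hw.flip_edge hi hαβ
      rw [← hval]
      have hne : cF (r i) ≠ 0 := by rw [hval]; exact halt0' i
      refine wp_mono (hRS.colorEdge hg (hFp.of_sub hsub) (hw.mem i hi) h0 (Nat.pos_of_ne_zero hne)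
        (hFp.le _ (hw.mem i hi)) (fun x hx => hFp.miss_of_sub hsub (hw.mem i hi) hx hne h0) _) ?_
      rintro - m2 t2 ⟨ht2, hRS2, hfr2⟩
      have : Function.update (c₂ i) (r i) (cF (r i)) = c₂ (i + 1) := by
        funext e
        simp only [Function.update_apply, c₂]
        by_cases he : e = r i
        · rw [if_pos he, if_neg, he]
          rintro ⟨k, hk, hik, hke⟩
          have := hinj hk hi (hke.trans he)
          omega
        · rw [if_neg he]
          refine if_congr ⟨fun ⟨k, hk, h1, h⟩ => ⟨k, hk, ?_, h⟩,
            fun ⟨k, hk, h1, h⟩ => ⟨k, hk, by omega, h⟩⟩ rfl rfl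
          rcases Nat.lt_or_eq_of_le h1 with h1 | rfl
          · exact h1
          · exact absurd h.symm he
      rw [← this]
      exact ⟨by omega, hRS2, hfr.trans hfr2⟩
    · have : c₂ L = cF := by
        funext e
        simp only [c₂]
        rw [if_neg]
        rintro ⟨k, hk, hk', -⟩
        omega
      rw [this] at h2; exact h2

/-! ### Activating a fan -/

/-- Vizing's argument. Of the fan edges only v x_j carries one of the two colors, as α is missing at
v and β occurs there once. After the flip β is missing at v. With i = j - 1, if the path does not
end in x_i, then β is still missing at x_i and the fan up to x_i is intact. If it does end there, v
x_j now has the color α and α has become missing at x_i, so the whole fan survives, and β is still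
missing at its last leaf. The time is reported through a walk, so that its expectation can be
estimated later. -/
theorem activateFan_wp (hg : g.Simple) (hc : g.Proper (d + 1) c) (h : RS g d c m) {v e α : ℕ}
    (hα : α ≠ 0) (hαd : α ≤ d + 1) (hv : g.Miss c v α) {r : ℕ × ℕ × Option ℕ}
    (hP : Primed g d c v e (m .fan) r) (t : ℕ) :
    wp (activateFan g.lo g.hi d α v r) m t fun _ m' t' =>
      (∃ L β p ρ, 1 ≤ β ∧ β ≤ d + 1 ∧ α ≠ β ∧ g.Walk c v α β L p ρ ∧
        t' ≤ t + 50 * (d + 1) + 57 * L + 40) ∧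
      ∃ c', RS g d c' m' ∧ g.Proper (d + 1) c' ∧ (∀ f, c' f = 0 ↔ c f = 0 ∧ f ≠ e) ∧
        ∀ f ∉ g.E, c' f = c f := by
  obtain ⟨k, β, o⟩ := r
  obtain ⟨hzero, hF, hβ, hmiss, hpr⟩ := hP
  dsimp only at hF hβ hmiss hpr
  have hkd : k ≤ d := by
    have h1 := hF.lt_deg
    have := h.ds.mu.le v (EdgeList.star_nonempty (hF.mem 0 (by omega)) (hF.inc 0 (by omega)))
    omega
  rcases hpr with ⟨rfl, hvβ⟩ | ⟨j, rfl, hj1, hjk, hcj⟩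
  · unfold activateFan
    refine wp_mono (shiftAndColor_spec hg hc h hF hβ hvβ hmiss _) ?_
    rintro - m' t' ⟨ht', c', h1, h2, h3, h4⟩
    -- No path is traced in this case. The conclusion is met by the empty walk, for which any color
    -- different from α serves; one exists because d ≥ 1.
    have hmin : ∃ β', 1 ≤ β' ∧ β' ≤ d + 1 ∧ α ≠ β' := by
      have hd : 1 ≤ d := by
        have h1 := hF.lt_deg
        have := h.ds.mu.le v (EdgeList.star_nonempty (hF.mem 0 (by omega)) (hF.inc 0 (by omega)))
        omega
      by_cases h1 : α = 1
      · exact ⟨2, by omega, by omega, by omega⟩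
      · exact ⟨1, by omega, by omega, by omega⟩
    obtain ⟨β', hb1, hb2, hb3⟩ := hmin
    refine ⟨⟨0, β', fun _ => v, fun _ => 0, hb1, hb2, hb3, ⟨rfl, ?_, ?_, ?_, ?_⟩, ?_⟩, c', h1, h2, ?_, h4⟩
    any_goals (intro i hi; omega)
    · have : 50 * k ≤ 50 * d := by omega
      omega
    · rw [← hzero]; exact h3
  · have hβ0 : β ≠ 0 := by omega
    have hjm := hF.mem j hjk
    have hjv := hF.inc j hjk
    have hαβ : α ≠ β := by
      rintro rfl
      exact hv _ hjm hjv hcj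
    obtain ⟨i, rfl⟩ : ∃ i, j = i + 1 := ⟨j - 1, by omega⟩
    unfold activateFan
    have htr := tracePath_wp hg hc hα hβ0 hαβ hv (g.hi - g.lo) 0 (fun _ => v) m t h
      ⟨rfl, by intro i hi; omega, by intro i hi; omega, by intro i hi; omega,
        by intro i hi; omega⟩ (by omega)
    refine (wp_bind _ _ _).2 (wp_mono htr ?_)
    rintro ⟨L, w⟩ m1 t1 ⟨⟨-, ht1⟩, ⟨p, hw, hwp, hmax⟩, hfr1⟩
    dsimp only at hw hwp hmax ht1
    have h1 : RS g d c m1 := h.congr fun a _ _ h3 _ => hfr1 a h3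
    have hfan1 : m1 .fan = m .fan := hfr1 _ (by decide)
    dsimp only
    refine (flipPath_spec hg hc h1 hα hβ0 hαβ hαd hβ.2 hv hw hmax).wp_bind ?_
    rintro - m2 t2 ⟨h2, hfr2⟩ ht2
    have hfan2 : m2 .fan = m .fan := (hfr2 _ (by decide) (by decide) (by decide) (by decide)
      (by decide) (by decide) (by decide) (by decide)).trans hfan1
    set F := m .fan with hFdef
    set ρ := m1 .path with hρ
    set cF := EdgeList.flip c ρ α β L with hcF
    have hflipE : ∀ f ∉ g.E, cF f = c f := fun f hf => by
      rw [hcF]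
      unfold EdgeList.flip
      rw [if_neg]
      rintro ⟨l, hl, rfl⟩
      exact hf (hw.mem l hl)
    have hcFp : g.Proper (d + 1) cF := hw.flip_proper hc hα hβ0 hαβ hαd hβ.2 hv hmax
    rw [wp_bind, wp_read, wp_bind, h2.wp_other, hfan2]
    simp only [Nat.add_sub_cancel]
    -- The flip touches no fan edge except v x_j, so all fan conditions not involving it persist.
    have hcol : ∀ l ≤ k, l ≠ i + 1 → c (F l) ≠ α ∧ c (F l) ≠ β := by
      intro l hl hne
      refine ⟨hv _ (hF.mem l hl) (hF.inc l hl), fun hlβ => hne ?_⟩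
      refine hF.inj l hl _ hjk (hc.eq (hF.mem l hl) hjm (hF.inc l hl) hjv (by rw [hlβ, hcj]) ?_)
      rw [hlβ]; exact hβ0
    have hcFl : ∀ l ≤ k, l ≠ i + 1 → cF (F l) = c (F l) := fun l hl hne =>
      (EdgeList.flip_eq_iff hw (hcol l hl hne).1 (hcol l hl hne).2 _).2 rfl
    have hmissl : ∀ l, l ≠ i → l < k → g.Miss cF (g.oth (F l) v) (cF (F (l + 1))) := by
      intro l hne hl f hf hfx
      rw [hcFl (l + 1) (by omega) (by omega)]
      have := hcol (l + 1) (by omega) (by omega)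
      rw [ne_eq, EdgeList.flip_eq_iff hw this.1 this.2]
      exact hF.miss l hl f hf hfx
    have hvF : g.Miss cF v β := hw.flip_miss hc hα hβ0 hαβ hv hmax (Or.inl rfl)
    have hmi : g.Miss c (g.oth (F i) v) β := hcj ▸ hF.miss i (by omega)
    have hzeroF : cF (F 0) = 0 := (EdgeList.flip_eq_zero hw hα hβ0 _).2 hF.zero
    have hfin : ∀ c' : ℕ → ℕ, (∀ f, c' f = 0 ↔ cF f = 0 ∧ f ≠ m2 .fan 0) → ∀ f, c' f = 0 ↔ c f = 0 ∧ f ≠ e := by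
      intro c' h f
      rw [h, hfan2, hzero, hcF, EdgeList.flip_eq_zero hw hα hβ0]
    have hoth_ne : g.oth (F i) v ≠ v := hg.oth_ne (hF.mem i (by omega))
    rw [wp_ite]
    refine ⟨fun hwx => ?_, fun hwx => ?_⟩
    · have hpL : p L = g.oth (F i) v := hwp ▸ hwx
      have hFF : g.Fan cF v k (m2 .fan) := by
        rw [hfan2]
        refine ⟨hF.mem, hF.inc, hF.inj, hzeroF, fun l hl => ?_, fun l hl => ?_⟩
        · rw [ne_eq, EdgeList.flip_eq_zero hw hα hβ0]; exact hF.ne l hl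
        · by_cases hne : l = i
          · subst hne
            -- The edge v x_j is the unique β-edge at v, hence the first edge of the path, and is
            -- turned into α.
            have hα' : cF (F (l + 1)) = α := by
              have hL0 : 0 < L := by
                rcases Nat.eq_zero_or_pos L with rfl | h
                · exact absurd (hpL ▸ hw.start) hoth_ne
                · exact h
              have : F (l + 1) = ρ 0 := hc.eq hjm (hw.mem 0 hL0) hjv (hw.start ▸ hw.fst 0 hL0)
                (by rw [hcj, hw.col 0 hL0]; simp [EdgeList.alt]) (by rw [hcj]; exact hβ0)
              rw [this, hcF, hw.flip_edge hL0 hαβ]; simp [EdgeList.alt]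
            rw [hα', ← hpL]
            exact hw.flip_miss_end hc hα hαβ (hpL ▸ hmi) (hpL ▸ hoth_ne)
          · exact hmissl l hne hl
      have hx : g.Miss cF (g.oth (m2 .fan k) v) β := by
        rw [hfan2]
        -- The last leaf is not the end of the path: otherwise F k and F i would join the same two
        -- vertices, forcing k = i although i + 1 ≤ k.
        refine hw.flip_miss hc hα hβ0 hαβ hv hmax (Or.inr ⟨hmiss, fun heq => ?_⟩)
        have := hg.eq_of_inc (hF.mem k le_rfl) (hF.mem i (by omega)) hoth_ne
          (heq.trans hpL ▸ EdgeList.inc_oth (hF.inc k le_rfl)) (hF.inc k le_rfl)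
          (EdgeList.inc_oth (hF.inc i (by omega))) (hF.inc i (by omega))
        have := hF.inj k le_rfl i (by omega) this
        omega
      refine wp_mono (shiftAndColor_spec hg hcFp h2 hFF hβ hvF hx _) ?_
      rintro - m3 t3 ⟨ht3, c', h31, h32, h33, h34⟩
      refine ⟨⟨L, β, p, ρ, hβ.1, hβ.2, hαβ, hw, by omega⟩, c', h31, h32, hfin c' h33,
        fun f hf => (h34 f hf).trans (hflipE f hf)⟩
    · have hpL : g.oth (F i) v ≠ p L := fun h => hwx (hwp.trans h.symm)
      have hFF : g.Fan cF v i (m2 .fan) := by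
        rw [hfan2]
        refine ⟨fun l hl => hF.mem l (by omega), fun l hl => hF.inc l (by omega),
          fun l hl l' hl' => hF.inj l (by omega) l' (by omega), hzeroF, fun l hl => ?_,
          fun l hl => hmissl l (by omega) (by omega)⟩
        rw [ne_eq, EdgeList.flip_eq_zero hw hα hβ0]; exact hF.ne l (by omega)
      have hx : g.Miss cF (g.oth (m2 .fan i) v) β := by
        rw [hfan2]
        exact hw.flip_miss hc hα hβ0 hαβ hv hmax (Or.inr ⟨hmi, hpL⟩)
      refine wp_mono (shiftAndColor_spec hg hcFp h2 hFF hβ hvF hx _) ?_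
      rintro - m3 t3 ⟨ht3, c', h31, h32, h33, h34⟩
      refine ⟨⟨L, β, p, ρ, hβ.1, hβ.2, hαβ, hw, by omega⟩, c', h31, h32, hfin c' h33,
        fun f hf => (h34 f hf).trans (hflipE f hf)⟩

/-! ### Listing the missing colors -/

/-- The listing has to be free of repetitions and complete, so that a uniform position in it is a
uniform missing color. -/
theorem listMissing_spec (h : RS g d c m) (v : ℕ) :
    Spec (listMissing g.lo g.hi d v) m (6 * (d + 1)) fun k m' => RS g d c m' ∧
      k = (g.missing c (d + 1) v).card ∧ (∀ r < k, m' .scratch r ∈ g.missing c (d + 1) v) ∧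
      ∀ r < k, ∀ r' < k, m' .scratch r = m' .scratch r' → r = r' := by
  unfold listMissing
  refine (Spec.loop _ (d + 1) 0 (fun i k m' => RS g d c m' ∧
      k = (g.missing c i v).card ∧ (∀ r < k, m' .scratch r ∈ g.missing c i v) ∧
      ∀ r < k, ∀ r' < k, m' .scratch r = m' .scratch r' → r = r') 5 ⟨h, ?_, ?_, ?_⟩ ?_).mono
      (by omega) fun _ _ h => h
  · symm; rw [Finset.card_eq_zero, Finset.eq_empty_iff_forall_notMem]
    intro x hx
    have := EdgeList.mem_missing.1 hx
    omega
  · intro r hr; omega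
  · intro r hr; omega
  · rintro i hi k m' ⟨hRS, hk, hmem, hinj⟩ t
    refine (search_spec hRS.ds (fun e _ => congrFun hRS.col e) (by omega : i + 1 ≠ 0) v).wp_bind ?_
    have hlt : ∀ x ∈ g.missing c i v, x ≤ i := fun x hx => (EdgeList.mem_missing.1 hx).1.2
    rintro r m t2 ⟨rfl, ⟨f, rfl, hf, hfv, hcf⟩ | ⟨rfl, hmv⟩⟩ ht2
    · have : g.missing c (i + 1) v = g.missing c i v := by
        ext x
        simp only [EdgeList.mem_missing]
        refine ⟨fun ⟨h1, h2⟩ => ⟨⟨h1.1, ?_⟩, h2⟩, fun ⟨h1, h2⟩ => ⟨⟨h1.1, by omega⟩, h2⟩⟩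
        have : x ≠ i + 1 := by rintro rfl; exact h2 f hf hfv hcf
        omega
      simp only [wp_pure, this]
      exact ⟨by omega, hRS, hk, hmem, hinj⟩
    · simp only [wp_bind, wp_write, wp_pure]
      have hins : g.missing c (i + 1) v = insert (i + 1) (g.missing c i v) := by
        ext x
        simp only [EdgeList.mem_missing, Finset.mem_insert]
        constructor
        · rintro ⟨h1, h2⟩
          by_cases hx : x = i + 1
          · exact Or.inl hx
          · exact Or.inr ⟨⟨h1.1, by omega⟩, h2⟩
        · rintro (rfl | ⟨h1, h2⟩)
          · exact ⟨⟨by omega, le_rfl⟩, hmv⟩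
          · exact ⟨⟨h1.1, by omega⟩, h2⟩
      have hnot : i + 1 ∉ g.missing c i v := fun hx => by have := hlt _ hx; omega
      refine ⟨by omega, hRS.congr fun a _ _ _ h4 => Mem.set_of_ne _ h4 _ _, ?_, ?_, ?_⟩
      · rw [hins, Finset.card_insert_of_notMem hnot, hk]
      · intro r hr
        rw [Mem.set_self, Function.update_apply, hins, Finset.mem_insert]
        split
        · exact Or.inl rfl
        · exact Or.inr (hmem r (by omega))
      · intro r hr r' hr'
        rw [Mem.set_self, Function.update_apply, Function.update_apply]
        split <;> split
        · intro _; omega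
        · intro h
          have := hlt _ (hmem r' (by omega))
          omega
        · intro h
          have := hlt _ (hmem r (by omega))
          omega
        · exact hinj r (by omega) r' (by omega)

/-! ### Randomized programs -/

/-- The postcondition holds for every possible outcome, and the expected number of steps is at most
`T`. -/
def RSpec {α : Type} (p : Rand α) (m : Mem) (T : ℝ≥0∞) (Q : α → Mem → Prop) : Prop :=
  ∀ t : ℕ, (∀ ω ∈ (p ⟨m, t⟩ : PMF (α × Machine)).support, Q ω.1 ω.2.mem) ∧
    ∑' ω, (p ⟨m, t⟩ : PMF (α × Machine)) ω * (ω.2.time : ℝ≥0∞) ≤ t + T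

section RSpec
variable {α β : Type} {m : Mem} {T : ℝ≥0∞}

theorem tsum_pmf_bind {α β : Type} (p : PMF α) (f : α → PMF β) (w : β → ℝ≥0∞) :
    ∑' b, p.bind f b * w b = ∑' a, p a * ∑' b, f a b * w b := by
  simp_rw [PMF.bind_apply, ← ENNReal.tsum_mul_right]
  rw [ENNReal.tsum_comm]
  simp_rw [mul_assoc, ENNReal.tsum_mul_left]

theorem tsum_pmf_le {α : Type} (p : PMF α) {f h : α → ℝ≥0∞} (hle : ∀ a ∈ p.support, f a ≤ h a) :
    ∑' a, p a * f a ≤ ∑' a, p a * h a := by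
  refine ENNReal.tsum_le_tsum fun a => ?_
  by_cases ha : p a = 0
  · simp [ha]
  · exact mul_le_mul_right (hle a ((PMF.mem_support_iff p a).2 ha)) _

theorem tsum_pmf_pure {α : Type} (a : α) (w : α → ℝ≥0∞) : ∑' b, (pure a : PMF α) b * w b = w a := by
  have : (pure a : PMF α) = PMF.pure a := rfl
  rw [this, tsum_eq_single a]
  · simp
  · intro b hb
    simp [hb]

theorem RSpec.mono {p : Rand α} {Q R : α → Mem → Prop} {T' : ℝ≥0∞} (h : RSpec p m T Q) (hT : T ≤ T')
    (hQR : ∀ a m', Q a m' → R a m') : RSpec p m T' R := fun t =>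
  ⟨fun ω hω => hQR _ _ ((h t).1 ω hω), (h t).2.trans (by gcongr)⟩

theorem RSpec.min {p : Rand α} {Q : α → Mem → Prop} {T' : ℝ≥0∞} (h : RSpec p m T Q)
    (h' : RSpec p m T' Q) : RSpec p m (T ⊓ T') Q := by
  rcases le_total T T' with hT | hT
  · rwa [inf_eq_left.2 hT]
  · rwa [inf_eq_right.2 hT]

theorem RSpec.pure {a : α} {Q : α → Mem → Prop} (h : Q a m) :
    RSpec (Pure.pure a : Rand α) m 0 Q := fun t => by
  have : (Pure.pure a : Rand α) ⟨m, t⟩ = PMF.pure (a, ⟨m, t⟩) := rfl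
  rw [this]
  refine ⟨fun ω hω => ?_, ?_⟩
  · rw [PMF.mem_support_pure_iff] at hω
    rw [hω]; exact h
  · refine (tsum_pmf_pure (a, (⟨m, t⟩ : Machine)) fun ω => (ω.2.time : ℝ≥0∞)).le.trans ?_
    simp

theorem RSpec.lift {p : Det α} {Q : α → Mem → Prop} {T : ℕ} (h : Spec p m T Q) :
    RSpec (liftM p : Rand α) m T Q := fun t => by
  have : (liftM p : Rand α) ⟨m, t⟩ = PMF.pure (p ⟨m, t⟩) := rfl
  rw [this]
  have := h t
  unfold wp at this
  refine ⟨fun ω hω => ?_, ?_⟩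
  · rw [PMF.mem_support_pure_iff] at hω
    rw [hω]; exact this.2
  · refine (tsum_pmf_pure (p ⟨m, t⟩) fun ω => (ω.2.time : ℝ≥0∞)).le.trans ?_
    exact_mod_cast this.1

/-- Expected costs add up because T₂ bounds the remaining cost uniformly over all reachable
intermediate states. -/
theorem RSpec.bind {p : Rand α} {f : α → Rand β} {R : α → Mem → Prop} {Q : β → Mem → Prop}
    {T₁ T₂ : ℝ≥0∞} (h : RSpec p m T₁ R) (hf : ∀ a m', R a m' → RSpec (f a) m' T₂ Q) :
    RSpec (p >>= f) m (T₁ + T₂) Q := fun t => by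
  have hb : (p >>= f) ⟨m, t⟩ = (p ⟨m, t⟩ : PMF (α × Machine)).bind fun ω => f ω.1 ω.2 := rfl
  rw [hb]
  refine ⟨fun ω hω => ?_, ?_⟩
  · rw [PMF.mem_support_bind_iff] at hω
    obtain ⟨ω', h1, h2⟩ := hω
    exact (hf _ _ ((h t).1 ω' h1) ω'.2.time).1 ω h2
  · rw [tsum_pmf_bind]
    calc _ ≤ ∑' ω, (p ⟨m, t⟩ : PMF (α × Machine)) ω * ((ω.2.time : ℝ≥0∞) + T₂) :=
          tsum_pmf_le _ fun ω hω => (hf _ _ ((h t).1 ω hω) ω.2.time).2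
      _ = (∑' ω, (p ⟨m, t⟩ : PMF (α × Machine)) ω * (ω.2.time : ℝ≥0∞)) + T₂ := by
          simp_rw [mul_add]
          rw [ENNReal.tsum_add, ENNReal.tsum_mul_right, PMF.tsum_coe, one_mul]
      _ ≤ t + T₁ + T₂ := by gcongr; exact (h t).2
      _ = _ := by rw [add_assoc]

theorem RSpec.lift_bind {p : Det α} {f : α → Rand β} {R : α → Mem → Prop} {Q : β → Mem → Prop}
    {T₁ : ℕ} {T₂ : ℝ≥0∞} (h : Spec p m T₁ R) (hf : ∀ a m', R a m' → RSpec (f a) m' T₂ Q) :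
    RSpec ((liftM p : Rand α) >>= f) m (T₁ + T₂) Q := RSpec.bind (RSpec.lift h) hf

theorem RSpec.read_bind {a : Arr} {i : ℕ} {f : ℕ → Rand β} {Q : β → Mem → Prop}
    (hf : RSpec (f (m a i)) m T Q) : RSpec ((liftM (read a i) : Rand ℕ) >>= f) m (1 + T) Q := by
  have : Spec (read a i) m 1 fun x m' => x = m a i ∧ m' = m := fun t => by
    rw [wp_read]; exact ⟨le_rfl, rfl, rfl⟩
  have := RSpec.lift_bind (T₂ := T) this (f := f) (Q := Q) (by rintro _ _ ⟨rfl, rfl⟩; exact hf)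
  simpa using this

/-- Here expectations really get averaged: each outcome may have a bound τ i of its own. -/
theorem RSpec.randBelow_bind {k : ℕ} (hk : 0 < k) {f : ℕ → Rand β} {Q : β → Mem → Prop}
    {τ : ℕ → ℝ≥0∞} (hf : ∀ i < k, RSpec (f i) m (τ i) Q) :
    RSpec (randBelow k >>= f) m (1 + (∑ i ∈ Finset.range k, τ i) / k) Q := fun t => by
  have hb : (randBelow k >>= f) ⟨m, t⟩ =
      (PMF.uniformOfFinset (Finset.range k) (Finset.nonempty_range_iff.mpr hk.ne')).bind
        fun i => f i ⟨m, t + 1⟩ := by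
    change ((randBelow k ⟨m, t⟩ : PMF (ℕ × Machine)).bind fun ω => f ω.1 ω.2) = _
    unfold randBelow
    rw [dif_pos hk, PMF.bind_map]
    rfl
  rw [hb]
  refine ⟨fun ω hω => ?_, ?_⟩
  · rw [PMF.mem_support_bind_iff] at hω
    obtain ⟨i, h1, h2⟩ := hω
    rw [PMF.mem_support_uniformOfFinset_iff, Finset.mem_range] at h1
    exact (hf i h1 (t + 1)).1 ω h2
  · rw [tsum_pmf_bind]
    set u := PMF.uniformOfFinset (Finset.range k) (Finset.nonempty_range_iff.mpr hk.ne') with hu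
    calc _ ≤ ∑' i, u i * (((t + 1 : ℕ) : ℝ≥0∞) + τ i) := tsum_pmf_le _ fun i hi => by
          rw [hu, PMF.mem_support_uniformOfFinset_iff, Finset.mem_range] at hi
          exact (hf i hi (t + 1)).2
      _ = ((t + 1 : ℕ) : ℝ≥0∞) + ∑' i, u i * τ i := by
          simp_rw [mul_add]
          rw [ENNReal.tsum_add, ENNReal.tsum_mul_right, PMF.tsum_coe, one_mul]
      _ = ((t + 1 : ℕ) : ℝ≥0∞) + (∑ i ∈ Finset.range k, τ i) / k := by
          congr 1
          rw [tsum_eq_sum (s := Finset.range k) fun i hi => by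
            rw [hu, PMF.uniformOfFinset_apply, if_neg hi, zero_mul]]
          rw [div_eq_mul_inv, Finset.sum_mul]
          refine Finset.sum_congr rfl fun i hi => ?_
          rw [hu, PMF.uniformOfFinset_apply, if_pos hi, Finset.card_range, mul_comm]
      _ = _ := by push_cast; ring

end RSpec

/-! ### The expected length of the alternating path -/

namespace EdgeList

open Classical in
/-- The length of the longest walk from `v` alternating between `β` and `α`. -/
noncomputable def pathLen (g : EdgeList) (c : ℕ → ℕ) (v α β : ℕ) : ℕ :=
  Nat.findGreatest (fun L => ∃ p r, g.Walk c v α β L p r) (g.hi - g.lo)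

theorem pathLen_walk (v α β : ℕ) : ∃ p r, g.Walk c v α β (g.pathLen c v α β) p r := by
  classical
  unfold pathLen
  refine Nat.findGreatest_spec (P := fun L => ∃ p r, g.Walk c v α β L p r) (m := 0) (Nat.zero_le _)
    ⟨fun _ => v, fun _ => 0, rfl, ?_, ?_, ?_, ?_⟩ <;> intro i hi <;> omega

theorem Walk.le_pathLen (hg : g.Simple) (hc : g.Proper q c) {v α β L : ℕ} {p r : ℕ → ℕ}
    (hw : g.Walk c v α β L p r) (hα : α ≠ 0) (hβ : β ≠ 0) (hαβ : α ≠ β) (hv : g.Miss c v α) :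
    L ≤ g.pathLen c v α β := by
  classical
  exact Nat.le_findGreatest (hw.length_le hg hc hα hβ hαβ hv) ⟨p, r, hw⟩

/-- The vertices that are not isolated. -/
def V (g : EdgeList) : Finset ℕ := g.E.image g.s ∪ g.E.image g.t

theorem mem_V {v : ℕ} : v ∈ g.V ↔ ∃ e ∈ g.E, g.Inc e v := by
  unfold V Inc
  simp only [Finset.mem_union, Finset.mem_image]
  constructor
  · rintro (⟨e, he, h⟩ | ⟨e, he, h⟩)
    exacts [⟨e, he, Or.inl h⟩, ⟨e, he, Or.inr h⟩]
  · rintro ⟨e, he, h | h⟩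
    exacts [Or.inl ⟨e, he, h⟩, Or.inr ⟨e, he, h⟩]

/-- Every edge lies on at most two alternating paths for each choice of a second color. -/
theorem sum_pathLen_le (hc : g.Proper q c) :
    ∑ v ∈ g.V, ∑ α ∈ g.missing c q v, ∑ β ∈ (Finset.Icc 1 q).erase α, g.pathLen c v α β ≤
      2 * (g.hi - g.lo) * q := by
  classical
  choose p r hw using fun v α β => pathLen_walk (g := g) (c := c) v α β
  set S : Finset (Σ _ : ℕ, Σ _ : ℕ, Σ _ : ℕ, ℕ) :=
    g.V.sigma fun v => (g.missing c q v).sigma fun α => ((Finset.Icc 1 q).erase α).sigma fun β =>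
      Finset.range (g.pathLen c v α β) with hS
  have hcard : S.card = ∑ v ∈ g.V, ∑ α ∈ g.missing c q v, ∑ β ∈ (Finset.Icc 1 q).erase α,
      g.pathLen c v α β := by
    simp [hS, Finset.card_sigma]
  have hmem : ∀ x ∈ S, x.2.1 ∈ g.missing c q x.1 ∧ (1 ≤ x.2.2.1 ∧ x.2.2.1 ≤ q) ∧
      x.2.2.2 < g.pathLen c x.1 x.2.1 x.2.2.1 := by
    intro x hx
    simp only [hS, Finset.mem_sigma, Finset.mem_erase, Finset.mem_Icc, Finset.mem_range] at hx
    exact ⟨hx.2.1, hx.2.2.1.2, hx.2.2.2⟩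
  -- A position on a path is encoded by its edge, the other color of the pair, and the direction of
  -- traversal. This leaves at most 2 · q codes for each edge.
  let φ : (Σ _ : ℕ, Σ _ : ℕ, Σ _ : ℕ, ℕ) → ℕ × ℕ × Bool := fun x =>
    (r x.1 x.2.1 x.2.2.1 x.2.2.2, alt x.2.1 x.2.2.1 (x.2.2.2 + 1),
      decide (p x.1 x.2.1 x.2.2.1 x.2.2.2 = g.s (r x.1 x.2.1 x.2.2.1 x.2.2.2)))
  have hle : S.card ≤ (g.E ×ˢ Finset.Icc 1 q ×ˢ (Finset.univ : Finset Bool)).card := by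
    refine Finset.card_le_card_of_injOn φ ?_ ?_
    · intro x hx
      obtain ⟨h1, h2, h3⟩ := hmem x hx
      have h1 := (mem_missing.1 h1).1
      simp only [Finset.coe_product, Set.mem_prod, Finset.mem_coe, φ, Finset.mem_univ, and_true,
        Finset.mem_Icc]
      refine ⟨(hw _ _ _).mem _ h3, ?_⟩
      rcases alt_eq_or x.2.1 x.2.2.1 (x.2.2.2 + 1) with h | h <;> rw [h] <;> assumption
    · rintro ⟨v, α, β, i⟩ hx ⟨v', α', β', i'⟩ hx' heq
      obtain ⟨h1, h2, h3⟩ := hmem _ hx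
      obtain ⟨h1', h2', h3'⟩ := hmem _ hx'
      have h1 := mem_missing.1 h1
      have h1' := mem_missing.1 h1'
      dsimp only at h1 h2 h3 h1' h2' h3'
      simp only [φ, Prod.mk.injEq] at heq
      obtain ⟨he, ho, hp⟩ := heq
      -- The same edge traversed in the same direction is left from the same vertex; `Walk.unique`
      -- then identifies the two walks and positions.
      have hpp : p v α β i = p v' α' β' i' := by
        have e1 := (hw v α β).fst i h3
        have e2 := (hw v' α' β').fst i' h3'
        rw [← he] at e2 hp
        rw [decide_eq_decide] at hp
        unfold Inc at e1 e2
        grind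
      have := (hw v α β).unique hc (hw v' α' β') ⟨by omega, by omega, by omega, by omega⟩ h1.2 h1'.2
        i i' h3 h3' hpp (by rw [← (hw v α β).col i h3, ← (hw v' α' β').col i' h3', he]) ho
      obtain ⟨rfl, rfl, rfl, rfl⟩ := this
      rfl
  rw [hcard] at hle
  refine hle.trans (le_of_eq ?_)
  simp only [Finset.card_product, card_E, Nat.card_Icc, Finset.card_univ, Fintype.card_bool]
  rw [Nat.add_sub_cancel]
  ring

/-- The average over the uncolored edges, their endpoints, and the missing colors there. -/
noncomputable def average (g : EdgeList) (c : ℕ → ℕ) (q : ℕ) (Λ : ℕ → ℕ → ℕ) : ℝ≥0∞ :=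
  (∑ e ∈ g.unc c, ((∑ α ∈ g.missing c q (g.s e), (Λ (g.s e) α : ℝ≥0∞)) / (g.missing c q (g.s e)).card +
    (∑ α ∈ g.missing c q (g.t e), (Λ (g.t e) α : ℝ≥0∞)) / (g.missing c q (g.t e)).card) / 2) /
    (g.unc c).card

theorem average_const_le (n : ℕ) : g.average c q (fun _ _ => n) ≤ n := by
  unfold average
  refine ENNReal.div_le_of_le_mul ?_
  rw [mul_comm, ← nsmul_eq_mul]
  refine Finset.sum_le_card_nsmul _ _ _ fun e _ => ?_
  have : ∀ v, (∑ α ∈ g.missing c q v, (n : ℝ≥0∞)) / (g.missing c q v).card ≤ n := fun v => by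
    rw [Finset.sum_const, nsmul_eq_mul]
    exact ENNReal.div_le_of_le_mul (by rw [mul_comm])
  refine ENNReal.div_le_of_le_mul ?_
  rw [mul_two]
  exact add_le_add (this _) (this _)

/-- Exchanging the sums over uncolored edges and their endpoints, each vertex occurs as often as it
meets uncolored edges. That number is at most the number of its missing colors, which cancels the
averaging over α. The factor 2 from the two directions cancels the choice between two endpoints. -/
theorem average_pathLen_le (hg : g.Simple) (hc : g.Proper q c) (hq : ∀ v, g.deg v + 1 ≤ q) :
    g.average c q (fun v α => ∑ β ∈ (Finset.Icc 1 q).erase α, g.pathLen c v α β) ≤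
      ((g.hi - g.lo) * q : ℕ) / ((g.unc c).card : ℝ≥0∞) := by
  classical
  unfold average
  set Λ : ℕ → ℕ → ℕ := fun v α => ∑ β ∈ (Finset.Icc 1 q).erase α, g.pathLen c v α β with hΛ
  set Y : ℕ → ℝ≥0∞ := fun v => (∑ α ∈ g.missing c q v, (Λ v α : ℝ≥0∞)) / (g.missing c q v).card with hY
  refine ENNReal.div_le_div_right ?_ _
  have h1 : ∀ e ∈ g.unc c, (Y (g.s e) + Y (g.t e)) / 2 = (∑ v ∈ g.V.filter (g.Inc e), Y v) / 2 := by
    intro e he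
    have he := (mem_unc.1 he).1
    have : g.V.filter (g.Inc e) = {g.s e, g.t e} := by
      ext v
      simp only [Finset.mem_filter, mem_V, Finset.mem_insert, Finset.mem_singleton]
      constructor
      · rintro ⟨-, h | h⟩
        exacts [Or.inl h.symm, Or.inr h.symm]
      · rintro (rfl | rfl)
        exacts [⟨⟨e, he, inc_s e⟩, inc_s e⟩, ⟨⟨e, he, inc_t e⟩, inc_t e⟩]
    rw [this, Finset.sum_pair (hg.ne e he)]
  calc ∑ e ∈ g.unc c, (Y (g.s e) + Y (g.t e)) / 2
      = (∑ e ∈ g.unc c, ∑ v ∈ g.V.filter (g.Inc e), Y v) / 2 := by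
        rw [Finset.sum_congr rfl h1]
        simp only [div_eq_mul_inv, Finset.sum_mul]
    _ = (∑ v ∈ g.V, ∑ e ∈ (g.unc c).filter (fun e => g.Inc e v), Y v) / 2 := by
        congr 1
        exact Finset.sum_comm' (by intro e v; simp only [Finset.mem_filter]; tauto)
    _ ≤ (∑ v ∈ g.V, ∑ α ∈ g.missing c q v, (Λ v α : ℝ≥0∞)) / 2 := by
        refine ENNReal.div_le_div_right (Finset.sum_le_sum fun v hv => ?_) _
        rw [Finset.sum_const, nsmul_eq_mul]
        -- This is where it matters that the colors are drawn from all of 1, …, q: the missing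
        -- colors outnumber the uncolored edges at v.
        have hcard : ((g.unc c).filter fun e => g.Inc e v).card ≤ (g.missing c q v).card := by
          have h := card_missing c (hq v)
          have : (g.unc c).filter (fun e => g.Inc e v) = (g.star v).filter fun e => c e = 0 := by
            ext e; simp only [Finset.mem_filter, mem_unc, mem_star]; tauto
          rw [this]; omega
        calc _ ≤ ((g.missing c q v).card : ℝ≥0∞) * Y v := by gcongr
          _ ≤ _ := ENNReal.mul_div_le
    _ ≤ ((2 * (g.hi - g.lo) * q : ℕ) : ℝ≥0∞) / 2 := by
        refine ENNReal.div_le_div_right ?_ _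
        exact_mod_cast sum_pathLen_le hc
    _ = _ := by
        rw [mul_assoc, Nat.cast_mul, mul_comm, Nat.cast_two,
          ENNReal.mul_div_cancel_right (by simp) (by simp)]

end EdgeList

/-! ### Expected time of one call of Random-Color-One. -/

theorem average_add_mul {k : ℕ} (hk : 0 < k) (A B : ℝ≥0∞) (x : ℕ → ℝ≥0∞) :
    (∑ i ∈ Finset.range k, (A + B * x i)) / k = A + B * ((∑ i ∈ Finset.range k, x i) / k) := by
  rw [Finset.sum_add_distrib, Finset.sum_const, Finset.card_range, nsmul_eq_mul, ← Finset.mul_sum,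
    ENNReal.add_div, mul_comm (k : ℝ≥0∞) A, ENNReal.mul_div_cancel_right (by simpa using hk.ne') (by simp),
    mul_div_assoc]

/-- The bound Λ may depend on the drawn v and α but not on β, because β is found only while the fan
is made. The factor 57 consists of 8 steps for tracing and 49 for flipping an edge of the path. -/
theorem randomColorOne_average (hg : g.Simple) (hc : g.Proper (d + 1) c) (h : RS g d c m)
    (hpos : (g.unc c).Nonempty) {Λ : ℕ → ℕ → ℕ}
    (hΛ : ∀ v α β L p r, α ∈ g.missing c (d + 1) v → 1 ≤ β → β ≤ d + 1 → α ≠ β →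
      g.Walk c v α β L p r → L ≤ Λ v α) :
    RSpec (randomColorOne g.lo g.hi d) m
      (((68 * (d + 1) + 50 : ℕ) : ℝ≥0∞) + 57 * g.average c (d + 1) Λ) fun _ m' =>
      ∃ c' e, e ∈ g.unc c ∧ RS g d c' m' ∧ g.Proper (d + 1) c' ∧ (∀ f, c' f = 0 ↔ c f = 0 ∧ f ≠ e) ∧ ∀ f ∉ g.E, c' f = c f := by
  set Q : Unit → Mem → Prop := fun _ m' => ∃ c' e, e ∈ g.unc c ∧ RS g d c' m' ∧
    g.Proper (d + 1) c' ∧ (∀ f, c' f = 0 ↔ c f = 0 ∧ f ≠ e) ∧ ∀ f ∉ g.E, c' f = c f with hQ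
  have hcnt : m .unCnt 0 = (g.unc c).card := h.ds.unc.cnt_eq_card fun x => Iff.rfl
  have hℓ : 0 < (g.unc c).card := Finset.card_pos.2 hpos
  set Y : ℕ → ℝ≥0∞ := fun v =>
    (∑ α ∈ g.missing c (d + 1) v, (Λ v α : ℝ≥0∞)) / (g.missing c (d + 1) v).card with hY
  have hactivate : ∀ e ∈ g.unc c, ∀ v, g.Inc e v → ∀ α ∈ g.missing c (d + 1) v, ∀ m', RS g d c m' →
      RSpec (do
        let F ← makePrimedFan g.lo g.hi d v e
        activateFan g.lo g.hi d α v F) m' (((62 * (d + 1) + 42 : ℕ) : ℝ≥0∞) + 57 * (Λ v α : ℝ≥0∞)) Q := by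
    intro e he v hv α hα m' h'
    have he' := EdgeList.mem_unc.1 he
    have hα' := EdgeList.mem_missing.1 hα
    refine (RSpec.lift_bind (T₂ := ((50 * (d + 1) + 57 * Λ v α + 40 : ℕ) : ℝ≥0∞))
      (makePrimedFan_spec hg hc h' he'.1 hv he'.2) ?_).mono ?_ fun _ _ h => h
    · rintro r m1 ⟨hP, h1⟩
      refine RSpec.lift fun t => wp_mono (activateFan_wp hg hc h1 (by omega) hα'.1.2 hα'.2 hP t) ?_
      rintro - m2 t2 ⟨⟨L, β, p, ρ, hb1, hb2, hne, hw, ht⟩, c', h2, h3, h4⟩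
      have := hΛ v α β L p ρ hα hb1 hb2 hne hw
      exact ⟨by omega, c', e, he, h2, h3, h4⟩
    · push_cast
      ring_nf
      rfl
  have hcolor : ∀ e ∈ g.unc c, ∀ v, g.Inc e v → ∀ m', RS g d c m' →
      RSpec (do
        let k ← listMissing g.lo g.hi d v
        let r ← randBelow k
        let α ← read .scratch r
        let F ← makePrimedFan g.lo g.hi d v e
        activateFan g.lo g.hi d α v F) m' (((68 * (d + 1) + 44 : ℕ) : ℝ≥0∞) + 57 * Y v) Q := by
    intro e he v hv m' h'
    have he' := EdgeList.mem_unc.1 he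
    refine (RSpec.lift_bind (T₂ := ((62 * (d + 1) + 44 : ℕ) : ℝ≥0∞) + 57 * Y v)
      (listMissing_spec h' v) ?_).mono ?_ fun _ _ h => h
    · rintro k m1 ⟨h1, hk, hmem, hinj⟩
      have hkpos : 0 < k := by
        rw [hk]
        have := EdgeList.card_missing c (h'.ds.mu.le v (EdgeList.star_nonempty he'.1 hv) |>.trans
          le_rfl |> Nat.succ_le_succ)
        exact lt_of_lt_of_le (Nat.succ_pos _) this
      refine (RSpec.randBelow_bind hkpos (τ := fun r => ((62 * (d + 1) + 43 : ℕ) : ℝ≥0∞) +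
        57 * (Λ v (m1 .scratch r) : ℝ≥0∞)) fun r hr => ?_).mono ?_ fun _ _ h => h
      · refine (RSpec.read_bind (hactivate e he v hv _ (hmem r hr) m1 h1)).mono ?_ fun _ _ h => h
        push_cast
        ring_nf
        rfl
      · rw [average_add_mul hkpos]
        have : ∑ i ∈ Finset.range k, (Λ v (m1 .scratch i) : ℝ≥0∞) =
            ∑ α ∈ g.missing c (d + 1) v, (Λ v α : ℝ≥0∞) := by
          refine Finset.sum_nbij (m1 .scratch) (fun i hi => hmem i (Finset.mem_range.1 hi))
            (fun i hi j hj hij => hinj i (by simpa using hi) j (by simpa using hj) hij) ?_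
            fun _ _ => rfl
          refine Finset.surjOn_of_injOn_of_card_le _ (fun i hi => hmem i (by simpa using hi))
            (fun i hi j hj hij => hinj i (by simpa using hi) j (by simpa using hj) hij) ?_
          rw [Finset.card_range, hk]
        rw [this, hY, hk]
        push_cast
        ring_nf
        rfl
    · push_cast
      ring_nf
      rfl
  unfold randomColorOne
  refine (RSpec.read_bind (T := ((68 * (d + 1) + 49 : ℕ) : ℝ≥0∞) + 57 * g.average c (d + 1) Λ)
    ?_).mono ?_ fun _ _ h => h
  · rw [hcnt]
    refine (RSpec.randBelow_bind hℓ (τ := fun i => ((68 * (d + 1) + 48 : ℕ) : ℝ≥0∞) +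
      57 * ((Y (g.s (m .unArr i)) + Y (g.t (m .unArr i))) / 2)) fun i hi => ?_).mono ?_
      fun _ _ h => h
    · have hel := h.ds.unc.elem i (by rw [hcnt]; exact hi)
      rw [zero_add] at hel
      set e := m .unArr i with he
      have heu : e ∈ g.unc c := hel.1
      refine (RSpec.read_bind (T := ((68 * (d + 1) + 47 : ℕ) : ℝ≥0∞) +
        57 * ((Y (g.s e) + Y (g.t e)) / 2)) ?_).mono ?_ fun _ _ h => h
      · rw [← he]
        refine (RSpec.randBelow_bind (k := 2) (by omega) (τ := fun side =>
          ((68 * (d + 1) + 45 : ℕ) : ℝ≥0∞) + 57 * (if side = 0 then Y (g.s e) else Y (g.t e)))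
          fun side hside => ?_).mono ?_ fun _ _ h => h
        · split
          · rename_i h0
            refine (RSpec.read_bind (T := ((68 * (d + 1) + 44 : ℕ) : ℝ≥0∞) + 57 * Y (g.s e)) ?_).mono
              ?_ fun _ _ h => h
            · rw [h.ds.src]
              exact hcolor e heu _ (g.inc_s e) m h
            · push_cast
              ring_nf
              rfl
          · rename_i h0
            refine (RSpec.read_bind (T := ((68 * (d + 1) + 44 : ℕ) : ℝ≥0∞) + 57 * Y (g.t e)) ?_).mono
              ?_ fun _ _ h => h
            · rw [h.ds.dst]
              exact hcolor e heu _ (g.inc_t e) m h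
            · push_cast
              ring_nf
              rfl
        · rw [average_add_mul (by omega)]
          simp only [Finset.sum_range_succ, Finset.sum_range_zero, zero_add, if_true, one_ne_zero,
            if_false]
          push_cast
          rw [← add_assoc]
          refine add_le_add ?_ le_rfl
          ring_nf
          gcongr
          norm_num
      · push_cast
        ring_nf
        rfl
    · rw [average_add_mul hℓ]
      have : ∑ i ∈ Finset.range (g.unc c).card, ((Y (g.s (m .unArr i)) + Y (g.t (m .unArr i))) / 2) =
          ∑ e ∈ g.unc c, ((Y (g.s e) + Y (g.t e)) / 2) := by
        have hmem : ∀ i ∈ Finset.range (g.unc c).card, m .unArr i ∈ g.unc c := fun i hi => by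
          have := (h.ds.unc.elem i (by rw [hcnt]; simpa using hi)).1
          rw [zero_add] at this
          exact this
        have hinj : Set.InjOn (m .unArr) (Finset.range (g.unc c).card) := fun i hi j hj hij => by
          refine h.ds.unc.arr_inj (by rw [hcnt]; simpa using hi) (by rw [hcnt]; simpa using hj) ?_
          simpa using hij
        refine Finset.sum_nbij (m .unArr) hmem hinj ?_ fun _ _ => rfl
        refine Finset.surjOn_of_injOn_of_card_le _ (fun i hi => hmem i hi) hinj ?_
        rw [Finset.card_range]
      rw [this]
      change _ ≤ _ + 57 * ((∑ e ∈ g.unc c, (Y (g.s e) + Y (g.t e)) / 2) / (g.unc c).card)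
      push_cast
      ring_nf
      rfl
  · push_cast
    ring_nf
    rfl

/-- The expected running time of Random-Color-One, and what it does to the coloring. -/
theorem randomColorOne_rspec (hg : g.Simple) (hc : g.Proper (d + 1) c) (h : RS g d c m)
    (hpos : (g.unc c).Nonempty) (hd : ∀ v, g.deg v ≤ d) {n : ℕ} (hd1 : 1 ≤ d) (hdn : d < n)
    (hn : ∀ e ∈ g.E, g.s e < n ∧ g.t e < n) :
    RSpec (randomColorOne g.lo g.hi d) m
      (ENNReal.ofReal (300 * min (n : ℝ) (((g.hi - g.lo : ℕ) : ℝ) * d / (g.unc c).card)))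
      fun _ m' => ∃ c' e, e ∈ g.unc c ∧ RS g d c' m' ∧ g.Proper (d + 1) c' ∧
        (∀ f, c' f = 0 ↔ c f = 0 ∧ f ≠ e) ∧ ∀ f ∉ g.E, c' f = c f := by
  have hℓ : 0 < (g.unc c).card := Finset.card_pos.2 hpos
  have hℓm : (g.unc c).card ≤ g.hi - g.lo := by
    rw [← EdgeList.card_E]; exact Finset.card_filter_le _ _
  have h1 := randomColorOne_average hg hc h hpos (Λ := fun _ _ => n)
    fun v α β L p r hα hb1 hb2 hne hw => by
      have hα' := EdgeList.mem_missing.1 hα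
      exact hw.length_le_vertices hg hc (by omega) (by omega) hne hα'.2 hn
  -- Summing over all second colors makes the bound independent of how the fan determines β.
  have h2 := randomColorOne_average hg hc h hpos
    (Λ := fun v α => ∑ β ∈ (Finset.Icc 1 (d + 1)).erase α, g.pathLen c v α β)
    fun v α β L p r hα hb1 hb2 hne hw => by
      have hα' := EdgeList.mem_missing.1 hα
      refine (hw.le_pathLen hg hc (by omega) (by omega) hne hα'.2).trans ?_
      exact Finset.single_le_sum (f := fun β => g.pathLen c v α β) (fun _ _ => Nat.zero_le _)
        (Finset.mem_erase.2 ⟨hne.symm, Finset.mem_Icc.2 ⟨hb1, hb2⟩⟩)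
  refine (h1.min h2).mono ?_ fun _ _ h => h
  rw [mul_min_of_nonneg _ _ (by norm_num), ENNReal.ofReal_mono.map_min]
  refine min_le_min ?_ ?_
  · calc _ ≤ ((68 * (d + 1) + 50 : ℕ) : ℝ≥0∞) + 57 * (n : ℝ≥0∞) := by
          gcongr; exact EdgeList.average_const_le n
      _ = ((68 * (d + 1) + 50 + 57 * n : ℕ) : ℝ≥0∞) := by push_cast; ring
      _ ≤ ((300 * n : ℕ) : ℝ≥0∞) := by gcongr; omega
      _ = _ := by
          rw [← ENNReal.ofReal_natCast]; push_cast; rfl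
  · calc _ ≤ ((68 * (d + 1) + 50 : ℕ) : ℝ≥0∞) +
          57 * (((g.hi - g.lo) * (d + 1) : ℕ) / ((g.unc c).card : ℝ≥0∞)) := by
          gcongr; exact EdgeList.average_pathLen_le hg hc fun v => by have := hd v; omega
      _ = ENNReal.ofReal ((68 * (d + 1) + 50 : ℕ) +
          57 * (((g.hi - g.lo) * (d + 1) : ℕ) / ((g.unc c).card : ℝ))) := by
          rw [ENNReal.ofReal_add (by positivity) (by positivity), ENNReal.ofReal_mul (by norm_num),
            ENNReal.ofReal_div_of_pos (by exact_mod_cast hℓ)]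
          simp only [ENNReal.ofReal_natCast, ENNReal.ofReal_ofNat]
      _ ≤ _ := by
          refine ENNReal.ofReal_le_ofReal ?_
          have hℓ' : (0 : ℝ) < (g.unc c).card := by exact_mod_cast hℓ
          rw [mul_div_assoc', mul_div_assoc', ← sub_nonneg, ← sub_nonneg]
          rw [show (300 * (((g.hi - g.lo : ℕ) : ℝ) * d) / ((g.unc c).card : ℝ) -
            (((68 * (d + 1) + 50 : ℕ) : ℝ) + 57 * (((g.hi - g.lo) * (d + 1) : ℕ) : ℝ) /
              ((g.unc c).card : ℝ)) - 0) =
            (300 * (((g.hi - g.lo : ℕ) : ℝ) * d) - ((68 * (d + 1) + 50 : ℕ) : ℝ) * (g.unc c).card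
              - 57 * (((g.hi - g.lo) * (d + 1) : ℕ) : ℝ)) / ((g.unc c).card : ℝ) by
            field_simp; ring]
          refine div_nonneg ?_ hℓ'.le
          have e1 : ((g.unc c).card : ℝ) ≤ ((g.hi - g.lo : ℕ) : ℝ) := by exact_mod_cast hℓm
          have e2 : (1 : ℝ) ≤ d := by exact_mod_cast hd1
          push_cast
          nlinarith

/-! ### Degrees -/

namespace EdgeList

/-- The subgraph of the edges before `i`. -/
def upto (g : EdgeList) (i : ℕ) : EdgeList := { g with hi := i }

theorem upto_hi (g : EdgeList) : g.upto g.hi = g := rfl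

theorem mem_E_upto {i e : ℕ} : e ∈ (g.upto i).E ↔ g.lo ≤ e ∧ e < i := Finset.mem_Ico

theorem upto_lo_E : (g.upto g.lo).E = ∅ := Finset.Ico_self _

theorem star_upto_succ {i : ℕ} (hi : g.lo ≤ i) (v : ℕ) :
    (g.upto (i + 1)).star v = if g.Inc i v then insert i ((g.upto i).star v) else (g.upto i).star v := by
  ext e
  have : ∀ j, (g.upto j).Inc e v ↔ g.Inc e v := fun j => Iff.rfl
  split <;> simp only [Finset.mem_insert, mem_star, mem_E_upto, this]
  · rename_i h
    constructor
    · rintro ⟨⟨h1, h2⟩, h3⟩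
      by_cases he : e = i
      · exact Or.inl he
      · exact Or.inr ⟨⟨h1, by omega⟩, h3⟩
    · rintro (rfl | ⟨⟨h1, h2⟩, h3⟩)
      · exact ⟨⟨hi, by omega⟩, h⟩
      · exact ⟨⟨h1, by omega⟩, h3⟩
  · rename_i h
    constructor
    · rintro ⟨⟨h1, h2⟩, h3⟩
      have he : e ≠ i := by rintro rfl; exact h h3
      exact ⟨⟨h1, by omega⟩, h3⟩
    · rintro ⟨⟨h1, h2⟩, h3⟩
      exact ⟨⟨h1, by omega⟩, h3⟩

theorem deg_upto_succ {i : ℕ} (hi : g.lo ≤ i) (v : ℕ) :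
    (g.upto (i + 1)).deg v = (g.upto i).deg v + if g.Inc i v then 1 else 0 := by
  unfold deg
  rw [star_upto_succ hi]
  split
  · rw [Finset.card_insert_of_notMem]
    intro h
    have := mem_E_upto.1 (mem_star.1 h).1
    omega
  · rfl

/-- `D` is the maximum degree. -/
def IsMaxDeg (g : EdgeList) (D : ℕ) : Prop := (∀ v, g.deg v ≤ D) ∧ ∃ v, g.deg v = D

theorem sum_star (f : ℕ → ℕ) : ∑ v ∈ g.V, ∑ e ∈ g.star v, f e =
    ∑ e ∈ g.E, ∑ v ∈ g.V.filter (g.Inc e), f e :=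
  Finset.sum_comm' (by intro v e; simp only [Finset.mem_filter, mem_star]; tauto)

theorem sum_deg_le : ∑ v ∈ g.V, g.deg v ≤ 2 * (g.hi - g.lo) := by
  have h := sum_star (g := g) fun _ => 1
  simp only [Finset.sum_const, smul_eq_mul, mul_one] at h
  unfold deg
  rw [h, ← card_E, mul_comm, ← smul_eq_mul]
  refine Finset.sum_le_card_nsmul _ _ _ fun e he => ?_
  refine (Finset.card_le_card (t := {g.s e, g.t e}) fun v hv => ?_).trans Finset.card_le_two
  rcases (Finset.mem_filter.1 hv).2 with h | h <;> simp [← h]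

theorem card_V_le : g.V.card ≤ 2 * (g.hi - g.lo) := by
  unfold V
  refine (Finset.card_union_le _ _).trans ?_
  have h1 : (g.E.image g.s).card ≤ _ := Finset.card_image_le
  have h2 : (g.E.image g.t).card ≤ _ := Finset.card_image_le
  rw [card_E] at h1 h2
  omega

end EdgeList

-- The first pass clears just the cells of endpoints of edges, so nothing is claimed about the cells
-- of isolated vertices.
open EdgeList in
theorem maxDegree_spec (hg : g.Simple) (hle : g.lo ≤ g.hi) (hs : m .src = g.s) (ht : m .dst = g.t) :
    Spec (maxDegree g.lo g.hi) m (12 * (g.hi - g.lo)) fun D m' => g.IsMaxDeg D ∧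
      (∀ v, (g.star v).Nonempty → m' .deg v = g.deg v) ∧ ∀ a : Arr, a ≠ .deg → m' a = m a := by
  unfold maxDegree
  refine Spec.bind (7 * (g.hi - g.lo)) (T₁ := 5 * (g.hi - g.lo))
    (R := fun _ m' => (∀ v, (g.star v).Nonempty → m' .deg v = 0) ∧ ∀ a : Arr, a ≠ .deg → m' a = m a)
    ?_ ?_ (by omega)
  · refine (Spec.forRange _ g.lo g.hi hle (fun i m' =>
      (∀ v, ((g.upto i).star v).Nonempty → m' .deg v = 0) ∧ ∀ a : Arr, a ≠ .deg → m' a = m a) 4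
      ⟨fun v hv => ?_, fun _ _ => rfl⟩ ?_).mono (by omega) fun _ _ h => h
    · obtain ⟨e, he⟩ := hv
      have := mem_E_upto.1 (mem_star.1 he).1
      omega
    · rintro i hi hi' m' ⟨h1, h2⟩ t
      simp only [wp_bind, wp_read, wp_write, Mem.set_of_ne, ne_eq, reduceCtorEq, not_false_eq_true]
      refine ⟨by omega, fun v hv => ?_, fun a ha => ?_⟩
      · rw [star_upto_succ hi] at hv
        simp only [Mem.set_self, Function.update_apply, h2 .src (by decide), h2 .dst (by decide), hs, ht]
        split
        · rfl
        · split
          · rfl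
          · refine h1 v ?_
            rwa [if_neg] at hv
            unfold Inc
            grind
      · rw [Mem.set_of_ne _ ha, Mem.set_of_ne _ ha, h2 a ha]
  · rintro - m1 ⟨hz, hfr⟩
    refine (Spec.loop _ (g.hi - g.lo) 0 (fun i best m' => (g.upto (g.lo + i)).IsMaxDeg best ∧
      (∀ v, (g.star v).Nonempty → m' .deg v = (g.upto (g.lo + i)).deg v) ∧
      ∀ a : Arr, a ≠ .deg → m' a = m a) 6 ⟨⟨?_, 0, ?_⟩, ?_, hfr⟩ ?_).mono (by omega) ?_
    · intro v; simp [EdgeList.deg, EdgeList.star, upto_lo_E]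
    · simp [EdgeList.deg, EdgeList.star, upto_lo_E]
    · intro v hv; rw [hz v hv]; simp [EdgeList.deg, EdgeList.star, upto_lo_E]
    · rintro i hi best m' ⟨⟨h1, v0, h1'⟩, h2, h3⟩ t
      simp only [wp_bind, wp_read, wp_write, wp_pure, Mem.set_self, Mem.set_of_ne, ne_eq, reduceCtorEq,
        not_false_eq_true]
      set e := g.lo + i with he
      have heE : e ∈ g.E := mem_E.2 ⟨by omega, by omega⟩
      have hne := hg.ne e heE
      rw [h3 .src (by decide), h3 .dst (by decide), hs, ht, Function.update_of_ne hne.symm,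
        h2 _ (star_nonempty heE (inc_s e)), h2 _ (star_nonempty heE (inc_t e))]
      have hdeg : ∀ v, (g.upto (g.lo + (i + 1))).deg v =
          (g.upto e).deg v + if g.Inc e v then 1 else 0 := fun v =>
        deg_upto_succ (Nat.le_add_right g.lo i) v
      refine ⟨by omega, ⟨fun v => ?_, ?_⟩, fun v hv => ?_, fun a ha => ?_⟩
      · rw [hdeg]
        have := h1 v
        split
        · rename_i h
          rcases h with rfl | rfl <;> omega
        · omega
      -- The new maximum is attained either at an endpoint of e or at the old vertex v0; if v0 is
      -- itself an endpoint, it still attains the maximum after growing by one.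
      · have ha := hdeg (g.s e)
        have hb := hdeg (g.t e)
        have h0 := hdeg v0
        rw [if_pos (inc_s e)] at ha
        rw [if_pos (inc_t e)] at hb
        by_cases hv0 : g.Inc e v0
        · rw [if_pos hv0] at h0
          have e1 := h1 (g.s e)
          have e2 := h1 (g.t e)
          exact ⟨v0, by rcases hv0 with rfl | rfl <;> omega⟩
        · rw [if_neg hv0] at h0
          rcases le_total best (max ((g.upto e).deg (g.s e) + 1) ((g.upto e).deg (g.t e) + 1)) with h | h
          · rcases le_total ((g.upto e).deg (g.s e)) ((g.upto e).deg (g.t e)) with h' | h'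
            · exact ⟨g.t e, by omega⟩
            · exact ⟨g.s e, by omega⟩
          · exact ⟨v0, by omega⟩
      · rw [hdeg]
        simp only [Function.update_apply]
        have := h2 v hv
        unfold Inc
        grind
      · rw [Mem.set_of_ne _ ha, Mem.set_of_ne _ ha, h3 a ha]
    · rintro D m' ⟨h1, h2, h3⟩
      rw [show g.lo + (g.hi - g.lo) = g.hi by omega] at h1 h2
      exact ⟨h1, h2, h3⟩

/-! ### Setting up the data structures -/

/-- The initial sets `μ(v)`: already filled for `v ∈ W`. -/
def fullSets (g : EdgeList) (W : Finset ℕ) (v : ℕ) : Set ℕ :=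
  {x | v ∈ W ∧ 1 ≤ x ∧ x ≤ g.deg v + 1}

/-- Amortized: the cost 5(deg v + 1) is paid only when v enters W. A zero counter detects the first
visit, because a filled set contains the color 1. -/
theorem muFill_wp {W : Finset ℕ} (h : Mu g d (fullSets g W) m) {v : ℕ} (hv : (g.star v).Nonempty)
    (t : ℕ) :
    wp (muFill d v) m t fun _ m' t' =>
      t' + ∑ u ∈ W, 5 * (g.deg u + 1) ≤ t + 2 + ∑ u ∈ insert v W, 5 * (g.deg u + 1) ∧
      Mu g d (fullSets g (insert v W)) m' ∧
      ∀ a : Arr, a ≠ .muArr → a ≠ .muPos → a ≠ .muCnt → m' a = m a := by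
  unfold muFill
  simp only [wp_bind, wp_read, wp_ite, wp_pure]
  have hd := h.le v hv
  refine ⟨fun h0 => ?_, fun h0 => ?_⟩
  · have hvW : v ∉ W := by
      intro hvW
      have := ((h.mu v hv).index 1 ⟨hvW, le_rfl, by omega⟩).1
      omega
    rw [h.deg v hv]
    have key := Spec.forRange (m := m) (fun γ => setInsert .muArr .muPos .muCnt (cell d v 0) v γ) 1
      (g.deg v + 2) (by omega) (fun i m' =>
        Mu g d (Function.update (fullSets g W) v {x | 1 ≤ x ∧ x < i}) m' ∧ i ≤ g.deg v + 2 ∧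
        ∀ a : Arr, a ≠ .muArr → a ≠ .muPos → a ≠ .muCnt → m' a = m a) 4 ⟨?_, by omega, fun _ _ _ _ => rfl⟩ ?_
    · refine wp_mono (key _) ?_
      rintro - m' t' ⟨ht, hMu, -, hfr⟩
      refine ⟨?_, hMu.congr (fun w hw => ?_) rfl rfl rfl rfl, hfr⟩
      · rw [Finset.sum_insert hvW]; omega
      · by_cases hwv : w = v
        · subst hwv
          rw [Function.update_self]
          ext x
          simp only [fullSets, Finset.mem_insert, true_or, true_and, Set.mem_ofPred_eq]
          omega
        · rw [Function.update_of_ne hwv]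
          ext x
          simp only [fullSets, Finset.mem_insert, hwv, false_or, Set.mem_ofPred_eq]
    · refine h.congr (fun w hw => ?_) rfl rfl rfl rfl
      by_cases hwv : w = v
      · subst hwv
        rw [Function.update_self]
        ext x
        simp only [fullSets, hvW, false_and, Set.mem_ofPred_eq]
        exact ⟨fun h => by omega, False.elim⟩
      · rw [Function.update_of_ne hwv]
    · rintro i hi hi' m' ⟨hMu, -, hfr⟩ t
      -- For a color at most deg v + 1, `muInsert` differs from the bare insertion by a degree read
      -- and a test, so its specification yields the invariant.
      have hins := muInsert_spec hMu hv hi (γ := i) (by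
        rw [Function.update_self]; simp) 0
      unfold muInsert at hins
      simp only [wp_bind, wp_read, wp_ite, wp_pure] at hins
      have hins := hins.1 (by rw [hMu.deg v hv]; omega)
      rw [setInsert_wp _ _ _ _ _ _ _ _ _ (by decide) (by decide) (by decide)] at hins ⊢
      obtain ⟨-, h1, h2⟩ := hins
      refine ⟨le_rfl, h1.congr (fun w hw => ?_) rfl rfl rfl rfl, by omega, fun a h3 h4 h5 =>
        (h2 a h3 h4 h5).trans (hfr a h3 h4 h5)⟩
      rw [Function.update_idem, Function.update_self]
      by_cases hwv : w = v
      · subst hwv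
        rw [Function.update_self, Function.update_self]
        ext x
        simp only [Set.mem_union, Set.mem_ofPred_eq]
        omega
      · rw [Function.update_of_ne hwv, Function.update_of_ne hwv]
  · have hvW : v ∈ W := by
      by_contra hvW
      have := (h.mu v hv).cnt_eq_card (F := ∅) (by simp [fullSets, hvW])
      exact h0 (by simpa using this)
    rw [Finset.insert_eq_of_mem hvW]
    exact ⟨by omega, h, by simp⟩

-- After the sets are filled as for the empty coloring, the edges are entered one by one; the
-- coloring cc i, restricted to the edges before i, is the invariant. Filling takes linear time
-- because deg v + 1 sums to at most four times the number of edges over the non-isolated vertices.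
open EdgeList in
theorem initRepair_spec (hg : g.Simple) (hle : g.lo ≤ g.hi) (hs : m .src = g.s) (ht : m .dst = g.t)
    (hd : ∀ v, g.deg v ≤ d) (hc : g.Proper (d + 1) c) (hcol : m .col = c) :
    Spec (initRepair g.lo g.hi d) m (90 * (g.hi - g.lo) + 1) fun _ m' => RS g d c m' := by
  intro t
  unfold initRepair
  refine (maxDegree_spec hg hle hs ht).wp_bind ?_
  rintro D m1 t1 ⟨-, hdeg1, hfr1⟩ ht1
  rw [wp_bind, wp_write]
  set m2 := m1.set .unCnt 0 0 with hm2
  have hfr2 : ∀ a : Arr, a ≠ .deg → a ≠ .unCnt → m2 a = m a := fun a h1 h2 => by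
    rw [hm2, Mem.set_of_ne _ h2, hfr1 a h1]
  have hdeg2 : ∀ v, (g.star v).Nonempty → m2 .deg v = g.deg v := fun v hv => hdeg1 v hv
  have hun2 : m2 .unCnt 0 = 0 := by simp [hm2, Mem.set_self]
  -- clearing the counters
  have hclear := Spec.forRange (m := m2) (fun e => do
      write .muCnt (← read .src e) 0
      write .muCnt (← read .dst e) 0) g.lo g.hi hle (fun i m' =>
      (∀ v, ((g.upto i).star v).Nonempty → m' .muCnt v = 0) ∧ ∀ a : Arr, a ≠ .muCnt → m' a = m2 a) 4
      ⟨fun v hv => ?_, fun _ _ => rfl⟩ ?_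
  rotate_left
  · obtain ⟨e, he⟩ := hv
    have := mem_E_upto.1 (mem_star.1 he).1
    omega
  · rintro i hi hi' m' ⟨h1, h2⟩ t
    simp only [wp_bind, wp_read, wp_write, Mem.set_of_ne, ne_eq, reduceCtorEq, not_false_eq_true]
    refine ⟨by omega, fun v hv => ?_, fun a ha => ?_⟩
    · rw [star_upto_succ hi] at hv
      simp only [Mem.set_self, Function.update_apply, h2 .src (by decide), h2 .dst (by decide),
        hfr2 .src (by decide) (by decide), hfr2 .dst (by decide) (by decide), hs, ht]
      split
      · rfl
      · split
        · rfl
        · refine h1 v ?_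
          rwa [if_neg] at hv
          unfold Inc
          grind
    · rw [Mem.set_of_ne _ ha, Mem.set_of_ne _ ha, h2 a ha]
  refine hclear.wp_bind ?_
  rintro - m3 t3 ⟨hcnt3, hfr3⟩ ht3
  rw [wp_bind]
  have hMu3 : Mu g d (fullSets g ∅) m3 := by
    refine ⟨fun v hv => ?_, fun v _ => hd v, fun v hv x hx => hx.2, fun v hv => ⟨fun i hi => ?_, fun x hx => ?_⟩⟩
    · rw [hfr3 .deg (by decide)]; exact hdeg2 v hv
    · rw [hcnt3 v hv] at hi; omega
    · simp [fullSets] at hx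
  -- filling the sets
  have hfill := wp_forRange (m := m3) (t := t3) (fun e => do
      muFill d (← read .src e)
      muFill d (← read .dst e)) g.lo g.hi hle (fun i m' t' =>
      t' ≤ t3 + 7 * (i - g.lo) + ∑ u ∈ (g.upto i).V, 5 * (g.deg u + 1) ∧
      Mu g d (fullSets g (g.upto i).V) m' ∧
      ∀ a : Arr, a ≠ .muArr → a ≠ .muPos → a ≠ .muCnt → m' a = m3 a) ⟨by omega, ?_, fun _ _ _ _ => rfl⟩ ?_
  rotate_left
  · have : (g.upto g.lo).V = ∅ := by
      unfold V; rw [upto_lo_E]; rfl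
    rw [this]; exact hMu3
  · rintro i hi hi' m' t' ⟨h1, h2, h3⟩
    have hiE : i ∈ g.E := mem_E.2 ⟨hi, hi'⟩
    have hsrc : m' .src = g.s := by
      rw [h3 _ (by decide) (by decide) (by decide), hfr3 _ (by decide),
        hfr2 _ (by decide) (by decide), hs]
    have hV : (g.upto (i + 1)).V = insert (g.t i) (insert (g.s i) (g.upto i).V) := by
      ext v
      simp only [Finset.mem_insert, mem_V, mem_E_upto]
      constructor
      · rintro ⟨e, he, h⟩
        by_cases hei : e = i
        · subst hei
          rcases h with h | h
          exacts [Or.inr (Or.inl h.symm), Or.inl h.symm]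
        · exact Or.inr (Or.inr ⟨e, by omega, h⟩)
      · rintro (rfl | rfl | ⟨e, he, h⟩)
        exacts [⟨i, by omega, inc_t i⟩, ⟨i, by omega, inc_s i⟩, ⟨e, by omega, h⟩]
    rw [wp_bind, wp_read, wp_bind, hsrc]
    refine wp_mono (muFill_wp h2 (star_nonempty hiE (inc_s i)) _) ?_
    rintro - m'' t'' ⟨h4, h5, h6⟩
    have hdst : m'' .dst = g.t := by
      rw [h6 _ (by decide) (by decide) (by decide), h3 _ (by decide) (by decide) (by decide),
        hfr3 _ (by decide), hfr2 _ (by decide) (by decide), ht]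
    rw [wp_bind, wp_read, hdst]
    refine wp_mono (muFill_wp h5 (star_nonempty hiE (inc_t i)) _) ?_
    rintro - m5 t5 ⟨h7, h8, h9⟩
    rw [hV]
    refine ⟨by omega, h8, fun a ha hb hc => ?_⟩
    rw [h9 a ha hb hc, h6 a ha hb hc, h3 a ha hb hc]
  refine wp_mono hfill ?_
  rintro - m4 t4 ⟨ht4, hMu4, hfr4⟩
  rw [upto_hi] at ht4 hMu4
  have hsum : ∑ u ∈ g.V, 5 * (g.deg u + 1) ≤ 20 * (g.hi - g.lo) := by
    rw [← Finset.mul_sum, Finset.sum_add_distrib, Finset.sum_const, smul_eq_mul, mul_one]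
    have := sum_deg_le (g := g)
    have := card_V_le (g := g)
    omega
  have hfr24 : ∀ a : Arr, a ≠ .muArr → a ≠ .muPos → a ≠ .muCnt → m4 a = m2 a := fun a h1 h2 h3 => by
    rw [hfr4 a h1 h2 h3, hfr3 a h3]
  have hsrc4 : m4 .src = g.s := by
    rw [hfr24 _ (by decide) (by decide) (by decide), hfr2 _ (by decide) (by decide), hs]
  have hdst4 : m4 .dst = g.t := by
    rw [hfr24 _ (by decide) (by decide) (by decide), hfr2 _ (by decide) (by decide), ht]
  have hcol4 : m4 .col = c := by
    rw [hfr24 _ (by decide) (by decide) (by decide), hfr2 _ (by decide) (by decide), hcol]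
  -- entering the colored edges
  let cc : ℕ → ℕ → ℕ := fun i e => if e < i then c e else 0
  let U : ℕ → Set ℕ := fun i => {e | (g.lo ≤ e ∧ e < i) ∧ c e = 0}
  have hlast := Spec.forRange (m := m4) (fun e => do
    let γ ← read .col e
    write .col e 0
    setInsert .unArr .unPos .unCnt 0 0 e
    if γ = 0 then return () else colorEdge d e γ) g.lo g.hi hle (fun i m' =>
      DS g d (cc i) (U i) m' ∧ m' .col = c) 31 ⟨⟨hsrc4, hdst4, ?_, ?_, ?_, ?_⟩, hcol4⟩ ?_
  · refine wp_mono (hlast _) ?_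
    rintro - m5 t5 ⟨ht5, hDS, hcol5⟩
    refine ⟨by omega, ?_, hcol5⟩
    have hU : U g.hi = {e | e ∈ g.unc c} := by
      ext e; simp only [U, Set.mem_ofPred_eq, mem_unc, mem_E]
    rw [← hU]
    refine hDS.congr (fun e he => ?_) fun _ _ _ _ _ _ => rfl
    simp only [cc]; rw [if_pos (mem_E.1 he).2]
  · intro e he h0
    simp only [cc] at h0
    rw [if_neg (by have := mem_E.1 he; omega)] at h0
    exact absurd rfl h0
  · refine hMu4.congr (fun v hv => ?_) rfl rfl rfl rfl
    obtain ⟨e, he⟩ := hv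
    have hvV : v ∈ g.V := mem_V.2 ⟨e, (mem_star.1 he).1, (mem_star.1 he).2⟩
    ext x
    simp only [muSet, fullSets, Set.mem_ofPred_eq, hvV, true_and]
    refine ⟨fun h => h.1, fun h => ⟨h, fun f hf _ => ?_⟩⟩
    simp only [cc]
    rw [if_neg (by have := mem_E.1 hf; omega)]
    omega
  · intro i hi
    rw [hfr24 _ (by decide) (by decide) (by decide), hun2] at hi
    omega
  · rintro x ⟨hx, -⟩
    omega
  · rintro i hi hi' m' ⟨hDS, hcol'⟩ t
    have hiE : i ∈ g.E := mem_E.2 ⟨hi, hi'⟩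
    simp only [wp_bind, wp_read, wp_write, wp_ite, wp_pure]
    rw [setInsert_wp _ _ _ _ _ _ _ _ _ (by decide) (by decide) (by decide), hcol']
    set m5 := m'.set .col i 0 with hm5
    set m6 := ((m5.set .unArr (0 + m5 .unCnt 0) i).set .unPos (0 + i) (m5 .unCnt 0)).set .unCnt 0
      (m5 .unCnt 0 + 1) with hm6
    have hun6 : StoresSet m6 .unArr .unPos .unCnt 0 0 (insert i (U i)) := by
      refine hDS.unc.insert (fun h => by have := h.1; omega) ?_ ?_ ?_ <;>
      simp [hm6, hm5, Mem.set_self, Mem.set_of_ne]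
    have hDS6 : DS g d (cc i) (insert i (U i)) m6 :=
      ⟨hDS.src, hDS.dst, hDS.dict, hDS.mu.congr (fun _ _ => rfl) rfl rfl rfl rfl, hun6⟩
    have hcol6 : m6 .col = Function.update c i 0 := by
      simp only [hm6, hm5, Mem.set_self, Mem.set_of_ne, ne_eq, reduceCtorEq, not_false_eq_true, hcol']
    have hci : cc i i = 0 := by simp [cc]
    have hsub : ∀ e ∈ g.E, cc i e = 0 ∨ cc i e = c e := fun e he => by
      simp only [cc]; split <;> simp
    have hccs : Function.update (cc i) i (c i) = cc (i + 1) := by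
      funext e
      simp only [cc, Function.update_apply]
      by_cases he : e = i
      · subst he; simp
      · simp only [he, if_false]
        exact if_congr (by omega) rfl rfl
    refine ⟨fun h0 => ⟨by omega, ?_, ?_⟩, fun h0 => ?_⟩
    · have : insert i (U i) = U (i + 1) := by
        ext e
        simp only [U, Set.mem_insert_iff, Set.mem_ofPred_eq]
        constructor
        · rintro (rfl | h)
          exacts [⟨by omega, h0⟩, ⟨by omega, h.2⟩]
        · rintro ⟨h1, h2⟩
          by_cases he : e = i
          exacts [Or.inl he, Or.inr ⟨by omega, h2⟩]
      rw [← this, ← hccs, h0, ← hci, Function.update_eq_self]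
      exact hDS6
    · rw [hcol6, ← h0, Function.update_eq_self]
    · refine wp_mono (colorEdge_spec hg hDS6 (hc.of_sub hsub) hiE (Or.inl rfl) hci
        (Nat.pos_of_ne_zero h0) (hc.le i hiE) (fun v hv => hc.miss_of_sub hsub hiE hv h0 hci) _) ?_
      rintro - m7 t7 ⟨ht7, hDS7, hcol7, -⟩
      refine ⟨by omega, ?_, ?_⟩
      · have : insert i (U i) \ {i} = U (i + 1) := by
          ext e
          simp only [U, Set.mem_insert_iff, Set.mem_ofPred_eq, Set.mem_sdiff, Set.mem_singleton_iff]
          constructor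
          · rintro ⟨rfl | h, h'⟩
            exacts [absurd rfl h', ⟨by omega, h.2⟩]
          · rintro ⟨h1, h2⟩
            have : e ≠ i := by rintro rfl; exact h0 h2
            exact ⟨Or.inr ⟨by omega, h2⟩, this⟩
        rw [← this, ← hccs]
        exact hDS7
      · rw [hcol7, hcol6, Function.update_idem, Function.update_eq_self]

/-! ### The repair loop -/

/-- Every outcome of Random-Color-One has exactly one uncolored edge less. So the sequence of values
ℓ is not random, and the expected costs of the calls can simply be summed. -/
theorem repairLoop_rspec (hg : g.Simple) (hd : ∀ v, g.deg v ≤ d) {n : ℕ} (hd1 : 1 ≤ d) (hdn : d < n)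
    (hn : ∀ e ∈ g.E, g.s e < n ∧ g.t e < n) (b : ℕ) : ∀ (c : ℕ → ℕ) (m : Mem),
    g.Proper (d + 1) c → RS g d c m → (g.unc c).card ≤ b →
    RSpec (repairLoop g.lo g.hi d b) m
      (1 + ∑ ℓ ∈ Finset.range (g.unc c).card, (1 + ENNReal.ofReal (300 * min (n : ℝ)
        (((g.hi - g.lo : ℕ) : ℝ) * d / ((ℓ + 1 : ℕ) : ℝ))))) fun _ m' => ∃ c', RS g d c' m' ∧
          g.Proper (d + 1) c' ∧ (∀ e ∈ g.E, c' e ≠ 0) ∧ ∀ e ∉ g.E, c' e = c e := by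
  induction b with
  | zero =>
    intro c m hc h hb
    refine (RSpec.pure ⟨c, h, hc, fun e he h0 => ?_, fun _ _ => rfl⟩).mono zero_le fun _ _ h => h
    have := Finset.card_eq_zero.1 (Nat.le_zero.1 hb)
    exact absurd (EdgeList.mem_unc.2 ⟨he, h0⟩) (by simp [this])
  | succ b ih =>
    intro c m hc h hb
    unfold repairLoop
    have hcnt : m .unCnt 0 = (g.unc c).card := h.ds.unc.cnt_eq_card fun x => Iff.rfl
    refine RSpec.read_bind ?_
    rw [hcnt]
    split
    · rename_i h0
      refine (RSpec.pure ⟨c, h, hc, fun e he h0' => ?_, fun _ _ => rfl⟩).mono zero_le fun _ _ h => h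
      have := Finset.card_eq_zero.1 h0
      exact absurd (EdgeList.mem_unc.2 ⟨he, h0'⟩) (by simp [this])
    · rename_i h0
      obtain ⟨ℓ, hℓ⟩ : ∃ ℓ, (g.unc c).card = ℓ + 1 := ⟨(g.unc c).card - 1, by omega⟩
      have hpos : (g.unc c).Nonempty := Finset.card_pos.1 (by omega)
      refine (RSpec.bind (randomColorOne_rspec hg hc h hpos hd hd1 hdn hn) ?_ (T₂ := 1 +
        ∑ ℓ ∈ Finset.range ℓ, (1 + ENNReal.ofReal (300 * min (n : ℝ)
        (((g.hi - g.lo : ℕ) : ℝ) * d / ((ℓ + 1 : ℕ) : ℝ)))))).mono ?_ fun _ _ h => h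
      · rintro - m' ⟨c', e, he, h', hc', h1, h2⟩
        have : g.unc c' = (g.unc c).erase e := by
          ext f
          simp only [EdgeList.mem_unc, Finset.mem_erase, h1]
          tauto
        have hcard : (g.unc c').card = ℓ := by
          rw [this, Finset.card_erase_of_mem he, hℓ]; rfl
        have := ih c' m' hc' h' (by omega)
        rw [hcard] at this
        refine this.mono le_rfl ?_
        rintro - m'' ⟨c'', h3, h4, h5, h6⟩
        exact ⟨c'', h3, h4, h5, fun e he => (h6 e he).trans (h2 e he)⟩
      · rw [hℓ, Finset.sum_range_succ]
        refine le_of_eq ?_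
        ring

/-! ### Recoloring whole color classes -/

theorem colorAll_spec {lo hi : ℕ} (hle : lo ≤ hi) :
    Spec (colorAll lo hi) m (2 * (hi - lo)) fun _ m' =>
      (∀ e, m' .col e = if lo ≤ e ∧ e < hi then 1 else m .col e) ∧
      ∀ a : Arr, a ≠ .col → m' a = m a := by
  unfold colorAll
  refine (Spec.forRange _ lo hi hle (fun i m' =>
    (∀ e, m' .col e = if lo ≤ e ∧ e < i then 1 else m .col e) ∧
      ∀ a : Arr, a ≠ .col → m' a = m a) 1 ⟨fun e => ?_, fun _ _ => rfl⟩ ?_).mono (by omega) fun _ _ h => h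
  · rw [if_neg (by omega)]
  · rintro i hi hi' m' ⟨h1, h2⟩ t
    rw [wp_write]
    refine ⟨by omega, fun e => ?_, fun a ha => by rw [Mem.set_of_ne _ ha, h2 a ha]⟩
    rw [Mem.set_self, Function.update_apply, h1]
    split_ifs <;> first | rfl | omega

theorem relabel_spec {lo hi k : ℕ} (hle : lo ≤ hi) :
    Spec (relabel lo hi k) m (3 * (hi - lo)) fun _ m' =>
      (∀ e, m' .col e = if lo ≤ e ∧ e < hi then m .col e + k else m .col e) ∧
      ∀ a : Arr, a ≠ .col → m' a = m a := by
  unfold relabel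
  refine (Spec.forRange _ lo hi hle (fun i m' =>
    (∀ e, m' .col e = if lo ≤ e ∧ e < i then m .col e + k else m .col e) ∧
      ∀ a : Arr, a ≠ .col → m' a = m a) 2 ⟨fun e => ?_, fun _ _ => rfl⟩ ?_).mono (by omega) fun _ _ h => h
  · rw [if_neg (by omega)]
  · rintro i hi hi' m' ⟨h1, h2⟩ t
    simp only [wp_bind, wp_read, wp_write]
    refine ⟨by omega, fun e => ?_, fun a ha => by rw [Mem.set_of_ne _ ha, h2 a ha]⟩
    rw [Mem.set_self, Function.update_apply, h1, h1]
    split_ifs <;> first | rfl | omega | (subst_vars; rfl)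

theorem eliminate_spec {lo hi q γ : ℕ} (hle : lo ≤ hi) :
    Spec (eliminate lo hi q γ) m (3 * (hi - lo)) fun _ m' =>
      (∀ e, m' .col e = if lo ≤ e ∧ e < hi then
        (if m .col e = γ then 0 else if m .col e = q then γ else m .col e) else m .col e) ∧
      ∀ a : Arr, a ≠ .col → m' a = m a := by
  unfold eliminate
  refine (Spec.forRange _ lo hi hle (fun i m' =>
    (∀ e, m' .col e = if lo ≤ e ∧ e < i then
        (if m .col e = γ then 0 else if m .col e = q then γ else m .col e) else m .col e) ∧
      ∀ a : Arr, a ≠ .col → m' a = m a) 2 ⟨fun e => ?_, fun _ _ => rfl⟩ ?_).mono (by omega) fun _ _ h => h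
  · rw [if_neg (by omega)]
  · rintro i hi hi' m' ⟨h1, h2⟩ t
    have hi1 : m' .col i = m .col i := by rw [h1, if_neg (by omega)]
    simp only [wp_bind, wp_read, wp_write, wp_ite, wp_pure, hi1]
    refine ⟨fun hx => ⟨by omega, fun e => ?_, fun a ha => by rw [Mem.set_of_ne _ ha, h2 a ha]⟩,
      fun hx => ⟨fun hx' => ⟨by omega, fun e => ?_, fun a ha => by rw [Mem.set_of_ne _ ha, h2 a ha]⟩,
      fun hx' => ⟨by omega, fun e => ?_, h2⟩⟩⟩
    · rw [Mem.set_self, Function.update_apply, h1]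
      by_cases he : e = i
      · subst he; simp [hx, hi]
      · rw [if_neg he]; exact if_congr (by omega) rfl rfl
    · rw [Mem.set_self, Function.update_apply, h1]
      by_cases he : e = i
      · subst he; rw [if_pos rfl, if_pos (by omega), if_neg hx, if_pos hx']
      · rw [if_neg he]; exact if_congr (by omega) rfl rfl
    · rw [h1]
      by_cases he : e = i
      · subst he; rw [if_neg (by omega), if_pos (by omega), if_neg hx, if_neg hx']
      · exact if_congr (by omega) rfl rfl

/-- The edges of color `γ`. -/
def EdgeList.colorClass (g : EdgeList) (c : ℕ → ℕ) (γ : ℕ) : Finset ℕ := g.E.filter fun e => c e = γ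

-- The minimum is at most the average: the q classes are disjoint sets of edges. Uncolored edges are
-- not counted as a class.
open EdgeList in
theorem leastCommon_spec {q : ℕ} (hq : 1 ≤ q) (hle : g.lo ≤ g.hi) (hc : ∀ e ∈ g.E, m .col e ≤ q) :
    Spec (leastCommon g.lo g.hi q) m (5 * q + 4 * (g.hi - g.lo)) fun γ m' =>
      (1 ≤ γ ∧ γ ≤ q) ∧ q * (g.colorClass (m .col) γ).card ≤ g.hi - g.lo ∧
      ∀ a : Arr, a ≠ .classSize → m' a = m a := by
  unfold leastCommon
  refine Spec.bind (3 * q + 4 * (g.hi - g.lo)) (T₁ := 2 * q)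
    (R := fun _ m' => (∀ γ, 1 ≤ γ → γ ≤ q → m' .classSize γ = 0) ∧
      ∀ a : Arr, a ≠ .classSize → m' a = m a) ?_ ?_ (by omega)
  · refine (Spec.forRange _ 1 (q + 1) (by omega) (fun i m' =>
      (∀ γ, 1 ≤ γ → γ < i → m' .classSize γ = 0) ∧ ∀ a : Arr, a ≠ .classSize → m' a = m a) 1
      ⟨fun γ h1 h2 => by omega, fun _ _ => rfl⟩ ?_).mono (by omega)
      fun _ _ h => ⟨fun γ h1 h2 => h.1 γ h1 (by omega), h.2⟩
    rintro i hi hi' m' ⟨h1, h2⟩ t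
    rw [wp_write]
    refine ⟨by omega, fun γ h3 h4 => ?_, fun a ha => by rw [Mem.set_of_ne _ ha, h2 a ha]⟩
    rw [Mem.set_self, Function.update_apply]
    split
    · rfl
    · exact h1 γ h3 (by omega)
  rintro - m1 ⟨hz, hfr1⟩
  refine Spec.bind (3 * q) (T₁ := 4 * (g.hi - g.lo))
    (R := fun _ m' => (∀ γ, 1 ≤ γ → γ ≤ q → m' .classSize γ = (g.colorClass (m .col) γ).card) ∧
      ∀ a : Arr, a ≠ .classSize → m' a = m a) ?_ ?_ (by omega)
  · refine (Spec.forRange _ g.lo g.hi hle (fun i m' =>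
      (∀ γ, 1 ≤ γ → γ ≤ q → m' .classSize γ = ((g.upto i).colorClass (m .col) γ).card) ∧
      ∀ a : Arr, a ≠ .classSize → m' a = m a) 3 ⟨fun γ h1 h2 => ?_, hfr1⟩ ?_).mono (by omega) fun _ _ h => h
    · rw [hz γ h1 h2, colorClass, upto_lo_E]; rfl
    · rintro i hi hi' m' ⟨h1, h2⟩ t
      have hiE : i ∈ g.E := mem_E.2 ⟨hi, hi'⟩
      have hE : (g.upto (i + 1)).E = insert i (g.upto i).E := by
        ext e; simp only [Finset.mem_insert, mem_E_upto]; omega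
      have hnot : i ∉ (g.upto i).E := fun h => by have := mem_E_upto.1 h; omega
      simp only [wp_bind, wp_read, wp_write, wp_ite, wp_pure, h2 .col (by decide)]
      refine ⟨fun hx => ⟨by omega, fun γ h3 h4 => ?_, h2⟩,
        fun hx => ⟨by omega, fun γ h3 h4 => ?_, fun a ha => by rw [Mem.set_of_ne _ ha, h2 a ha]⟩⟩
      · rw [h1 γ h3 h4, colorClass, colorClass, hE, Finset.filter_insert, if_neg (by omega)]
      · rw [Mem.set_self, Function.update_apply, colorClass, hE, Finset.filter_insert]
        by_cases hγ : m .col i = γ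
        · rw [if_pos hγ.symm, if_pos hγ, Finset.card_insert_of_notMem (by simp [hnot]), hγ, h1 γ h3 h4]
          rfl
        · rw [if_neg (Ne.symm hγ), if_neg hγ, h1 γ h3 h4]; rfl
  rintro - m2 ⟨hcs, hfr2⟩
  refine (Spec.loop _ (q - 1) 1 (fun i best m' => m' = m2 ∧ 1 ≤ best ∧ best ≤ i + 1 ∧
    ∀ γ, 1 ≤ γ → γ ≤ i + 1 → m2 .classSize best ≤ m2 .classSize γ) 2
    ⟨rfl, le_rfl, le_rfl, fun γ h1 h2 => by rw [show γ = 1 by omega]⟩ ?_).mono (by omega) ?_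
  · rintro i hi best m ⟨rfl, h1, h2, h3⟩ t
    simp only [wp_bind, wp_read]
    split
    · rename_i hlt
      rw [wp_pure]
      refine ⟨by omega, rfl, by omega, by omega, fun γ h4 h5 => ?_⟩
      by_cases hγ : γ = i + 2
      · rw [hγ]
      · exact hlt.le.trans (h3 γ h4 (by omega))
    · rename_i hlt
      rw [wp_pure]
      refine ⟨by omega, rfl, h1, by omega, fun γ h4 h5 => ?_⟩
      by_cases hγ : γ = i + 2
      · rw [hγ]; omega
      · exact h3 γ h4 (by omega)
  · rintro γ m3 ⟨hm3, h1, h2, h3⟩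
    subst hm3
    refine ⟨⟨h1, by omega⟩, ?_, hfr2⟩
    have : ∑ γ' ∈ Finset.Icc 1 q, (g.colorClass (m .col) γ').card ≤ g.hi - g.lo := by
      rw [← card_E]
      refine (Finset.sum_le_sum_of_subset (Finset.Icc_subset_Icc_left (Nat.zero_le 1))).trans ?_
      refine le_of_eq (Finset.card_eq_sum_card_fiberwise fun e he => ?_).symm
      simpa using hc e he
    refine le_trans ?_ this
    have h4 := Finset.card_nsmul_le_sum (Finset.Icc 1 q) (fun γ' => (g.colorClass (m .col) γ').card)
      (g.colorClass (m .col) γ).card fun γ' hγ' => by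
        rw [Finset.mem_Icc] at hγ'
        rw [← hcs γ h1 (by omega), ← hcs γ' hγ'.1 hγ'.2]
        exact h3 γ' hγ'.1 (by omega)
    simpa using h4

/-! ### The coloring after eliminating a class, and the Prune step. -/

namespace EdgeList

/-- Uncoloring the color class `γ`, and renaming the color `q` to `γ`. -/
def elim (c : ℕ → ℕ) (q γ e : ℕ) : ℕ := if c e = γ then 0 else if c e = q then γ else c e

theorem Proper.elim {q γ : ℕ} (hc : g.Proper q c) (h1 : 1 ≤ γ) (h2 : γ ≤ q) :
    g.Proper (q - 1) (elim c q γ) where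
  le e he := by
    have := hc.le e he
    unfold EdgeList.elim
    split_ifs <;> omega
  ne e he f hf hne v hev hfv h0 h := by
    refine hc.ne e he f hf hne v hev hfv ?_ ?_
    · intro h; apply h0; unfold EdgeList.elim; rw [h]; split_ifs <;> omega
    · unfold EdgeList.elim at h0 h
      split_ifs at h0 h <;> omega

theorem Proper.mono {q q' : ℕ} (hc : g.Proper q c) (h : q ≤ q') : g.Proper q' c :=
  ⟨fun e he => (hc.le e he).trans h, hc.ne⟩

theorem Proper.congr {q : ℕ} {c' : ℕ → ℕ} (hc : g.Proper q c) (h : ∀ e ∈ g.E, c' e = c e) :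
    g.Proper q c' :=
  hc.of_sub fun e he => Or.inr (h e he)

theorem card_unc_elim {q γ : ℕ} (h1 : 1 ≤ γ) (hq : 1 ≤ q) :
    (g.unc (elim c q γ)).card ≤ (g.unc c).card + (g.colorClass c γ).card := by
  refine (Finset.card_le_card (t := g.unc c ∪ g.colorClass c γ) fun e he => ?_).trans
    (Finset.card_union_le _ _)
  obtain ⟨he, h0⟩ := mem_unc.1 he
  rw [Finset.mem_union]
  unfold elim at h0
  split_ifs at h0 with h h'
  · exact Or.inr (Finset.mem_filter.2 ⟨he, h⟩)
  · omega
  · exact Or.inl (mem_unc.2 ⟨he, h0⟩)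

end EdgeList

-- A class is eliminated only while at least k + 1 colors are in use, so it contains at most a
-- (k+1)-th of the edges. The count is kept multiplied by k + 1 to avoid division.
open EdgeList in
theorem prune_spec {k q : ℕ} (hle : g.lo ≤ g.hi) (hc : g.Proper q (m .col)) :
    Spec (prune g.lo g.hi k q) m ((q - k) * (5 * q + 7 * (g.hi - g.lo) + 1)) fun _ m' =>
      g.Proper k (m' .col) ∧
      (k + 1) * (g.unc (m' .col)).card ≤ (k + 1) * (g.unc (m .col)).card + (q - k) * (g.hi - g.lo) ∧
      (∀ e ∉ g.E, m' .col e = m .col e) ∧ ∀ a : Arr, a ≠ .col → a ≠ .classSize → m' a = m a := by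
  unfold prune
  refine Spec.bind 0 (R := fun _ m' => g.Proper k (m' .col) ∧
      (k + 1) * (g.unc (m' .col)).card ≤ (k + 1) * (g.unc (m .col)).card + (q - k) * (g.hi - g.lo) ∧
      (∀ e ∉ g.E, m' .col e = m .col e) ∧ ∀ a : Arr, a ≠ .col → a ≠ .classSize → m' a = m a)
    ((Spec.loop _ (q - k) q (fun i q' m' => q' = q - i ∧ g.Proper q' (m' .col) ∧
      (k + 1) * (g.unc (m' .col)).card ≤ (k + 1) * (g.unc (m .col)).card + i * (g.hi - g.lo) ∧
      (∀ e ∉ g.E, m' .col e = m .col e) ∧ ∀ a : Arr, a ≠ .col → a ≠ .classSize → m' a = m a)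
      (5 * q + 7 * (g.hi - g.lo)) ⟨rfl, hc, by omega, fun _ _ => rfl, fun _ _ _ => rfl⟩ ?_).mono le_rfl ?_)
    ?_ le_rfl
  · rintro i hi q' m' ⟨hq', h1, h2, h3, h4⟩ t
    refine (leastCommon_spec (q := q') (by omega) hle h1.le).wp_bind ?_
    rintro γ m1 t1 ⟨⟨hγ1, hγq⟩, hcl, hfr1⟩ ht1
    refine (eliminate_spec (q := q') (γ := γ) hle).wp_bind ?_
    rintro - m2 t2 ⟨hcol, hfr2⟩ ht2
    rw [wp_pure]
    rw [hfr1 .col (by decide)] at hcol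
    have hcolE : ∀ e ∈ g.E, m2 .col e = elim (m' .col) q' γ e := fun e he => by
      rw [hcol, if_pos (mem_E.1 he)]; rfl
    have hunc : g.unc (m2 .col) = g.unc (elim (m' .col) q' γ) := by
      ext e
      simp only [mem_unc]
      exact and_congr_right fun he => by rw [hcolE e he]
    refine ⟨by omega, by omega, (h1.elim hγ1 hγq).congr hcolE, ?_, fun e he => ?_, fun a ha hb => ?_⟩
    · have h5 := card_unc_elim (g := g) (c := m' .col) (q := q') hγ1 (by omega)
      rw [← hunc] at h5
      have h6 : (k + 1) * (g.colorClass (m' .col) γ).card ≤ g.hi - g.lo :=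
        (Nat.mul_le_mul_right _ (by omega)).trans hcl
      have h7 := Nat.mul_le_mul_left (k + 1) h5
      rw [mul_add] at h7
      have h8 : (i + 1) * (g.hi - g.lo) = i * (g.hi - g.lo) + (g.hi - g.lo) := by ring
      omega
    · rw [hcol, if_neg (fun h => he (mem_E.2 h)), h3 e he]
    · rw [hfr2 a ha, hfr1 a hb, h4 a ha hb]
  · rintro q' m' ⟨hq', h1, h2, h3, h4⟩
    exact ⟨h1.mono (by omega), h2, h3, h4⟩
  · rintro - m' h t
    rw [wp_pure]
    exact ⟨by omega, h⟩

/-! ### Partition into tours -/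

/-- The linked list starting at `h` has the elements `l`. -/
def Linked (nxt : ℕ → ℕ) : ℕ → List ℕ → Prop
  | h, [] => h = 0
  | h, a :: l => h = a ∧ a ≠ 0 ∧ Linked nxt (nxt a) l

theorem Linked.update {nxt : ℕ → ℕ} {a x : ℕ} (l : List ℕ) : ∀ h, Linked nxt h l → a ∉ l →
    Linked (Function.update nxt a x) h l := by
  induction l with
  | nil => exact fun h hl _ => hl
  | cons b l ih =>
    rintro h ⟨h1, h2, h3⟩ ha
    rw [List.mem_cons, not_or] at ha
    exact ⟨h1, h2, by rw [Function.update_of_ne (Ne.symm ha.1)]; exact ih _ h3 ha.2⟩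

theorem Linked.zero {nxt : ℕ → ℕ} {l : List ℕ} (h : Linked nxt 0 l) : l = [] := by
  cases l with
  | nil => rfl
  | cons a l => exact absurd h.1.symm h.2.1

theorem Linked.pop {nxt : ℕ → ℕ} {h : ℕ} {l : List ℕ} (hl : Linked nxt h l) (h0 : h ≠ 0) :
    ∃ l', l = h :: l' ∧ Linked nxt (nxt h) l' := by
  cases l with
  | nil => exact absurd hl h0
  | cons a l => obtain ⟨rfl, -, h3⟩ := hl; exact ⟨l, rfl, h3⟩

/-- The number of edges at `v` not yet visited. -/
def rem (g : EdgeList) (vis : ℕ → ℕ) (v : ℕ) : ℕ := ((g.star v).filter fun e => vis e ≠ 1).card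

/-- The number of edges at `v` in even positions minus the number of those in odd positions. -/
def bal (g : EdgeList) (τ : ℕ → ℕ) (k v : ℕ) : ℤ :=
  ∑ i ∈ Finset.range k, if g.Inc (τ i) v then (-1) ^ i else 0

/-- The total length of the incidence lists. -/
def lists (g : EdgeList) (H : ℕ → List ℕ) : ℕ := ∑ v ∈ g.V, (H v).length

theorem lists_update {H : ℕ → List ℕ} {v : ℕ} (hv : v ∈ g.V) (l : List ℕ) :
    lists g (Function.update H v l) + (H v).length = lists g H + l.length := by
  unfold lists
  have h1 := Finset.add_sum_erase g.V (fun u => (H u).length) hv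
  have h2 := Finset.add_sum_erase g.V (fun u => (Function.update H v l u).length) hv
  rw [Function.update_self] at h2
  have h3 : ∑ u ∈ g.V.erase v, (Function.update H v l u).length = ∑ u ∈ g.V.erase v, (H u).length :=
    Finset.sum_congr rfl fun u hu => by rw [Function.update_of_ne (Finset.ne_of_mem_erase hu)]
  omega

/-- The incidence lists. -/
structure Incidence (g : EdgeList) (H : ℕ → List ℕ) (m : Mem) : Prop where
  src : m .src = g.s
  dst : m .dst = g.t
  linked : ∀ v ∈ g.V, Linked (m .nxt) (m .head v) (H v)
  sound : ∀ v, ∀ h ∈ H v, (h - 1) / 2 ∈ g.E ∧ g.Inc ((h - 1) / 2) v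

/-- The state during the removal of tours; `k` is the number of edges visited. -/
structure TourInv (g : EdgeList) (H : ℕ → List ℕ) (k : ℕ) (m : Mem) : Prop
    extends Incidence g H m where
  compl : ∀ e ∈ g.E, m .vis e ≠ 1 → ∀ v, g.Inc e v → ∃ h ∈ H v, (h - 1) / 2 = e
  deg : ∀ v ∈ g.V, m .deg v = rem g (m .vis) v
  len : m .tourLen 0 = k
  mem : ∀ i < k, m .tour i ∈ g.E
  inj : ∀ i < k, ∀ j < k, m .tour i = m .tour j → i = j
  vis : ∀ e ∈ g.E, m .vis e = 1 ↔ ∃ i < k, m .tour i = e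

theorem rem_visit {vis : ℕ → ℕ} {e v : ℕ} (he : e ∈ g.E) (h : vis e ≠ 1) :
    rem g (Function.update vis e 1) v + (if g.Inc e v then 1 else 0) = rem g vis v := by
  unfold rem
  have : (g.star v).filter (fun f => Function.update vis e 1 f ≠ 1) =
      ((g.star v).filter fun f => vis f ≠ 1).erase e := by
    ext f
    simp only [Finset.mem_filter, Finset.mem_erase, Function.update_apply]
    by_cases hf : f = e <;> simp [hf]
  rw [this]
  split
  · rename_i hev
    have hmem : e ∈ (g.star v).filter fun f => vis f ≠ 1 :=
      Finset.mem_filter.2 ⟨EdgeList.mem_star.2 ⟨he, hev⟩, h⟩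
    rw [Finset.card_erase_of_mem hmem]
    have := Finset.card_pos.2 ⟨e, hmem⟩
    omega
  · rename_i hev
    rw [Finset.erase_eq_of_notMem]
    · rfl
    · intro hmem
      exact hev (EdgeList.mem_star.1 (Finset.mem_filter.1 hmem).1).2

def TourFrame (m m' : Mem) : Prop :=
  ∀ a : Arr, a ≠ .head → a ≠ .vis → a ≠ .tour → a ≠ .tourLen → a ≠ .deg → m' a = m a

/-- The effect of removing a tour that starts at `v`. -/
structure Toured (g : EdgeList) (v k k' : ℕ) (m m' : Mem) (w : ℕ) : Prop where
  last : rem g (m' .vis) w = 0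
  bal : ∀ u, bal g (m' .tour) k' u = bal g (m .tour) k u + (if u = v then (-1) ^ k else 0) -
    (if u = w then (-1) ^ k' else 0)
  parity : ∀ u, (rem g (m' .vis) u + (if u = v then 1 else 0) + if u = w then 1 else 0) % 2 =
    rem g (m .vis) u % 2
  le : ∀ u, rem g (m' .vis) u ≤ rem g (m .vis) u
  trivial : rem g (m .vis) v = 0 → w = v ∧ k' = k

-- At an inner visit of a vertex, the arriving and the departing edge have consecutive positions and
-- opposite signs. Only the first departure, with sign (-1)^k, and the last arrival, at position k'
-- - 1, affect the balance. Each iteration but the last deletes a list element, which pays for its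
-- at most 14 steps and shows that the iteration bound suffices.
open EdgeList in
theorem walkTour_wp (hg : g.Simple) (b : ℕ) : ∀ (v k : ℕ) (H : ℕ → List ℕ) (m : Mem) (t : ℕ),
    TourInv g H k m → v ∈ g.V → lists g H < b →
    wp (walkTour b v) m t fun _ m' t' => ∃ H' k' w, TourInv g H' k' m' ∧ w ∈ g.V ∧
      t' + 14 * lists g H' ≤ t + 14 * lists g H + 1 ∧ lists g H' ≤ lists g H ∧
      Toured g v k k' m m' w ∧ TourFrame m m' := by
  induction b with
  | zero => intro v k H m t h hv hb; omega
  | succ b ih =>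
    intro v k H m t h hv hb
    unfold walkTour
    simp only [wp_bind, wp_read, wp_write, wp_ite, wp_pure, wp_other, Mem.set_self, Mem.set_of_ne, ne_eq,
      reduceCtorEq, not_false_eq_true]
    refine ⟨fun h0 => ?_, fun h0 => ?_⟩
    · refine ⟨H, k, v, h, hv, by omega, le_rfl, ⟨?_, fun u => by ring, fun u => ?_, fun _ => le_rfl,
        fun _ => ⟨rfl, rfl⟩⟩, fun _ _ _ _ _ _ => rfl⟩
      -- The walk stops at an empty incidence list only, and unvisited edges are still listed at
      -- both ends.
      · unfold rem
        rw [Finset.card_eq_zero, Finset.filter_eq_empty_iff]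
        intro e he hvis
        obtain ⟨heE, hev⟩ := mem_star.1 he
        obtain ⟨x, hx, -⟩ := h.compl e heE hvis v hev
        have := (h0 ▸ h.linked v hv).zero
        rw [this] at hx
        exact absurd hx (by simp)
      · split <;> omega
    · obtain ⟨l, hl, hlink⟩ := (h.linked v hv).pop h0
      set x := m .head v with hx
      set e := (x - 1) / 2 with he
      obtain ⟨heE, hev⟩ := h.sound v x (by rw [hl]; simp)
      rw [← he] at heE hev
      have hH : ∀ u y, y ∈ Function.update H v l u → y ∈ H u := by
        intro u y hy
        by_cases huv : u = v
        · subst huv; rw [Function.update_self] at hy; rw [hl]; exact List.mem_cons_of_mem _ hy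
        · rwa [Function.update_of_ne huv] at hy
      have hH' : ∀ u y, y ∈ H u → (y - 1) / 2 ≠ e → y ∈ Function.update H v l u := by
        intro u y hy hye
        by_cases huv : u = v
        · subst huv
          rw [hl, List.mem_cons] at hy
          rw [Function.update_self]
          rcases hy with rfl | hy
          · exact absurd rfl hye
          · exact hy
        · rwa [Function.update_of_ne huv]
      have hlists := lists_update (H := H) hv l
      rw [hl, List.length_cons] at hlists
      have hlinked : ∀ u ∈ g.V, Linked (m .nxt) (Function.update (m .head) v (m .nxt x) u)
          (Function.update H v l u) := by
        intro u hu
        by_cases huv : u = v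
        · subst huv; rw [Function.update_self, Function.update_self]; exact hlink
        · rw [Function.update_of_ne huv, Function.update_of_ne huv]; exact h.linked u hu
      refine ⟨fun hvis => ?_, fun hvis => ?_⟩
      · have hinv : TourInv g (Function.update H v l) k (m.set .head v (m .nxt x)) := by
          refine ⟨⟨h.src, h.dst, fun u hu => ?_, fun u y hy => h.sound u y (hH u y hy)⟩,
            fun f hf hfv u hfu => ?_, h.deg, h.len, h.mem, h.inj, h.vis⟩
          · rw [Mem.set_self]; exact hlinked u hu
          · obtain ⟨y, hy, hyf⟩ := h.compl f hf hfv u hfu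
            refine ⟨y, hH' u y hy ?_, hyf⟩
            rw [hyf]
            rintro rfl
            exact hfv hvis
        refine wp_mono (ih v k _ _ _ hinv hv (by omega)) ?_
        rintro - m' t' ⟨H', k', w, h1, h2, h3, h4, h5, h6⟩
        refine ⟨H', k', w, h1, h2, by omega, by omega, ⟨h5.last, h5.bal, h5.parity, h5.le, h5.trivial⟩,
          fun a ha1 ha2 ha3 ha4 ha5 => ?_⟩
        rw [h6 a ha1 ha2 ha3 ha4 ha5, Mem.set_of_ne _ ha1]
      · rw [show (if m .src e = v then m .dst e else m .src e) = g.oth e v by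
          rw [h.src, h.dst]; rfl]
        set w := g.oth e v with hw
        have hwv : w ≠ v := hg.oth_ne heE
        have hew : g.Inc e w := inc_oth hev
        have hwV : w ∈ g.V := mem_V.2 ⟨e, heE, hew⟩
        rw [Function.update_of_ne hwv, h.len]
        set m1 := (((((m.set .head v (m .nxt x)).set .vis e 1).set .tour k e).set .tourLen 0
          (k + 1)).set .deg v (m .deg v - 1)).set .deg w (m .deg w - 1) with hm1
        have hvis1 : m1 .vis = Function.update (m .vis) e 1 := by
          simp [hm1, Mem.set_self, Mem.set_of_ne]
        have htour1 : m1 .tour = Function.update (m .tour) k e := by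
          simp [hm1, Mem.set_self, Mem.set_of_ne]
        have hdeg1 : m1 .deg = Function.update (Function.update (m .deg) v (m .deg v - 1)) w
            (m .deg w - 1) := by
          simp [hm1, Mem.set_self, Mem.set_of_ne]
        have hhead1 : m1 .head = Function.update (m .head) v (m .nxt x) := by
          simp [hm1, Mem.set_self, Mem.set_of_ne]
        have hlen1 : m1 .tourLen 0 = k + 1 := by
          simp [hm1, Mem.set_self, Mem.set_of_ne]
        have hfr1 : TourFrame m m1 := by
          intro a h1 h2 h3 h4 h5
          rw [hm1, Mem.set_of_ne _ h5, Mem.set_of_ne _ h5, Mem.set_of_ne _ h4, Mem.set_of_ne _ h3,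
            Mem.set_of_ne _ h2, Mem.set_of_ne _ h1]
        have hnew : ∀ i < k, m .tour i ≠ e := fun i hi hie => hvis ((h.vis e heE).2 ⟨i, hi, hie⟩)
        have hrem : ∀ u, rem g (m1 .vis) u + (if g.Inc e u then 1 else 0) = rem g (m .vis) u :=
          fun u => by rw [hvis1]; exact rem_visit heE hvis
        have hinv : TourInv g (Function.update H v l) (k + 1) m1 := by
          refine ⟨⟨?_, ?_, fun u hu => ?_, fun u y hy => h.sound u y (hH u y hy)⟩,
            fun f hf hfv u hfu => ?_, fun u hu => ?_, hlen1, fun i hi => ?_, fun i hi j hj hij => ?_,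
            fun f hf => ?_⟩
          · rw [hfr1 _ (by decide) (by decide) (by decide) (by decide) (by decide), h.src]
          · rw [hfr1 _ (by decide) (by decide) (by decide) (by decide) (by decide), h.dst]
          · rw [hhead1, hfr1 .nxt (by decide) (by decide) (by decide) (by decide) (by decide)]
            exact hlinked u hu
          · rw [hvis1, Function.update_apply] at hfv
            split at hfv
            · exact absurd rfl hfv
            · rename_i hfe
              obtain ⟨y, hy, hyf⟩ := h.compl f hf hfv u hfu
              exact ⟨y, hH' u y hy (by rw [hyf]; exact hfe), hyf⟩
          · have h1 := hrem u
            have h2 := h.deg u hu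
            rw [hdeg1, Function.update_apply, Function.update_apply]
            simp only [inc_iff hev u, ← hw] at h1
            by_cases huw : u = w
            · subst huw; simp at h1 ⊢; omega
            · by_cases huv : u = v
              · subst huv; simp [huw] at h1 ⊢; omega
              · simp [huw, huv] at h1 ⊢; omega
          · rw [htour1, Function.update_apply]
            split
            · exact heE
            · exact h.mem i (by omega)
          · rw [htour1, Function.update_apply, Function.update_apply] at hij
            split at hij <;> split at hij
            · omega
            · exact absurd hij.symm (hnew j (by omega))
            · exact absurd hij (hnew i (by omega))
            · exact h.inj i (by omega) j (by omega) hij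
          · rw [hvis1, htour1]
            by_cases hfe : f = e
            · subst hfe
              simp only [Function.update_self, true_iff]
              exact ⟨k, by omega, Function.update_self ..⟩
            · rw [Function.update_of_ne hfe, h.vis f hf]
              constructor
              · rintro ⟨i, hi, hif⟩
                exact ⟨i, by omega, by rw [Function.update_of_ne (by omega), hif]⟩
              · rintro ⟨i, hi, hif⟩
                have : i ≠ k := by rintro rfl; rw [Function.update_self] at hif; exact hfe hif.symm
                exact ⟨i, by omega, by rwa [Function.update_of_ne this] at hif⟩
        refine wp_mono (ih w (k + 1) _ _ _ hinv hwV (by omega)) ?_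
        rintro - m' t' ⟨H', k', z, h1, h2, h3, h4, h5, h6⟩
        refine ⟨H', k', z, h1, h2, by omega, by omega, ⟨h5.last, fun u => ?_, fun u => ?_, fun u => ?_,
          fun h0 => ?_⟩, fun a ha1 ha2 ha3 ha4 ha5 => ?_⟩
        · rw [h5.bal u]
          -- The new edge contributes (-1)^k at both ends; at w this is cancelled by the departure
          -- term (-1)^(k+1) of the remaining walk.
          have hb : bal g (m1 .tour) (k + 1) u = bal g (m .tour) k u +
              (if u = v then (-1) ^ k else 0) + (if u = w then (-1) ^ k else 0) := by
            unfold bal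
            rw [Finset.sum_range_succ, htour1, Function.update_self, add_assoc]
            congr 1
            · refine Finset.sum_congr rfl fun i hi => ?_
              rw [Function.update_of_ne (by have := Finset.mem_range.1 hi; omega)]
            · have hiff := inc_iff hev u
              rw [← hw] at hiff
              by_cases huv : u = v
              · rw [if_pos (hiff.2 (Or.inl huv)), if_pos huv, if_neg (by rw [huv]; exact hwv.symm), add_zero]
              · by_cases huw : u = w
                · rw [if_pos (hiff.2 (Or.inr huw)), if_neg huv, if_pos huw, zero_add]
                · rw [if_neg (by rw [hiff]; tauto), if_neg huv, if_neg huw, add_zero]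
          rw [hb]
          by_cases huw : u = w
          · simp only [huw, if_true, pow_succ]; ring
          · simp only [huw, if_false]; ring
        · have e1 := h5.parity u
          have e2 := hrem u
          simp only [inc_iff hev u, ← hw] at e2
          by_cases huw : u = w
          · have huv : u ≠ v := fun h => hwv (huw ▸ h)
            simp only [huw, if_true, or_true, hwv, if_false] at e1 e2 ⊢
            omega
          · by_cases huv : u = v
            · simp only [huv, if_true, true_or, hwv.symm, if_false] at e1 e2 ⊢
              omega
            · simp only [huw, huv, if_false, or_self] at e1 e2 ⊢
              omega
        · have := h5.le u
          have := hrem u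
          omega
        · have := hrem v
          rw [if_pos hev] at this
          omega
        · rw [h6 a ha1 ha2 ha3 ha4 ha5, hfr1 a ha1 ha2 ha3 ha4 ha5]

/-! ### The incidence lists -/

-- All half-edges listed before step i are at most 2i. So the half-edges 2i + 1 and 2i + 2 are new,
-- and storing their successors breaks no existing list.
open EdgeList in
theorem buildIncidence_spec (hg : g.Simple) (hle : g.lo ≤ g.hi) (hs : m .src = g.s) (ht : m .dst = g.t)
    (hdeg : ∀ v ∈ g.V, m .deg v = g.deg v) :
    Spec (buildIncidence g.lo g.hi) m (16 * (g.hi - g.lo) + 1) fun _ m' =>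
      (∃ H, TourInv g H 0 m' ∧ lists g H ≤ 2 * (g.hi - g.lo)) ∧
      ∀ a : Arr, a ≠ .nxt → a ≠ .head → a ≠ .vis → a ≠ .tourLen → m' a = m a := by
  intro t
  unfold buildIncidence
  rw [wp_bind, wp_write]
  set m1 := m.set .tourLen 0 0 with hm1
  have hfr1 : ∀ a : Arr, a ≠ .tourLen → m1 a = m a := fun a ha => by rw [hm1, Mem.set_of_ne _ ha]
  have hlen1 : m1 .tourLen 0 = 0 := by simp [hm1, Mem.set_self]
  have hclear := Spec.forRange (m := m1) (fun e => do
      write .head (← read .src e) 0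
      write .head (← read .dst e) 0
      write .vis e 0) g.lo g.hi hle (fun i m' =>
      (∀ v ∈ (g.upto i).V, m' .head v = 0) ∧ (∀ e ∈ (g.upto i).E, m' .vis e = 0) ∧
      ∀ a : Arr, a ≠ .head → a ≠ .vis → m' a = m1 a) 5
      ⟨fun v hv => ?_, fun e he => ?_, fun _ _ _ => rfl⟩ ?_
  rotate_left
  · obtain ⟨e, he, -⟩ := mem_V.1 hv
    rw [upto_lo_E] at he
    simp at he
  · rw [upto_lo_E] at he
    simp at he
  · rintro i hi hi' m' ⟨h1, h2, h3⟩ t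
    simp only [wp_bind, wp_read, wp_write, Mem.set_self, Mem.set_of_ne, ne_eq, reduceCtorEq,
      not_false_eq_true, h3 .src (by decide) (by decide), h3 .dst (by decide) (by decide),
      hfr1 .src (by decide), hfr1 .dst (by decide), hs, ht]
    refine ⟨by omega, fun v hv => ?_, fun e he => ?_, fun a ha hb => ?_⟩
    · simp only [Function.update_apply]
      split
      · rfl
      · split
        · rfl
        · obtain ⟨e, he, hev⟩ := mem_V.1 hv
          rw [mem_E_upto] at he
          have : e ≠ i := by
            rintro rfl
            rcases hev with h | h
            · exact absurd h.symm ‹_›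
            · exact absurd h.symm ‹_›
          exact h1 v (mem_V.2 ⟨e, mem_E_upto.2 (by omega), hev⟩)
    · rw [Function.update_apply]
      split
      · rfl
      · rw [mem_E_upto] at he
        exact h2 e (mem_E_upto.2 (by omega))
    · rw [Mem.set_of_ne _ hb, Mem.set_of_ne _ ha, Mem.set_of_ne _ ha, h3 a ha hb]
  refine hclear.wp_bind ?_
  rintro - m2 t2 ⟨hhead2, hvis2, hfr2⟩ ht2
  rw [upto_hi] at hhead2 hvis2
  have hsrc2 : m2 .src = g.s := by rw [hfr2 _ (by decide) (by decide), hfr1 _ (by decide), hs]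
  have hdst2 : m2 .dst = g.t := by rw [hfr2 _ (by decide) (by decide), hfr1 _ (by decide), ht]
  have hpush := Spec.forRange (m := m2) (fun e => do
    pushHalfEdge (← read .src e) (2 * e + 1)
    pushHalfEdge (← read .dst e) (2 * e + 2)) g.lo g.hi hle (fun i m' =>
      (∃ H, Incidence g H m' ∧ (∀ v, ∀ h ∈ H v, h ≤ 2 * i) ∧ lists g H ≤ 2 * (i - g.lo) ∧
        ∀ e ∈ (g.upto i).E, 2 * e + 1 ∈ H (g.s e) ∧ 2 * e + 2 ∈ H (g.t e)) ∧
      ∀ a : Arr, a ≠ .nxt → a ≠ .head → m' a = m2 a) 8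
      ⟨⟨fun _ => [], ⟨hsrc2, hdst2, fun v hv => hhead2 v hv, by simp⟩, by simp, by simp [lists],
        by simp [upto_lo_E]⟩, fun _ _ _ => rfl⟩ ?_
  · refine wp_mono (hpush _) ?_
    rintro - m3 t3 ⟨ht3, ⟨H, hH, -, hlen, hall⟩, hfr3⟩
    rw [upto_hi] at hall
    have hfr : ∀ a : Arr, a ≠ .nxt → a ≠ .head → a ≠ .vis → a ≠ .tourLen → m3 a = m a :=
      fun a h1 h2 h3 h4 => by rw [hfr3 a h1 h2, hfr2 a h2 h3, hfr1 a h4]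
    have hvis3 : ∀ e ∈ g.E, m3 .vis e = 0 := fun e he => by
      rw [hfr3 .vis (by decide) (by decide)]; exact hvis2 e he
    refine ⟨by omega, ⟨H, ⟨hH, fun e he _ v hev => ?_, fun v hv => ?_, ?_, fun i hi => ?_,
      fun i hi => ?_, fun e he => ?_⟩, hlen⟩, hfr⟩
    · rcases hev with rfl | rfl
      · exact ⟨_, (hall e he).1, by omega⟩
      · exact ⟨_, (hall e he).2, by omega⟩
    · rw [hfr .deg (by decide) (by decide) (by decide) (by decide), hdeg v hv]
      unfold EdgeList.deg rem
      rw [Finset.filter_true_of_mem]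
      intro e he
      rw [hvis3 e (mem_star.1 he).1]
      omega
    · rw [hfr3 .tourLen (by decide) (by decide), hfr2 .tourLen (by decide) (by decide), hlen1]
    · omega
    · omega
    · rw [hvis3 e he]
      simp
  · rintro i hi hi' m' ⟨⟨H, hH, hlt, hlen, hall⟩, hfr⟩ t
    have hiE : i ∈ g.E := mem_E.2 ⟨hi, hi'⟩
    have hne := hg.ne i hiE
    have hsV : g.s i ∈ g.V := mem_V.2 ⟨i, hiE, inc_s i⟩
    have htV : g.t i ∈ g.V := mem_V.2 ⟨i, hiE, inc_t i⟩
    unfold pushHalfEdge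
    simp only [wp_bind, wp_read, wp_write, Mem.set_self, Mem.set_of_ne, ne_eq, reduceCtorEq,
      not_false_eq_true, hH.src, hH.dst]
    rw [Function.update_of_ne hne.symm]
    set m4 := ((((m'.set .nxt (2 * i + 1) (m' .head (g.s i))).set .head (g.s i) (2 * i + 1)).set .nxt
      (2 * i + 2) (m' .head (g.t i))).set .head (g.t i) (2 * i + 2)) with hm4
    have hnxt4 : m4 .nxt = Function.update (Function.update (m' .nxt) (2 * i + 1) (m' .head (g.s i)))
        (2 * i + 2) (m' .head (g.t i)) := by simp [hm4, Mem.set_self, Mem.set_of_ne]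
    have hhead4 : m4 .head = Function.update (Function.update (m' .head) (g.s i) (2 * i + 1))
        (g.t i) (2 * i + 2) := by simp [hm4, Mem.set_self, Mem.set_of_ne]
    set H1 := Function.update H (g.s i) ((2 * i + 1) :: H (g.s i)) with hH1
    set H2 := Function.update H1 (g.t i) ((2 * i + 2) :: H (g.t i)) with hH2
    have hlk : ∀ u ∈ g.V, Linked (m4 .nxt) (m' .head u) (H u) := fun u hu => by
      rw [hnxt4]
      refine Linked.update _ _ (Linked.update _ _ (hH.linked u hu) fun h => ?_) fun h => ?_ <;>
      · have := hlt u _ h; omega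
    have hmem2 : ∀ u x, x ∈ H2 u ↔ x ∈ H u ∨ (u = g.s i ∧ x = 2 * i + 1) ∨ (u = g.t i ∧ x = 2 * i + 2) := by
      intro u x
      rw [hH2, hH1, Function.update_apply, Function.update_apply]
      by_cases hut : u = g.t i
      · subst hut; rw [if_pos rfl]; simp [hne.symm]; tauto
      · rw [if_neg hut]
        by_cases hus : u = g.s i
        · subst hus; rw [if_pos rfl]; simp [hne]; tauto
        · rw [if_neg hus]; simp [hut, hus]
    refine ⟨by omega, ⟨H2, ⟨hH.src, hH.dst, fun u hu => ?_, fun u x hx => ?_⟩, fun u x hx => ?_, ?_,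
      fun e he => ?_⟩, fun a ha hb => ?_⟩
    · rw [hhead4, hH2, hH1]
      by_cases hut : u = g.t i
      · subst hut
        rw [Function.update_self, Function.update_self]
        refine ⟨rfl, by omega, ?_⟩
        have := hlk _ hu
        rw [show m4 .nxt (2 * i + 2) = m' .head (g.t i) by rw [hnxt4, Function.update_self]]
        exact this
      · rw [Function.update_of_ne hut, Function.update_of_ne hut]
        by_cases hus : u = g.s i
        · subst hus
          rw [Function.update_self, Function.update_self]
          refine ⟨rfl, by omega, ?_⟩
          have := hlk _ hu
          rw [show m4 .nxt (2 * i + 1) = m' .head (g.s i) by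
            rw [hnxt4, Function.update_of_ne (by omega), Function.update_self]]
          exact this
        · rw [Function.update_of_ne hus, Function.update_of_ne hus]
          exact hlk u hu
    · rcases (hmem2 u x).1 hx with h | ⟨rfl, rfl⟩ | ⟨rfl, rfl⟩
      · exact hH.sound u x h
      · rw [show (2 * i + 1 - 1) / 2 = i by omega]; exact ⟨hiE, inc_s i⟩
      · rw [show (2 * i + 2 - 1) / 2 = i by omega]; exact ⟨hiE, inc_t i⟩
    · rcases (hmem2 u x).1 hx with h | ⟨-, rfl⟩ | ⟨-, rfl⟩
      · have := hlt u x h; omega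
      · omega
      · omega
    · have e1 := lists_update (H := H) hsV ((2 * i + 1) :: H (g.s i))
      have e2 := lists_update (H := H1) htV ((2 * i + 2) :: H (g.t i))
      rw [← hH1] at e1
      rw [← hH2] at e2
      rw [show H1 (g.t i) = H (g.t i) by rw [hH1, Function.update_of_ne hne.symm]] at e2
      rw [List.length_cons] at e1 e2
      omega
    · rw [hmem2, hmem2]
      by_cases hei : e = i
      · subst hei
        exact ⟨Or.inr (Or.inl ⟨rfl, rfl⟩), Or.inr (Or.inr ⟨rfl, rfl⟩)⟩
      · rw [mem_E_upto] at he
        have := hall e (mem_E_upto.2 (by omega))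
        exact ⟨Or.inl this.1, Or.inl this.2⟩
    · rw [hm4, Mem.set_of_ne _ hb, Mem.set_of_ne _ ha, Mem.set_of_ne _ hb, Mem.set_of_ne _ ha, hfr a ha hb]

/-! ### The two phases of the removal of tours -/

/-- While open tours are removed: even and odd positions are balanced except at the vertices that were
an endpoint of an open tour. -/
structure OpenBal (g : EdgeList) (vis τ : ℕ → ℕ) (k : ℕ) : Prop where
  odd : ∀ u, rem g vis u % 2 = 1 → bal g τ k u = 0
  abs : ∀ u, |bal g τ k u| ≤ 1

/-- While closed tours are removed. -/
structure ClosedBal (g : EdgeList) (vis τ : ℕ → ℕ) (k : ℕ) : Prop where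
  even : ∀ u, rem g vis u % 2 = 0
  pos : ∀ u, 0 < rem g vis u → |bal g τ k u| ≤ 1
  abs : ∀ u, |bal g τ k u| ≤ 3

/-- A tour returning to its start preserves the parity of the remaining degree there, but it ends
with remaining degree 0. -/
theorem Toured.ne_of_odd {v k k' w : ℕ} {m m' : Mem} (h : Toured g v k k' m m' w)
    (hv : rem g (m .vis) v % 2 = 1) : w ≠ v := by
  rintro rfl
  have := h.parity w
  rw [if_pos rfl, h.last] at this
  omega

theorem Toured.even {v k k' w : ℕ} {m m' : Mem} (h : Toured g v k k' m m' w)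
    (hv : rem g (m .vis) v % 2 = 1) {u : ℕ} (hu : rem g (m .vis) u % 2 = 0 ∨ u = v) :
    rem g (m' .vis) u % 2 = 0 := by
  have h1 := h.parity u
  have h2 := h.last
  have h3 := h.ne_of_odd hv
  by_cases huw : u = w
  · rw [huw, h2]
  · rw [if_neg huw] at h1
    by_cases huv : u = v
    · subst huv; rw [if_pos rfl] at h1; omega
    · rw [if_neg huv] at h1
      rcases hu with hu | hu
      · omega
      · exact absurd hu huv

theorem abs_neg_one_pow_le (k : ℕ) : |(-1 : ℤ) ^ k| ≤ 1 := by simp [abs_pow]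

/-- Both endpoints of the tour had odd remaining degree before and even remaining degree afterwards,
so neither is an endpoint of a later open tour. Hence every balance leaves 0 at most once, and then
by 1. -/
theorem Toured.openBal {v k k' w : ℕ} {m m' : Mem} (h : Toured g v k k' m m' w)
    (hv : rem g (m .vis) v % 2 = 1) (hb : OpenBal g (m .vis) (m .tour) k) :
    OpenBal g (m' .vis) (m' .tour) k' := by
  have hwv := h.ne_of_odd hv
  have hw : rem g (m .vis) w % 2 = 1 := by
    have := h.parity w
    rw [if_neg hwv, if_pos rfl, h.last] at this
    omega
  constructor
  · intro u hu
    have huv : u ≠ v := by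
      rintro rfl
      have := h.even hv (Or.inr rfl)
      omega
    have huw : u ≠ w := by
      rintro rfl
      rw [h.last] at hu
      omega
    rw [h.bal, if_neg huv, if_neg huw, hb.odd u]
    · simp
    · have := h.parity u
      rw [if_neg huv, if_neg huw] at this
      omega
  · intro u
    rw [h.bal]
    by_cases huv : u = v
    · subst huv
      rw [hb.odd u hv, if_pos rfl, if_neg hwv.symm]
      simp
    · rw [if_neg huv]
      by_cases huw : u = w
      · subst huw
        rw [hb.odd u hw, if_pos rfl]
        simp
      · rw [if_neg huw]
        simpa using hb.abs u

/-- With all remaining degrees even, the tour ends where it began and changes the balance at its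
start by 0 or ±2. Then no edges are left there, so any later tour from that vertex is empty; this
gives the total 3 = 1 + 2. -/
theorem Toured.closedBal {v k k' w : ℕ} {m m' : Mem} (h : Toured g v k k' m m' w)
    (hb : ClosedBal g (m .vis) (m .tour) k) :
    w = v ∧ ClosedBal g (m' .vis) (m' .tour) k' := by
  have hwv : w = v := by
    by_contra hne
    have h1 := h.parity w
    rw [if_neg hne, if_pos rfl, h.last] at h1
    have := hb.even w
    omega
  subst hwv
  have habs : ∀ u, |EdgeColoringRAM.bal g (m' .tour) k' u| ≤ 3 := fun u => by
    rw [h.bal]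
    by_cases huv : u = w
    · subst huv
      rw [if_pos rfl, if_pos rfl]
      rcases Nat.eq_zero_or_pos (rem g (m .vis) u) with h0 | h0
      · rw [(h.trivial h0).2]
        simpa using hb.abs u
      · have h1 := abs_le.1 (hb.pos u h0)
        have h2 := abs_le.1 (abs_neg_one_pow_le k)
        have h3 := abs_le.1 (abs_neg_one_pow_le k')
        rw [abs_le]
        constructor <;> linarith
    · rw [if_neg huv, if_neg huv]
      simpa using hb.abs u
  refine ⟨rfl, fun u => ?_, fun u hu => ?_, habs⟩
  · have h1 := h.parity u
    have h2 := hb.even u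
    by_cases huv : u = w
    · rw [huv, h.last]
    · rw [if_neg huv] at h1; omega
  · have huv : u ≠ w := by rintro rfl; rw [h.last] at hu; omega
    rw [h.bal, if_neg huv, if_neg huv]
    simpa using hb.pos u (lt_of_lt_of_le hu (h.le u))

/-- The state during the removal of tours, with an account of the time. -/
def Touring (g : EdgeList) (m₀ : Mem) (T : ℕ) (P : Mem → ℕ → Prop) (m : Mem) (t : ℕ) : Prop :=
  ∃ H k, TourInv g H k m ∧ t + 14 * lists g H ≤ T ∧ lists g H ≤ 2 * (g.hi - g.lo) ∧ TourFrame m₀ m ∧ P m k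

theorem TourFrame.trans {m₀ m₁ m₂ : Mem} (h : TourFrame m₀ m₁) (h' : TourFrame m₁ m₂) : TourFrame m₀ m₂ :=
  fun a h1 h2 h3 h4 h5 => (h' a h1 h2 h3 h4 h5).trans (h a h1 h2 h3 h4 h5)

-- The predicate P collects the vertices already known to have even remaining degree; open tours
-- never spoil this.
open EdgeList in
theorem walkIfOdd_wp (hg : g.Simple) {m₀ m : Mem} {t T v : ℕ} {P : ℕ → Prop}
    (h : Touring g m₀ T (fun m k => OpenBal g (m .vis) (m .tour) k ∧
      ∀ u, P u → rem g (m .vis) u % 2 = 0) m t) (hv : v ∈ g.V) :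
    wp (walkIfOdd (2 * (g.hi - g.lo) + 1) v) m t fun _ m' t' =>
      Touring g m₀ (T + 2) (fun m k => OpenBal g (m .vis) (m .tour) k ∧
        ∀ u, P u ∨ u = v → rem g (m .vis) u % 2 = 0) m' t' := by
  obtain ⟨H, k, hinv, hT, hlen, hfr, hb, hev⟩ := h
  unfold walkIfOdd
  simp only [wp_bind, wp_read, wp_ite, wp_pure]
  rw [hinv.deg v hv]
  refine ⟨fun hodd => ?_, fun hodd => ?_⟩
  · refine wp_mono (walkTour_wp hg _ v k H m (t + 1) hinv hv (by omega)) ?_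
    rintro - m' t' ⟨H', k', w, h1, h2, h3, h4, h5, h6⟩
    refine ⟨H', k', h1, by omega, by omega, hfr.trans h6, h5.openBal hodd hb, fun u hu => ?_⟩
    exact h5.even hodd (hu.imp (hev u) id)
  · refine ⟨H, k, hinv, by omega, hlen, hfr, hb, fun u hu => ?_⟩
    rcases hu with hu | rfl
    · exact hev u hu
    · omega

open EdgeList in
theorem openTours_wp (hg : g.Simple) (hle : g.lo ≤ g.hi) {m₀ m : Mem} {t T : ℕ}
    (h : Touring g m₀ T (fun m k => OpenBal g (m .vis) (m .tour) k) m t) :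
    wp (forRange g.lo g.hi fun e => do
      walkIfOdd (2 * (g.hi - g.lo) + 1) (← read .src e)
      walkIfOdd (2 * (g.hi - g.lo) + 1) (← read .dst e)) m t fun _ m' t' =>
      Touring g m₀ (T + 7 * (g.hi - g.lo)) (fun m k => OpenBal g (m .vis) (m .tour) k ∧
        ∀ u ∈ g.V, rem g (m .vis) u % 2 = 0) m' t' := by
  refine wp_mono (wp_forRange (m := m) (t := t) _ g.lo g.hi hle (fun i m' t' =>
      Touring g m₀ (T + 7 * (i - g.lo)) (fun m k => OpenBal g (m .vis) (m .tour) k ∧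
        ∀ u, u ∈ (g.upto i).V → rem g (m .vis) u % 2 = 0) m' t') ?_ ?_) fun _ _ _ h => ?_
  · obtain ⟨H, k, h1, h2, h3, h4, h5⟩ := h
    refine ⟨H, k, h1, by omega, h3, h4, h5, fun u hu => ?_⟩
    obtain ⟨e, he, -⟩ := mem_V.1 hu
    rw [upto_lo_E] at he
    simp at he
  · intro i hi hi' m' t' hI
    have hiE : i ∈ g.E := mem_E.2 ⟨hi, hi'⟩
    have hI' : Touring g m₀ (T + 7 * (i - g.lo) + 2) (fun m k => OpenBal g (m .vis) (m .tour) k ∧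
        ∀ u, u ∈ (g.upto i).V → rem g (m .vis) u % 2 = 0) m' (t' + 1 + 1) := by
      obtain ⟨H, k, h1, h2, h3⟩ := hI
      exact ⟨H, k, h1, by omega, h3⟩
    have hsrc : m' .src = g.s := by obtain ⟨H, k, h1, -⟩ := hI; exact h1.src
    simp only [wp_bind, wp_read]
    rw [hsrc]
    refine wp_mono (walkIfOdd_wp hg hI' (mem_V.2 ⟨i, hiE, inc_s i⟩)) ?_
    rintro - m1 t1 ⟨H, k, h1, h2, h3⟩
    rw [h1.dst]
    refine wp_mono (walkIfOdd_wp hg (T := T + 7 * (i - g.lo) + 5) ⟨H, k, h1, by omega, h3⟩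
      (mem_V.2 ⟨i, hiE, inc_t i⟩)) ?_
    rintro - m2 t2 ⟨H, k, h1, h2, h3, h4, h5, h6⟩
    refine ⟨H, k, h1, by omega, h3, h4, h5, fun u hu => h6 u ?_⟩
    obtain ⟨e, he, heu⟩ := mem_V.1 hu
    rw [mem_E_upto] at he
    by_cases hei : e = i
    · subst hei
      rcases heu with h | h
      · exact Or.inl (Or.inr h.symm)
      · exact Or.inr h.symm
    · exact Or.inl (Or.inl (mem_V.2 ⟨e, mem_E_upto.2 (by omega), heu⟩))
  · exact h

open EdgeList in
theorem closedTours_wp (hg : g.Simple) (hle : g.lo ≤ g.hi) {m₀ m : Mem} {t T : ℕ}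
    (h : Touring g m₀ T (fun m k => ClosedBal g (m .vis) (m .tour) k) m t) :
    wp (forRange g.lo g.hi fun e => do
      walkTour (2 * (g.hi - g.lo) + 1) (← read .src e)) m t fun _ m' t' =>
      Touring g m₀ (T + 3 * (g.hi - g.lo)) (fun m k => ClosedBal g (m .vis) (m .tour) k ∧
        ∀ e ∈ g.E, rem g (m .vis) (g.s e) = 0) m' t' := by
  refine wp_mono (wp_forRange (m := m) (t := t) _ g.lo g.hi hle (fun i m' t' =>
      Touring g m₀ (T + 3 * (i - g.lo)) (fun m k => ClosedBal g (m .vis) (m .tour) k ∧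
        ∀ e ∈ (g.upto i).E, rem g (m .vis) (g.s e) = 0) m' t') ?_ ?_) fun _ _ _ h => ?_
  · obtain ⟨H, k, h1, h2, h3, h4, h5⟩ := h
    refine ⟨H, k, h1, by omega, h3, h4, h5, fun e he => ?_⟩
    rw [upto_lo_E] at he
    simp at he
  · rintro i hi hi' m' t' ⟨H, k, h1, h2, h3, h4, h5, h6⟩
    have hiE : i ∈ g.E := mem_E.2 ⟨hi, hi'⟩
    simp only [wp_bind, wp_read]
    rw [h1.src]
    refine wp_mono (walkTour_wp hg _ (g.s i) k H m' _ h1 (mem_V.2 ⟨i, hiE, inc_s i⟩) (by omega)) ?_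
    rintro - m2 t2 ⟨H', k', w, e1, e2, e3, e4, e5, e6⟩
    obtain ⟨hw, hb⟩ := e5.closedBal h5
    refine ⟨H', k', e1, by omega, by omega, h4.trans e6, hb, fun e he => ?_⟩
    rw [mem_E_upto] at he
    by_cases hei : e = i
    · rw [hei, ← hw, e5.last]
    · exact Nat.le_zero.1 ((e5.le _).trans (h6 e (mem_E_upto.2 (by omega))).le)
  · exact h

/-! ### Rearranging the records -/

/-- The place of the `i`-th edge of the list of the tours. -/
def slot (lo M i : ℕ) : ℕ := if i % 2 = 0 then lo + i / 2 else lo + (M + 1) / 2 + i / 2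

theorem slot_inj {lo M i j : ℕ} (hi : i < M) (hj : j < M) (h : slot lo M i = slot lo M j) : i = j := by
  unfold slot at h
  split_ifs at h <;> omega

theorem slot_mem {lo M i : ℕ} (hi : i < M) : lo ≤ slot lo M i ∧ slot lo M i < lo + M := by
  unfold slot
  split_ifs <;> omega

-- Every edge has its first endpoint among the exhausted vertices, so all edges have been visited
-- and the tour list enumerates them without repetition.
open EdgeList in
theorem Touring.complete {m₀ m : Mem} {t T : ℕ}
    (h : Touring g m₀ T (fun m k => ClosedBal g (m .vis) (m .tour) k ∧
        ∀ e ∈ g.E, rem g (m .vis) (g.s e) = 0) m t) :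
    t ≤ T ∧ TourFrame m₀ m ∧ (∀ i < g.hi - g.lo, m .tour i ∈ g.E) ∧
    (∀ i < g.hi - g.lo, ∀ j < g.hi - g.lo, m .tour i = m .tour j → i = j) ∧
    ∀ v, |bal g (m .tour) (g.hi - g.lo) v| ≤ 3 := by
  obtain ⟨H, k, h1, h2, h3, h4, h5, h6⟩ := h
  have hall : (Finset.range k).image (m .tour) = g.E := by
    ext e
    rw [Finset.mem_image]
    constructor
    · rintro ⟨i, hi, rfl⟩
      exact h1.mem i (Finset.mem_range.1 hi)
    · intro he
      have hvis : m .vis e = 1 := by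
        by_contra hne
        have := h6 e he
        unfold rem at this
        rw [Finset.card_eq_zero, Finset.filter_eq_empty_iff] at this
        exact this (mem_star.2 ⟨he, inc_s e⟩) hne
      obtain ⟨i, hi, hie⟩ := (h1.vis e he).1 hvis
      exact ⟨i, Finset.mem_range.2 hi, hie⟩
  have hk : k = g.hi - g.lo := by
    rw [← card_E, ← hall, Finset.card_image_of_injOn, Finset.card_range]
    intro i hi j hj hij
    exact h1.inj i (Finset.mem_range.1 hi) j (Finset.mem_range.1 hj) hij
  subst hk
  exact ⟨by omega, h4, h1.mem, h1.inj, h5.abs⟩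

theorem copyTours_spec {lo M : ℕ} {s t : ℕ → ℕ} (hs : m .src = s) (ht : m .dst = t) :
    Spec (forRange 0 M fun i => do
      let e ← read .tour i
      let p := if i % 2 = 0 then lo + i / 2 else lo + (M + 1) / 2 + i / 2
      write .tmpSrc p (← read .src e)
      write .tmpDst p (← read .dst e)) m (6 * M) fun _ m' =>
      (∀ j < M, m' .tmpSrc (slot lo M j) = s (m .tour j) ∧ m' .tmpDst (slot lo M j) = t (m .tour j)) ∧
      ∀ a : Arr, a ≠ .tmpSrc → a ≠ .tmpDst → m' a = m a := by
  refine (Spec.forRange (m := m) _ 0 M (Nat.zero_le _) (fun i m' =>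
      (∀ j < i, m' .tmpSrc (slot lo M j) = s (m .tour j) ∧
        m' .tmpDst (slot lo M j) = t (m .tour j)) ∧
      ∀ a : Arr, a ≠ .tmpSrc → a ≠ .tmpDst → m' a = m a) 5 ⟨by omega, fun _ _ _ => rfl⟩ ?_).mono
      (by omega) fun _ _ h => h
  rintro i hi hi' m' ⟨h1, h2⟩ t
  simp only [wp_bind, wp_read, wp_write, Mem.set_self, Mem.set_of_ne, ne_eq, reduceCtorEq,
    not_false_eq_true, h2 .tour (by decide) (by decide), h2 .src (by decide) (by decide),
    h2 .dst (by decide) (by decide), hs, ht]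
  change _ ∧ (∀ j < i + 1, Function.update (m' .tmpSrc) (slot lo M i) _ _ = _ ∧
    Function.update (m' .tmpDst) (slot lo M i) _ _ = _) ∧ _
  refine ⟨by omega, fun j hj => ?_, fun a ha hb => ?_⟩
  · by_cases hji : j = i
    · subst hji; rw [Function.update_self, Function.update_self]; exact ⟨rfl, rfl⟩
    · have : slot lo M j ≠ slot lo M i := fun h => hji (slot_inj (by omega) hi' h)
      rw [Function.update_of_ne this, Function.update_of_ne this]
      exact h1 j (by omega)
  · rw [Mem.set_of_ne _ hb, Mem.set_of_ne _ ha, h2 a ha hb]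

theorem copyBack_spec {lo hi : ℕ} (hle : lo ≤ hi) :
    Spec (forRange lo hi fun e => do
      write .src e (← read .tmpSrc e)
      write .dst e (← read .tmpDst e)) m (5 * (hi - lo)) fun _ m' =>
      (∀ e, m' .src e = if lo ≤ e ∧ e < hi then m .tmpSrc e else m .src e) ∧
      (∀ e, m' .dst e = if lo ≤ e ∧ e < hi then m .tmpDst e else m .dst e) ∧
      ∀ a : Arr, a ≠ .src → a ≠ .dst → m' a = m a := by
  refine (Spec.forRange (m := m) _ lo hi hle (fun i m' =>
      (∀ e, m' .src e = if lo ≤ e ∧ e < i then m .tmpSrc e else m .src e) ∧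
      (∀ e, m' .dst e = if lo ≤ e ∧ e < i then m .tmpDst e else m .dst e) ∧
      ∀ a : Arr, a ≠ .src → a ≠ .dst → m' a = m a) 4
    ⟨fun e => by rw [if_neg (by omega)], fun e => by rw [if_neg (by omega)], fun _ _ _ => rfl⟩ ?_).mono
    (by omega) fun _ _ h => h
  rintro i hi hi' m' ⟨h1, h2, h3⟩ t
  simp only [wp_bind, wp_read, wp_write, Mem.set_self, Mem.set_of_ne, ne_eq, reduceCtorEq,
    not_false_eq_true, h3 .tmpSrc (by decide) (by decide), h3 .tmpDst (by decide) (by decide)]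
  refine ⟨by omega, fun e => ?_, fun e => ?_, fun a ha hb => ?_⟩
  · rw [Function.update_apply, h1]
    by_cases hei : e = i
    · subst hei; rw [if_pos rfl, if_pos (by omega)]
    · rw [if_neg hei]; congr 1; rw [eq_iff_iff]; omega
  · rw [Function.update_apply, h2]
    by_cases hei : e = i
    · subst hei; rw [if_pos rfl, if_pos (by omega)]
    · rw [if_neg hei]; congr 1; rw [eq_iff_iff]; omega
  · rw [Mem.set_of_ne _ hb, Mem.set_of_ne _ ha, h3 a ha hb]

open EdgeList in
/-- The effect of `partition`. -/
theorem partition_spec (hg : g.Simple) (hle : g.lo ≤ g.hi) (hs : m .src = g.s) (ht : m .dst = g.t)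
    (hdeg : ∀ v ∈ g.V, m .deg v = g.deg v) :
    Spec (partition g.lo g.hi) m (65 * (g.hi - g.lo) + 1) fun _ m' => ∃ τ : ℕ → ℕ,
      (∀ i < g.hi - g.lo, τ i ∈ g.E) ∧
      (∀ i < g.hi - g.lo, ∀ j < g.hi - g.lo, τ i = τ j → i = j) ∧
      (∀ v, |bal g τ (g.hi - g.lo) v| ≤ 3) ∧
      (∀ i < g.hi - g.lo, m' .src (slot g.lo (g.hi - g.lo) i) = g.s (τ i) ∧
        m' .dst (slot g.lo (g.hi - g.lo) i) = g.t (τ i)) ∧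
      (∀ e ∉ g.E, m' .src e = g.s e ∧ m' .dst e = g.t e) ∧ m' .col = m .col := by
  intro t
  unfold partition
  refine (buildIncidence_spec hg hle hs ht hdeg).wp_bind ?_
  rintro - m1 t1 ⟨⟨H, hinv, hlen⟩, hfr1⟩ ht1
  have hrem : ∀ u ∉ g.V, rem g (m1 .vis) u = 0 := fun u hu => by
    unfold rem
    rw [Finset.card_eq_zero, Finset.filter_eq_empty_iff]
    intro e he
    exact absurd (mem_V.2 ⟨e, mem_star.1 he⟩) hu
  -- 16 steps per edge were spent on the incidence lists, and 28 = 14 · 2 per edge are reserved for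
  -- their elements.
  have h1 : Touring g m1 (t + 44 * (g.hi - g.lo) + 1)
      (fun m k => OpenBal g (m .vis) (m .tour) k) m1 t1 :=
    ⟨H, 0, hinv, by omega, hlen, fun _ _ _ _ _ _ => rfl,
      ⟨fun u _ => by simp [bal], fun u => by simp [bal]⟩⟩
  simp only [wp_bind]
  refine wp_mono (openTours_wp hg hle h1) ?_
  rintro - m2 t2 ⟨H2, k2, e1, e2, e3, e4, e5, e6⟩
  have heven : ∀ u, rem g (m2 .vis) u % 2 = 0 := fun u => by
    by_cases hu : u ∈ g.V
    · exact e6 u hu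
    · have : rem g (m2 .vis) u = 0 := by
        unfold rem
        rw [Finset.card_eq_zero, Finset.filter_eq_empty_iff]
        intro e he
        exact absurd (mem_V.2 ⟨e, mem_star.1 he⟩) hu
      omega
  have h2 : Touring g m1 (t + 51 * (g.hi - g.lo) + 1)
      (fun m k => ClosedBal g (m .vis) (m .tour) k) m2 t2 :=
    ⟨H2, k2, e1, by omega, e3, e4, heven, fun u _ => e5.abs u,
      fun u => (e5.abs u).trans (by norm_num)⟩
  refine wp_mono (closedTours_wp hg hle h2) ?_
  rintro - m3 t3 h3
  obtain ⟨ht3, hfr3, hmem, hinj, hbal⟩ := h3.complete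
  have hsrc3 : m3 .src = g.s := by
    rw [hfr3 _ (by decide) (by decide) (by decide) (by decide) (by decide), hinv.src]
  have hdst3 : m3 .dst = g.t := by
    rw [hfr3 _ (by decide) (by decide) (by decide) (by decide) (by decide), hinv.dst]
  have hcol3 : m3 .col = m .col := by
    rw [hfr3 _ (by decide) (by decide) (by decide) (by decide) (by decide),
      hfr1 _ (by decide) (by decide) (by decide) (by decide)]
  refine wp_mono (copyTours_spec (lo := g.lo) (M := g.hi - g.lo) hsrc3 hdst3 t3) ?_
  rintro - m4 t4 ⟨ht4, hslot4, hfr4⟩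
  refine wp_mono (copyBack_spec hle _) ?_
  rintro - m5 t5 ⟨ht5, hsrc5, hdst5, hfr5⟩
  refine ⟨by omega, m3 .tour, hmem, hinj, hbal, fun i hi => ?_, fun e he => ?_, ?_⟩
  · have := slot_mem (lo := g.lo) hi
    rw [hsrc5, hdst5, if_pos (by omega), if_pos (by omega)]
    exact hslot4 i hi
  · rw [mem_E] at he
    rw [hsrc5, hdst5, if_neg he, if_neg he, hfr4 _ (by decide) (by decide),
      hfr4 _ (by decide) (by decide), hsrc3, hdst3]
    exact ⟨rfl, rfl⟩
  · rw [hfr5 _ (by decide) (by decide), hfr4 _ (by decide) (by decide), hcol3]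

/-! ### Reordered records, maximum degrees and size bounds. -/

namespace EdgeList

/-- The records `lo, …, hi - 1` in the memory. -/
def ofMem (lo hi : ℕ) (m : Mem) : EdgeList := ⟨lo, hi, m .src, m .dst⟩

/-- The same edges in another order. -/
def perm (g : EdgeList) (ρ : Equiv.Perm ℕ) : EdgeList := ⟨g.lo, g.hi, g.s ∘ ρ, g.t ∘ ρ⟩

theorem perm_mem_E {ρ : Equiv.Perm ℕ} (hρ : ∀ e ∉ g.E, ρ e = e) {e : ℕ} : ρ e ∈ g.E ↔ e ∈ g.E := by
  constructor
  · intro h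
    by_contra he
    rw [hρ e he] at h
    exact he h
  · intro he
    by_contra h
    have := ρ.injective (hρ _ h)
    rw [this] at h
    exact h he

theorem Simple.perm (hg : g.Simple) {ρ : Equiv.Perm ℕ} (hρ : ∀ e ∉ g.E, ρ e = e) : (g.perm ρ).Simple where
  ne e he := hg.ne _ ((perm_mem_E hρ).2 he)
  inj e he f hf h := ρ.injective (hg.inj _ ((perm_mem_E hρ).2 he) _ ((perm_mem_E hρ).2 hf) h)

theorem deg_perm {ρ : Equiv.Perm ℕ} (hρ : ∀ e ∉ g.E, ρ e = e) (v : ℕ) : (g.perm ρ).deg v = g.deg v := by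
  refine Finset.card_bij' (fun e _ => ρ e) (fun e _ => ρ.symm e) ?_ ?_ ?_ ?_
  · intro e he
    obtain ⟨h1, h2⟩ := mem_star.1 he
    exact mem_star.2 ⟨(perm_mem_E hρ).2 h1, h2⟩
  · intro e he
    obtain ⟨h1, h2⟩ := mem_star.1 he
    refine mem_star.2 ⟨(perm_mem_E hρ).1 (by simpa using h1), ?_⟩
    simpa [EdgeList.perm, Inc] using h2
  · simp
  · simp

theorem Simple.sub {lo hi lo' hi' : ℕ} {s t : ℕ → ℕ} (hg : (⟨lo, hi, s, t⟩ : EdgeList).Simple)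
    (hlo : lo ≤ lo') (hhi : hi' ≤ hi) : (⟨lo', hi', s, t⟩ : EdgeList).Simple where
  ne e he := hg.ne e (mem_E.2 (by have := mem_E.1 he; dsimp only at *; omega))
  inj e he f hf := hg.inj e (mem_E.2 (by have := mem_E.1 he; dsimp only at *; omega)) f
    (mem_E.2 (by have := mem_E.1 hf; dsimp only at *; omega))

theorem exists_isMaxDeg (g : EdgeList) : ∃ D, g.IsMaxDeg D := by
  have hb : ∀ v, g.deg v ≤ g.hi - g.lo := fun v => by
    rw [← card_E]; exact Finset.card_le_card (Finset.filter_subset _ _)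
  classical
  have hfin : ∃ D, ∀ v, g.deg v ≤ D := ⟨_, hb⟩
  refine ⟨Nat.find hfin, Nat.find_spec hfin, ?_⟩
  by_contra hne
  push Not at hne
  have hlt : ∀ v, g.deg v < Nat.find hfin := fun v => lt_of_le_of_ne (Nat.find_spec hfin v) (hne v)
  have h0 := hlt 0
  exact Nat.find_min hfin (m := Nat.find hfin - 1) (by omega) fun v => by have := hlt v; omega

theorem IsMaxDeg.le_card {D : ℕ} (h : g.IsMaxDeg D) : D ≤ g.hi - g.lo := by
  obtain ⟨v, rfl⟩ := h.2
  rw [← card_E]; exact Finset.card_le_card (Finset.filter_subset _ _)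

theorem IsMaxDeg.unique {D D' : ℕ} (h : g.IsMaxDeg D) (h' : g.IsMaxDeg D') : D = D' := by
  obtain ⟨v, hv⟩ := h.2
  obtain ⟨w, hw⟩ := h'.2
  exact le_antisymm (hv ▸ h'.1 v) (hw ▸ h.1 w)

theorem IsMaxDeg.perm {D : ℕ} (h : g.IsMaxDeg D) {ρ : Equiv.Perm ℕ} (hρ : ∀ e ∉ g.E, ρ e = e) :
    (g.perm ρ).IsMaxDeg D := by
  unfold IsMaxDeg
  simp only [deg_perm hρ]
  exact h

/-- The degrees in a simple graph are less than the number of vertices. -/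
theorem Simple.deg_lt (hg : g.Simple) {n v : ℕ} (hn : ∀ e ∈ g.E, g.s e < n ∧ g.t e < n)
    (h0 : 0 < g.deg v) : g.deg v < n := by
  have hvn : v < n := by
    obtain ⟨e, he⟩ := Finset.card_pos.1 h0
    obtain ⟨heE, hev⟩ := mem_star.1 he
    rcases hev with rfl | rfl
    · exact (hn e heE).1
    · exact (hn e heE).2
  have hcard : g.deg v ≤ ((Finset.range n).erase v).card := by
    refine Finset.card_le_card_of_injOn (fun e => g.oth e v) ?_ ?_
    · intro e he
      obtain ⟨heE, hev⟩ := mem_star.1 he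
      refine Finset.mem_coe.2 (Finset.mem_erase.2 ⟨hg.oth_ne heE, Finset.mem_range.2 ?_⟩)
      show g.oth e v < n
      rcases inc_oth hev with h | h
      · rw [← h]; exact (hn e heE).1
      · rw [← h]; exact (hn e heE).2
    · intro e he f hf hef
      obtain ⟨heE, hev⟩ := mem_star.1 he
      obtain ⟨hfE, hfv⟩ := mem_star.1 hf
      dsimp only at hef
      exact hg.eq_of_inc heE hfE (hg.oth_ne heE) (inc_oth hev) hev (hef ▸ inc_oth hfv) hfv
  rw [Finset.card_erase_of_mem (Finset.mem_range.2 hvn), Finset.card_range] at hcard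
  omega

theorem Simple.card_le_sq (hg : g.Simple) {n : ℕ} (hn : ∀ e ∈ g.E, g.s e < n ∧ g.t e < n) :
    g.hi - g.lo ≤ n ^ 2 := by
  have : ((Finset.range n) ×ˢ (Finset.range n)).card = n ^ 2 := by
    rw [Finset.card_product, Finset.card_range, sq]
  rw [← card_E, ← this]
  refine Finset.card_le_card_of_injOn (fun e => (g.s e, g.t e)) ?_ ?_
  · intro e he
    simpa using hn e he
  · intro e he f hf hef
    simp only [Prod.mk.injEq] at hef
    exact hg.inj e he f hf (Or.inl hef)

end EdgeList

/-- The records `lo, …, hi - 1` have been rearranged. -/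
def Rearranged (lo hi : ℕ) (m m' : Mem) : Prop :=
  ∃ ρ : Equiv.Perm ℕ, (∀ e, ¬(lo ≤ e ∧ e < hi) → ρ e = e) ∧ m' .src = m .src ∘ ρ ∧ m' .dst = m .dst ∘ ρ

theorem Rearranged.refl {lo hi : ℕ} {m m' : Mem} (hs : m' .src = m .src) (ht : m' .dst = m .dst) :
    Rearranged lo hi m m' := ⟨Equiv.refl _, fun _ _ => rfl, hs, ht⟩

theorem Rearranged.trans {lo hi : ℕ} {m₀ m₁ m₂ : Mem} (h : Rearranged lo hi m₀ m₁)
    (h' : Rearranged lo hi m₁ m₂) : Rearranged lo hi m₀ m₂ := by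
  obtain ⟨ρ, h1, h2, h3⟩ := h
  obtain ⟨σ, e1, e2, e3⟩ := h'
  refine ⟨σ.trans ρ, fun e he => ?_, by rw [e2, h2]; rfl, by rw [e3, h3]; rfl⟩
  rw [Equiv.trans_apply, e1 e he, h1 e he]

theorem Rearranged.mono {lo hi lo' hi' : ℕ} {m m' : Mem} (h : Rearranged lo' hi' m m') (hlo : lo ≤ lo')
    (hhi : hi' ≤ hi) : Rearranged lo hi m m' := by
  obtain ⟨ρ, h1, h2⟩ := h
  exact ⟨ρ, fun e he => h1 e (by omega), h2⟩

open EdgeList in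
theorem Rearranged.perm {lo hi : ℕ} {m m' : Mem} (h : Rearranged lo hi m m') :
    ∃ ρ : Equiv.Perm ℕ, (∀ e ∉ (ofMem lo hi m).E, ρ e = e) ∧ ofMem lo hi m' = (ofMem lo hi m).perm ρ := by
  obtain ⟨ρ, h1, h2, h3⟩ := h
  refine ⟨ρ, fun e he => h1 e fun h => he (mem_E.2 h), ?_⟩
  unfold ofMem EdgeList.perm
  rw [h2, h3]

theorem Rearranged.congr {lo hi lo' hi' : ℕ} {m m' : Mem} (h : Rearranged lo hi m m')
    (hd : hi' ≤ lo ∨ hi ≤ lo') {e : ℕ} (he : lo' ≤ e ∧ e < hi') :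
    m' .src e = m .src e ∧ m' .dst e = m .dst e := by
  obtain ⟨ρ, h1, h2, h3⟩ := h
  rw [h2, h3, Function.comp_apply, Function.comp_apply, h1 e (by omega)]
  exact ⟨rfl, rfl⟩

/-! ### The halves of a partition -/

-- The permutation sends a place to the tour edge put there, and is the identity outside the
-- subgraph. It is injective and maps the finite set of edges to itself, so it is bijective.
open EdgeList in
theorem exists_perm_of_tours {τ : ℕ → ℕ} {s t : ℕ → ℕ} (hle : g.lo ≤ g.hi)
    (h1 : ∀ i < g.hi - g.lo, τ i ∈ g.E)
    (h2 : ∀ i < g.hi - g.lo, ∀ j < g.hi - g.lo, τ i = τ j → i = j)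
    (h4 : ∀ i < g.hi - g.lo, s (slot g.lo (g.hi - g.lo) i) = g.s (τ i) ∧
        t (slot g.lo (g.hi - g.lo) i) = g.t (τ i))
    (h5 : ∀ e ∉ g.E, s e = g.s e ∧ t e = g.t e) :
    ∃ ρ : Equiv.Perm ℕ, (∀ e ∉ g.E, ρ e = e) ∧ s = g.s ∘ ρ ∧ t = g.t ∘ ρ ∧
      ∀ i < g.hi - g.lo, ρ (slot g.lo (g.hi - g.lo) i) = τ i := by
  set M := g.hi - g.lo with hM
  set mid := g.lo + (M + 1) / 2 with hmid
  have hpos : ∀ e ∈ g.E, ∃ i < M, slot g.lo M i = e := by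
    intro e he
    rw [mem_E] at he
    by_cases h : e < mid
    · exact ⟨2 * (e - g.lo), by omega, by unfold slot; rw [if_pos (by omega)]; omega⟩
    · exact ⟨2 * (e - mid) + 1, by omega, by unfold slot; rw [if_neg (by omega)]; omega⟩
  choose! pos hpos hslot using hpos
  have hslotE : ∀ i < M, slot g.lo M i ∈ g.E := fun i hi => by
    have := slot_mem (lo := g.lo) hi
    exact mem_E.2 (by omega)
  have hps : ∀ i < M, pos (slot g.lo M i) = i := fun i hi =>
    slot_inj (hpos _ (hslotE i hi)) hi (hslot _ (hslotE i hi))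
  set f : ℕ → ℕ := fun e => if e ∈ g.E then τ (pos e) else e with hf
  have hfE : ∀ e, f e ∈ g.E ↔ e ∈ g.E := fun e => by
    simp only [hf]
    split
    · rename_i he
      exact ⟨fun _ => he, fun _ => h1 _ (hpos e he)⟩
    · rfl
  have hinj : Function.Injective f := by
    intro e e' h
    have hEE : e ∈ g.E ↔ e' ∈ g.E := by rw [← hfE e, h, hfE e']
    by_cases he : e ∈ g.E
    · have he' := hEE.1 he
      simp only [hf, if_pos he, if_pos he'] at h
      rw [← hslot e he, ← hslot e' he', h2 _ (hpos e he) _ (hpos e' he') h]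
    · have he' : e' ∉ g.E := fun h => he (hEE.2 h)
      simpa only [hf, if_neg he, if_neg he'] using h
  have hsurj : Function.Surjective f := by
    intro y
    by_cases hy : y ∈ g.E
    · have himg : g.E.image f = g.E := by
        refine Finset.eq_of_subset_of_card_le (fun x hx => ?_) ?_
        · obtain ⟨e, he, rfl⟩ := Finset.mem_image.1 hx
          exact (hfE e).2 he
        · rw [Finset.card_image_of_injective _ hinj]
      rw [← himg] at hy
      obtain ⟨e, -, he⟩ := Finset.mem_image.1 hy
      exact ⟨e, he⟩
    · exact ⟨y, by simp only [hf, if_neg hy]⟩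
  refine ⟨Equiv.ofBijective f ⟨hinj, hsurj⟩, fun e he => ?_, ?_, ?_, fun i hi => ?_⟩
  · simp only [Equiv.ofBijective_apply, hf, if_neg he]
  · funext e
    simp only [Function.comp_apply, Equiv.ofBijective_apply, hf]
    by_cases he : e ∈ g.E
    · rw [if_pos he, ← (h4 _ (hpos e he)).1, hslot e he]
    · rw [if_neg he, (h5 e he).1]
  · funext e
    simp only [Function.comp_apply, Equiv.ofBijective_apply, hf]
    by_cases he : e ∈ g.E
    · rw [if_pos he, ← (h4 _ (hpos e he)).2, hslot e he]
    · rw [if_neg he, (h5 e he).2]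
  · simp only [Equiv.ofBijective_apply, hf, if_pos (hslotE i hi), hps i hi]

-- The even positions of the tour list fill the first half and the odd ones the second. So the
-- degrees in the halves sum to the degree and differ by the balance.
open EdgeList in
theorem deg_halves {τ : ℕ → ℕ} {s t : ℕ → ℕ} (hle : g.lo ≤ g.hi)
    (h1 : ∀ i < g.hi - g.lo, τ i ∈ g.E)
    (h2 : ∀ i < g.hi - g.lo, ∀ j < g.hi - g.lo, τ i = τ j → i = j)
    (h4 : ∀ i < g.hi - g.lo, s (slot g.lo (g.hi - g.lo) i) = g.s (τ i) ∧
        t (slot g.lo (g.hi - g.lo) i) = g.t (τ i)) (v : ℕ) :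
    2 * ((⟨g.lo, g.lo + (g.hi - g.lo + 1) / 2, s, t⟩ : EdgeList).deg v : ℤ) =
      g.deg v + bal g τ (g.hi - g.lo) v ∧
    2 * ((⟨g.lo + (g.hi - g.lo + 1) / 2, g.hi, s, t⟩ : EdgeList).deg v : ℤ) =
      g.deg v - bal g τ (g.hi - g.lo) v := by
  set M := g.hi - g.lo with hM
  set mid := g.lo + (M + 1) / 2 with hmid
  set A := (Finset.range M).filter fun i => g.Inc (τ i) v ∧ i % 2 = 0 with hA
  set B := (Finset.range M).filter fun i => g.Inc (τ i) v ∧ i % 2 ≠ 0 with hB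
  have hdA : (⟨g.lo, mid, s, t⟩ : EdgeList).deg v = A.card := by
    symm
    refine Finset.card_bij (fun i _ => slot g.lo M i) ?_ ?_ ?_
    · intro i hi
      rw [hA, Finset.mem_filter, Finset.mem_range] at hi
      refine mem_star.2 ⟨mem_E.2 ?_, ?_⟩
      · dsimp only
        unfold slot
        rw [if_pos hi.2.2]
        omega
      · unfold Inc
        dsimp only
        rw [(h4 i hi.1).1, (h4 i hi.1).2]
        exact hi.2.1
    · intro i hi j hj h
      rw [hA, Finset.mem_filter, Finset.mem_range] at hi hj
      exact slot_inj hi.1 hj.1 h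
    · intro e he
      obtain ⟨he, hev⟩ := mem_star.1 he
      rw [mem_E] at he
      dsimp only at he
      have hs : slot g.lo M (2 * (e - g.lo)) = e := by unfold slot; rw [if_pos (by omega)]; omega
      have hlt : 2 * (e - g.lo) < M := by omega
      refine ⟨2 * (e - g.lo), Finset.mem_filter.2 ⟨Finset.mem_range.2 hlt, ?_, by omega⟩, hs⟩
      have := h4 _ hlt
      rw [hs] at this
      unfold Inc at hev ⊢
      rw [← this.1, ← this.2]
      exact hev
  have hdB : (⟨mid, g.hi, s, t⟩ : EdgeList).deg v = B.card := by
    symm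
    refine Finset.card_bij (fun i _ => slot g.lo M i) ?_ ?_ ?_
    · intro i hi
      rw [hB, Finset.mem_filter, Finset.mem_range] at hi
      refine mem_star.2 ⟨mem_E.2 ?_, ?_⟩
      · dsimp only
        unfold slot
        rw [if_neg hi.2.2]
        omega
      · unfold Inc
        dsimp only
        rw [(h4 i hi.1).1, (h4 i hi.1).2]
        exact hi.2.1
    · intro i hi j hj h
      rw [hB, Finset.mem_filter, Finset.mem_range] at hi hj
      exact slot_inj hi.1 hj.1 h
    · intro e he
      obtain ⟨he, hev⟩ := mem_star.1 he
      rw [mem_E] at he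
      dsimp only at he
      have hs : slot g.lo M (2 * (e - mid) + 1) = e := by unfold slot; rw [if_neg (by omega)]; omega
      have hlt : 2 * (e - mid) + 1 < M := by omega
      refine ⟨2 * (e - mid) + 1, Finset.mem_filter.2 ⟨Finset.mem_range.2 hlt, ?_, by omega⟩, hs⟩
      have := h4 _ hlt
      rw [hs] at this
      unfold Inc at hev ⊢
      rw [← this.1, ← this.2]
      exact hev
  have hd : g.deg v = A.card + B.card := by
    have : g.deg v = ((Finset.range M).filter fun i => g.Inc (τ i) v).card := by
      symm
      refine Finset.card_bij (fun i _ => τ i) ?_ ?_ ?_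
      · intro i hi
        rw [Finset.mem_filter, Finset.mem_range] at hi
        exact mem_star.2 ⟨h1 i hi.1, hi.2⟩
      · intro i hi j hj h
        rw [Finset.mem_filter, Finset.mem_range] at hi hj
        exact h2 i hi.1 j hj.1 h
      · intro e he
        obtain ⟨he, hev⟩ := mem_star.1 he
        have himg : (Finset.range M).image τ = g.E := by
          refine Finset.eq_of_subset_of_card_le (fun x hx => ?_) ?_
          · obtain ⟨i, hi, rfl⟩ := Finset.mem_image.1 hx
            exact h1 i (Finset.mem_range.1 hi)
          · rw [Finset.card_image_of_injOn, Finset.card_range, card_E]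
            intro i hi j hj hij
            exact h2 i (Finset.mem_range.1 hi) j (Finset.mem_range.1 hj) hij
        rw [← himg] at he
        obtain ⟨i, hi, rfl⟩ := Finset.mem_image.1 he
        exact ⟨i, Finset.mem_filter.2 ⟨hi, hev⟩, rfl⟩
    rw [this, ← Finset.card_filter_add_card_filter_not (s := (Finset.range M).filter _)
      (fun i => i % 2 = 0), Finset.filter_filter, Finset.filter_filter]
  have hbal : bal g τ M v = (A.card : ℤ) - B.card := by
    unfold bal
    rw [hA, hB, Finset.card_filter, Finset.card_filter]
    push_cast
    rw [← Finset.sum_sub_distrib]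
    refine Finset.sum_congr rfl fun i _ => ?_
    by_cases hi : g.Inc (τ i) v
    · rcases Nat.even_or_odd i with h | h
      · simp [hi, h.neg_one_pow, Nat.even_iff.1 h]
      · simp [hi, h.neg_one_pow, Nat.odd_iff.1 h]
    · simp [hi]
  rw [hdA, hdB, hbal, hd]
  push_cast
  constructor <;> ring

open EdgeList in
/-- `partition` rearranges the records, and halves all degrees up to a constant. -/
theorem partition_halves_spec {lo hi : ℕ} (hg : (ofMem lo hi m).Simple) (hle : lo ≤ hi)
    (hdeg : ∀ v, ((ofMem lo hi m).star v).Nonempty → m .deg v = (ofMem lo hi m).deg v) :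
    Spec (partition lo hi) m (65 * (hi - lo) + 1) fun _ m' => Rearranged lo hi m m' ∧
      m' .col = m .col ∧ ∀ v,
        |2 * ((ofMem lo (lo + (hi - lo + 1) / 2) m').deg v : ℤ) - (ofMem lo hi m).deg v| ≤ 3 ∧
        |2 * ((ofMem (lo + (hi - lo + 1) / 2) hi m').deg v : ℤ) - (ofMem lo hi m).deg v| ≤ 3 := by
  refine (partition_spec (g := ofMem lo hi m) hg hle rfl rfl fun v hv => hdeg v ?_).mono le_rfl ?_
  · obtain ⟨e, he⟩ := mem_V.1 hv
    exact ⟨e, mem_star.2 he⟩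
  · rintro - m' ⟨τ, h1, h2, h3, h4, h5, h6⟩
    obtain ⟨ρ, r1, r2, r3, -⟩ := exists_perm_of_tours (g := ofMem lo hi m) hle h1 h2 h4 h5
    refine ⟨⟨ρ, fun e he => r1 e fun h => he (mem_E.1 h), r2, r3⟩, h6, fun v => ?_⟩
    obtain ⟨e1, e2⟩ := deg_halves (g := ofMem lo hi m) hle h1 h2 h4 v
    have e3 := abs_le.1 (h3 v)
    constructor
    · rw [abs_le]
      change 2 * ((ofMem lo (lo + (hi - lo + 1) / 2) m').deg v : ℤ) = _ at e1
      rw [e1]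
      constructor <;> linarith
    · rw [abs_le]
      change 2 * ((ofMem (lo + (hi - lo + 1) / 2) hi m').deg v : ℤ) = _ at e2
      rw [e2]
      constructor <;> linarith

/-! ### Estimates for the running time -/

/-- The fourth root. -/
noncomputable def root4 (x : ℝ) : ℝ := √√x

theorem root4_nonneg (x : ℝ) : 0 ≤ root4 x := Real.sqrt_nonneg _

theorem root4_sq (x : ℝ) : root4 x ^ 2 = √x := Real.sq_sqrt (Real.sqrt_nonneg _)

theorem root4_pow {x : ℝ} (hx : 0 ≤ x) : root4 x ^ 4 = x := by
  rw [show root4 x ^ 4 = (root4 x ^ 2) ^ 2 by ring, root4_sq, Real.sq_sqrt hx]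

theorem root4_mul {x : ℝ} (hx : 0 ≤ x) (y : ℝ) : root4 (x * y) = root4 x * root4 y := by
  unfold root4
  rw [Real.sqrt_mul hx, Real.sqrt_mul (Real.sqrt_nonneg _)]

theorem root4_mono {x y : ℝ} (h : x ≤ y) : root4 x ≤ root4 y := Real.sqrt_le_sqrt (Real.sqrt_le_sqrt h)

/-- A discrete form of integrating x^(-3/4): for the fourth roots a, b of ℓ + 1 and ℓ, (a - b)(a +
b)(a² + b²) = 1, and (a + b)(a² + b²) ≤ 4a³. -/
theorem inv_root4_cube_le (ℓ : ℕ) :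
    1 / root4 ((ℓ + 1 : ℕ) : ℝ) ^ 3 ≤ 4 * (root4 ((ℓ + 1 : ℕ) : ℝ) - root4 (ℓ : ℝ)) := by
  set a := root4 ((ℓ + 1 : ℕ) : ℝ) with ha
  set b := root4 (ℓ : ℝ) with hb
  have h1 : a ^ 4 = ℓ + 1 := by rw [ha, root4_pow (by positivity)]; push_cast; ring
  have h2 : b ^ 4 = ℓ := root4_pow (by positivity)
  have hb0 : 0 ≤ b := root4_nonneg _
  have hab : b ≤ a := root4_mono (by push_cast; linarith)
  have ha0 : 0 < a := by
    rcases (root4_nonneg ((ℓ + 1 : ℕ) : ℝ)).lt_or_eq with h | h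
    · exact h
    · exfalso
      rw [← ha] at h
      rw [← h] at h1
      have : (0 : ℝ) ≤ ℓ := by positivity
      norm_num at h1
      linarith
  rw [div_le_iff₀ (by positivity)]
  have h3 : (a - b) * ((a + b) * (a ^ 2 + b ^ 2)) = 1 := by
    have : (a - b) * ((a + b) * (a ^ 2 + b ^ 2)) = a ^ 4 - b ^ 4 := by ring
    rw [this, h1, h2]; ring
  have h4 : (a + b) * (a ^ 2 + b ^ 2) ≤ 4 * a ^ 3 := by
    have : b ^ 2 ≤ a ^ 2 := by gcongr
    calc (a + b) * (a ^ 2 + b ^ 2) ≤ (a + a) * (a ^ 2 + a ^ 2) := by gcongr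
      _ = 4 * a ^ 3 := by ring
  calc (1 : ℝ) = (a - b) * ((a + b) * (a ^ 2 + b ^ 2)) := h3.symm
    _ ≤ (a - b) * (4 * a ^ 3) := by
      apply mul_le_mul_of_nonneg_left h4; linarith
    _ = 4 * (a - b) * a ^ 3 := by ring

/-- A minimum is at most any weighted geometric mean; the weights 1/4 and 3/4 are the ones used. -/
theorem min_pow_le {p r : ℝ} (hp : 0 ≤ p) (hr : 0 ≤ r) : min (p ^ 4) (r ^ 4) ≤ p * r ^ 3 := by
  rcases le_total p r with h | h
  · refine (min_le_left _ _).trans ?_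
    calc p ^ 4 = p * p ^ 3 := by ring
      _ ≤ p * r ^ 3 := by gcongr
  · refine (min_le_right _ _).trans ?_
    calc r ^ 4 = r * r ^ 3 := by ring
      _ ≤ p * r ^ 3 := by gcongr

/-- Interpolation makes the terms proportional to ℓ^(-3/4), whose sums telescope. The exponent is
less than 1, so no logarithm appears as it would from A/ℓ alone. -/
theorem sum_min_le {n A : ℝ} (hn : 0 ≤ n) (hA : 0 ≤ A) (U : ℕ) :
    ∑ ℓ ∈ Finset.range U, min n (A / ((ℓ + 1 : ℕ) : ℝ)) ≤ 4 * root4 n * root4 A ^ 3 * root4 U := by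
  have hterm : ∀ ℓ : ℕ, min n (A / ((ℓ + 1 : ℕ) : ℝ)) ≤
      4 * root4 n * root4 A ^ 3 * (root4 ((ℓ + 1 : ℕ) : ℝ) - root4 (ℓ : ℝ)) := by
    intro ℓ
    have h1 := min_pow_le (root4_nonneg n)
      (div_nonneg (root4_nonneg A) (root4_nonneg ((ℓ + 1 : ℕ) : ℝ)))
    rw [div_pow, root4_pow hn, root4_pow hA, root4_pow (by positivity)] at h1
    refine h1.trans ?_
    have h2 := inv_root4_cube_le ℓ
    have h3 := root4_nonneg n
    have h4 := root4_nonneg A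
    calc root4 n * (root4 A / root4 ((ℓ + 1 : ℕ) : ℝ)) ^ 3
        = root4 n * root4 A ^ 3 * (1 / root4 ((ℓ + 1 : ℕ) : ℝ) ^ 3) := by rw [div_pow]; ring
      _ ≤ root4 n * root4 A ^ 3 * (4 * (root4 ((ℓ + 1 : ℕ) : ℝ) - root4 (ℓ : ℝ))) := by gcongr
      _ = _ := by ring
  refine (Finset.sum_le_sum fun ℓ _ => hterm ℓ).trans ?_
  rw [← Finset.mul_sum, Finset.sum_range_sub (fun ℓ : ℕ => root4 (ℓ : ℝ))]
  simp [root4]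

/-- The expected time of the Repair step, in two regimes. -/
theorem sum_min_le_sqrt {n k d : ℝ} (hn : 0 ≤ n) (hk : 0 ≤ k) (hd : 0 < d) {U : ℕ}
    (hU : U * d ≤ 4 * k) :
    ∑ ℓ ∈ Finset.range U, min n (k * d / ((ℓ + 1 : ℕ) : ℝ)) ≤ 8 * k * √(√n * d) := by
  refine (sum_min_le hn (by positivity) U).trans ?_
  have h1 := root4_nonneg n
  have h2 := root4_nonneg k
  have h3 := root4_nonneg d
  have h5 : root4 d * root4 U ≤ 2 * root4 k := by
    have : (root4 d * root4 U) ^ 4 ≤ (2 * root4 k) ^ 4 := by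
      rw [mul_pow, mul_pow, root4_pow hd.le, root4_pow hk, root4_pow (by positivity)]
      nlinarith
    exact le_of_pow_le_pow_left₀ (by norm_num) (by positivity) this
  have h6 : √(√n * d) = root4 n * root4 d ^ 2 := by
    rw [root4_sq, Real.sqrt_mul (Real.sqrt_nonneg _)]; rfl
  rw [root4_mul hk, h6]
  calc 4 * root4 n * (root4 k * root4 d) ^ 3 * root4 U
      = 4 * root4 n * root4 k ^ 3 * root4 d ^ 2 * (root4 d * root4 U) := by ring
    _ ≤ 4 * root4 n * root4 k ^ 3 * root4 d ^ 2 * (2 * root4 k) := by gcongr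
    _ = 8 * root4 k ^ 4 * (root4 n * root4 d ^ 2) := by ring
    _ = 8 * k * (root4 n * root4 d ^ 2) := by rw [root4_pow hk]

/-- Taking n for each of the U terms is the better estimate for d above √n, where few edges are
uncolored. -/
theorem sum_min_le_div {n A k d : ℝ} (hn : 0 ≤ n) (hd : 0 < d) {U : ℕ} (hU : U * d ≤ 4 * k) :
    ∑ ℓ ∈ Finset.range U, min n (A / ((ℓ + 1 : ℕ) : ℝ)) ≤ 4 * k * (n / d) := by
  have : ∑ ℓ ∈ Finset.range U, min n (A / ((ℓ + 1 : ℕ) : ℝ)) ≤ U * n := by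
    refine (Finset.sum_le_sum fun ℓ _ => min_le_left n _).trans ?_
    simp
  refine this.trans ?_
  rw [← mul_div_assoc, le_div_iff₀ hd]
  nlinarith

/-- The potential of a subproblem of maximum degree about `D`. -/
noncomputable def potential (N D : ℝ) : ℝ := √(D / N) / (1 + √(D / N))

theorem potential_nonneg (N D : ℝ) : 0 ≤ potential N D := by unfold potential; positivity

theorem potential_le_one (N D : ℝ) : potential N D ≤ 1 := by
  unfold potential
  rw [div_le_one (by positivity)]
  linarith

/-- Halving D divides s = √(D/N) by √2, so s falls by at least s/4, while s/(1+s) has slope at least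
1/(1+s)² on this range. -/
theorem potential_drop {N D : ℝ} (hN : 0 < N) (hD : 0 < D) :
    √(D / N) / (1 + √(D / N)) ^ 2 ≤ 4 * (potential N D - potential N (D / 2)) := by
  unfold potential
  set s := √(D / N) with hs
  set r := √(D / 2 / N) with hr
  have hs0 : 0 < s := Real.sqrt_pos.2 (by positivity)
  have hr0 : 0 ≤ r := Real.sqrt_nonneg _
  have hsr : r ≤ 3 / 4 * s := by
    rw [hr, Real.sqrt_le_left (by positivity)]
    rw [mul_pow, hs, Real.sq_sqrt (by positivity)]
    have : 0 < D / N := by positivity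
    rw [show D / 2 / N = (D / N) / 2 by ring]
    linarith
  have h1 : s / (1 + s) - r / (1 + r) = (s - r) / ((1 + s) * (1 + r)) := by
    field_simp
    ring
  rw [h1, ← mul_div_assoc, div_le_div_iff₀ (by positivity) (by positivity)]
  have h2 : (1 + s) * (1 + r) ≤ (1 + s) ^ 2 := by
    rw [sq]; gcongr; linarith
  calc s * ((1 + s) * (1 + r)) ≤ s * (1 + s) ^ 2 := by gcongr
    _ ≤ 4 * (s - r) * (1 + s) ^ 2 := by
      gcongr
      linarith

/-- For √x ≤ 1 the denominator on the right is at most 4; for √x ≥ 1 it is at most 4x, and x√x ≥ x.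
-/
theorem min_le_potential {x : ℝ} (hx : 0 < x) : min (√x) (1 / x) ≤ 4 * (√x / (1 + √x) ^ 2) := by
  set s := √x with hs
  have hs0 : 0 < s := Real.sqrt_pos.2 hx
  have hx2 : x = s ^ 2 := (Real.sq_sqrt hx.le).symm
  rw [← mul_div_assoc, le_div_iff₀ (by positivity), hx2]
  rcases le_total s 1 with h | h
  · refine (mul_le_mul_of_nonneg_right (min_le_left _ _) (by positivity)).trans ?_
    nlinarith
  · refine (mul_le_mul_of_nonneg_right (min_le_right _ _) (by positivity)).trans ?_
    rw [one_div, inv_mul_le_iff₀ (by positivity)]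
    have h1 : (1 + s) ^ 2 ≤ (2 * s) ^ 2 := by gcongr; linarith
    nlinarith [mul_nonneg hs0.le (mul_nonneg hs0.le (sub_nonneg.2 h))]

/-- The expected time of the Repair step, charged to the potential. -/
theorem sum_min_le_drop {n k d D : ℝ} (hn : 1 ≤ n) (hk : 0 ≤ k) (hd : 0 < d) (hD : 0 < D)
    (hdD : |d - D| ≤ 3) {U : ℕ} (hU : U * d ≤ 4 * k) :
    ∑ ℓ ∈ Finset.range U, min n (k * d / ((ℓ + 1 : ℕ) : ℝ)) ≤
      256 * k * (√n * (potential (√n) D - potential (√n) (D / 2))) + 24 * k * √√n := by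
  set N := √n with hN
  have hN1 : 1 ≤ N := Real.one_le_sqrt.2 hn
  have hN0 : 0 < N := by linarith
  obtain ⟨h1, h2⟩ := abs_le.1 hdD
  have hdrop := potential_drop hN0 hD
  have hs0 : 0 ≤ √(D / N) / (1 + √(D / N)) ^ 2 := by positivity
  have hA := sum_min_le_sqrt (n := n) (by linarith) hk hd hU
  have hB := sum_min_le_div (n := n) (A := k * d) (by linarith) hd hU
  set S := ∑ ℓ ∈ Finset.range U, min n (k * d / ((ℓ + 1 : ℕ) : ℝ)) with hS
  -- For D ≥ 6 the error 3 is harmless: D/2 ≤ d ≤ 4D. The constant 256 is 16 from these estimates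
  -- times 4 · 4 from the potential. For D ≤ 6 only d ≤ 9 is used, which gives the additive term 8 ·
  -- 3 = 24.
  rcases le_total 6 D with h6 | h6
  · have hA' : S ≤ 16 * k * N * √(D / N) := by
      refine hA.trans ?_
      have : √(N * d) ≤ 2 * (N * √(D / N)) := by
        rw [Real.sqrt_le_left (by positivity), mul_pow, mul_pow,
          Real.sq_sqrt (show 0 ≤ D / N by positivity)]
        rw [show (2 : ℝ) ^ 2 * (N ^ 2 * (D / N)) = N * (4 * D) by field_simp; ring]
        gcongr
        linarith
      nlinarith
    have hB' : S ≤ 16 * k * N * (1 / (D / N)) := by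
      refine hB.trans ?_
      have : n / d ≤ 2 * (N * (1 / (D / N))) := by
        rw [show 2 * (N * (1 / (D / N))) = N ^ 2 / (D / 2) by field_simp, hN, Real.sq_sqrt (by linarith)]
        gcongr
        linarith
      have h0 : 0 ≤ N * (1 / (D / N)) := by positivity
      nlinarith
    have hm : S ≤ 16 * k * N * min (√(D / N)) (1 / (D / N)) := by
      rcases min_choice (√(D / N)) (1 / (D / N)) with h | h <;> rw [h] <;> assumption
    have h3 := min_le_potential (x := D / N) (by positivity)
    have h4 : min (√(D / N)) (1 / (D / N)) ≤ 16 * (potential N D - potential N (D / 2)) := by linarith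
    have h5 : 0 ≤ 24 * k * √N := by positivity
    calc S ≤ 16 * k * N * min (√(D / N)) (1 / (D / N)) := hm
      _ ≤ 16 * k * N * (16 * (potential N D - potential N (D / 2))) := by gcongr
      _ ≤ _ := by linarith
  · have h3 : √(N * d) ≤ 3 * √N := by
      rw [Real.sqrt_le_left (by positivity), mul_pow, Real.sq_sqrt hN0.le]
      nlinarith
    have h4 : 0 ≤ potential N D - potential N (D / 2) := by linarith
    have h5 : 0 ≤ 256 * k * (N * (potential N D - potential N (D / 2))) := by positivity
    nlinarith

/-- The bound for the expected time on a graph with `k` edges and maximum degree about `D`. -/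
noncomputable def timeBound (n : ℕ) (k : ℕ) (D : ℝ) : ℝ :=
  k * (76800 * (√n * potential (√n) D) + 7600 * (√√n * (1 + Nat.clog 2 k)))

theorem timeBound_nonneg (n k : ℕ) (D : ℝ) : 0 ≤ timeBound n k D := by
  have := potential_nonneg (√n) D
  unfold timeBound
  positivity

theorem timeBound_base {n k : ℕ} (hn : 1 ≤ n) (D : ℝ) : (14 * k : ℝ) ≤ timeBound n k D := by
  have h1 := potential_nonneg (√n) D
  have h2 : 1 ≤ √√(n : ℝ) := Real.one_le_sqrt.2 (Real.one_le_sqrt.2 (by exact_mod_cast hn))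
  have h3 : (0 : ℝ) ≤ Nat.clog 2 k := by positivity
  have h4 : 1 ≤ √√(n : ℝ) * (1 + Nat.clog 2 k) := by nlinarith
  have h5 : 0 ≤ √(n : ℝ) * potential (√n) D := by positivity
  unfold timeBound
  rw [mul_comm (14 : ℝ)]
  gcongr
  linarith

/-- The drop of the potential pays the main part of the repair, 76800 = 300 · 256. The logarithmic
term loses one unit in each half, which pays 300 · 24 for small degrees and 300 for the linear work;
7600 exceeds their sum. -/
theorem timeBound_step {n k k₁ k₂ : ℕ} (hn : 1 ≤ n) (hk : 2 ≤ k) (h₁ : k₁ = (k + 1) / 2)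
    (h₂ : k₁ + k₂ = k) {d D : ℝ} (hd : 0 < d) (hD : 0 < D) (hdD : |d - D| ≤ 3) {U : ℕ}
    (hU : U * d ≤ 4 * k) :
    300 * (k : ℝ) + timeBound n k₁ (D / 2) + timeBound n k₂ (D / 2) +
      300 * ∑ ℓ ∈ Finset.range U, min (n : ℝ) (k * d / ((ℓ + 1 : ℕ) : ℝ)) ≤ timeBound n k D := by
  have hn' : (1 : ℝ) ≤ n := by exact_mod_cast hn
  have hsum := sum_min_le_drop hn' (Nat.cast_nonneg k) hd hD hdD hU
  have hP : 1 ≤ √√(n : ℝ) := Real.one_le_sqrt.2 (Real.one_le_sqrt.2 hn')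
  have hc1 : Nat.clog 2 k = Nat.clog 2 k₁ + 1 := by
    rw [Nat.clog_of_two_le (by norm_num) hk, h₁]; rfl
  have hc2 : Nat.clog 2 k₂ ≤ Nat.clog 2 k₁ := Nat.clog_mono_right 2 (by omega)
  have hc2' : (Nat.clog 2 k₂ : ℝ) ≤ Nat.clog 2 k₁ := by exact_mod_cast hc2
  have hk2 : (k : ℝ) = k₁ + k₂ := by exact_mod_cast h₂.symm
  unfold timeBound
  rw [hc1, Nat.cast_add (Nat.clog 2 k₁), Nat.cast_one]
  set S := ∑ ℓ ∈ Finset.range U, min (n : ℝ) (k * d / ((ℓ + 1 : ℕ) : ℝ))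
  set p := potential (√n) D
  set p' := potential (√n) (D / 2)
  set P := √√(n : ℝ)
  set L : ℝ := (Nat.clog 2 k₁ : ℝ)
  set L₂ : ℝ := (Nat.clog 2 k₂ : ℝ)
  have hk20 : (0 : ℝ) ≤ k₂ := Nat.cast_nonneg _
  have h1 : (k₂ : ℝ) * (P * (1 + L₂)) ≤ k₂ * (P * (1 + L)) := by gcongr
  have h2 : (k : ℝ) ≤ k * P := by nlinarith [(Nat.cast_nonneg k : (0 : ℝ) ≤ k)]
  rw [hk2] at hsum h2 ⊢
  nlinarith

/-- With p = ⌈n^(1/4)⌉, k ≤ p^8 ≤ 2^(8p), and rounding up at most doubles n^(1/4) ≥ 1. Thus the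
number of levels is absorbed into a second factor n^(1/4). -/
theorem clog_le {n k : ℕ} (hn : 1 ≤ n) (hk : k ≤ n ^ 2) : (Nat.clog 2 k : ℝ) ≤ 16 * √√(n : ℝ) := by
  set P := √√(n : ℝ) with hP
  have hP1 : 1 ≤ P := Real.one_le_sqrt.2 (Real.one_le_sqrt.2 (by exact_mod_cast hn))
  set p := ⌈P⌉₊ with hp
  have h1 : n ≤ p ^ 4 := by
    have : (n : ℝ) = P ^ 4 := (root4_pow (Nat.cast_nonneg n)).symm
    have h2 : (n : ℝ) ≤ (p : ℝ) ^ 4 := by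
      rw [this]; gcongr; exact Nat.le_ceil P
    exact_mod_cast h2
  have h2 : k ≤ 2 ^ (8 * p) := by
    calc k ≤ n ^ 2 := hk
      _ ≤ (p ^ 4) ^ 2 := by gcongr
      _ = p ^ 8 := by ring
      _ ≤ (2 ^ p) ^ 8 := by gcongr; exact Nat.lt_two_pow_self.le
      _ = 2 ^ (8 * p) := by rw [← pow_mul, mul_comm]
  have h3 : Nat.clog 2 k ≤ 8 * p := Nat.clog_le_of_le_pow h2
  have h4 : (p : ℝ) < P + 1 := Nat.ceil_lt_add_one (by linarith)
  have h5 : (Nat.clog 2 k : ℝ) ≤ 8 * p := by exact_mod_cast h3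
  linarith

theorem timeBound_le {n k : ℕ} (hn : 1 ≤ n) (hk : k ≤ n ^ 2) (D : ℝ) :
    timeBound n k D ≤ 206000 * (k * √n) := by
  have h1 := clog_le hn hk
  have h2 := potential_le_one (√n) D
  have hP : 1 ≤ √√(n : ℝ) := Real.one_le_sqrt.2 (Real.one_le_sqrt.2 (by exact_mod_cast hn))
  have h3 : √√(n : ℝ) ^ 2 = √n := root4_sq _
  unfold timeBound
  have h4 : √√(n : ℝ) * (1 + Nat.clog 2 k) ≤ 17 * √n := by
    have : √√(n : ℝ) * (1 + Nat.clog 2 k) ≤ √√(n : ℝ) * (17 * √√(n : ℝ)) := by gcongr; linarith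
    nlinarith
  have h5 : √(n : ℝ) * potential (√n) D ≤ √n := by
    have := Real.sqrt_nonneg (n : ℝ); nlinarith
  calc (k : ℝ) * (76800 * (√n * potential (√n) D) + 7600 * (√√n * (1 + Nat.clog 2 k)))
      ≤ k * (76800 * √n + 7600 * (17 * √n)) := by gcongr
    _ = 206000 * (k * √n) := by ring

/-! ### Random-Euler-Color on edge records -/

namespace EdgeList

theorem deg_congr {lo hi : ℕ} {m m' : Mem}
    (h : ∀ e, lo ≤ e ∧ e < hi → m' .src e = m .src e ∧ m' .dst e = m .dst e) (v : ℕ) :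
    (ofMem lo hi m').deg v = (ofMem lo hi m).deg v := by
  unfold deg
  congr 1
  ext e
  rw [mem_star, mem_star]
  refine and_congr_right fun he => ?_
  have := h e (mem_E.1 he)
  unfold Inc ofMem
  dsimp only
  rw [this.1, this.2]

theorem Proper.congr_mem {lo hi : ℕ} {m m' : Mem} {c' : ℕ → ℕ} (hc : (ofMem lo hi m).Proper q c)
    (h : ∀ e, lo ≤ e ∧ e < hi → m' .src e = m .src e ∧ m' .dst e = m .dst e ∧ c' e = c e) :
    (ofMem lo hi m').Proper q c' where
  le e he := by rw [(h e (mem_E.1 he)).2.2]; exact hc.le e he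
  ne e he f hf hne v hev hfv := by
    have h1 := h e (mem_E.1 he)
    have h2 := h f (mem_E.1 hf)
    rw [h1.2.2, h2.2.2]
    refine hc.ne e he f hf hne v ?_ ?_
    · unfold Inc ofMem at hev ⊢
      dsimp only at hev ⊢
      rwa [← h1.1, ← h1.2.1]
    · unfold Inc ofMem at hfv ⊢
      dsimp only at hfv ⊢
      rwa [← h2.1, ← h2.2.1]

/-- The first half uses colors up to q₁. Every edge of the second half is colored, so after the
relabeling its colors exceed q₁. -/
theorem Proper.union {lo mid hi q₁ q₂ : ℕ} {m : Mem} {c c' : ℕ → ℕ}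
    (h₁ : (ofMem lo mid m).Proper q₁ c) (h₂ : (ofMem mid hi m).Proper q₂ c)
    (n₂ : ∀ e, mid ≤ e ∧ e < hi → c e ≠ 0)
    (hc : ∀ e, c' e = if mid ≤ e ∧ e < hi then c e + q₁ else c e) :
    (ofMem lo hi m).Proper (q₁ + q₂) c' := by
  have key : ∀ e, lo ≤ e ∧ e < hi → (e ∈ (ofMem lo mid m).E ∧ c' e = c e ∧ c e ≤ q₁) ∨
      (e ∈ (ofMem mid hi m).E ∧ c' e = c e + q₁ ∧ c e ≤ q₂ ∧ c e ≠ 0) := by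
    intro e he
    by_cases h : e < mid
    · have hE : e ∈ (ofMem lo mid m).E := mem_E.2 ⟨he.1, h⟩
      exact Or.inl ⟨hE, by rw [hc, if_neg (by omega)], h₁.le e hE⟩
    · have hE : e ∈ (ofMem mid hi m).E := mem_E.2 ⟨by simpa [ofMem] using h, he.2⟩
      exact Or.inr ⟨hE, by rw [hc, if_pos (by omega)], h₂.le e hE, n₂ e (by omega)⟩
  constructor
  · intro e he
    rcases key e (mem_E.1 he) with h | h <;> omega
  · intro e he f hf hne v hev hfv h0
    rcases key e (mem_E.1 he) with ⟨a1, a2, a3⟩ | ⟨a1, a2, a3, a4⟩ <;>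
    rcases key f (mem_E.1 hf) with ⟨b1, b2, b3⟩ | ⟨b1, b2, b3, b4⟩
    · rw [a2, b2]
      exact h₁.ne e a1 f b1 hne v hev hfv (a2 ▸ h0)
    · omega
    · omega
    · have := h₂.ne e a1 f b1 hne v hev hfv a4
      omega

theorem proper_one {lo hi : ℕ} {m : Mem} {c : ℕ → ℕ} (hd : ∀ v, (ofMem lo hi m).deg v ≤ 1)
    (hc : ∀ e, lo ≤ e ∧ e < hi → c e = 1) : (ofMem lo hi m).Proper 1 c where
  le e he := (hc e (mem_E.1 he)).le
  ne e he f hf hne v hev hfv _ := by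
    exfalso
    have : ({e, f} : Finset ℕ) ⊆ (ofMem lo hi m).star v := by
      intro x hx
      rw [Finset.mem_insert, Finset.mem_singleton] at hx
      rcases hx with rfl | rfl
      · exact mem_star.2 ⟨he, hev⟩
      · exact mem_star.2 ⟨hf, hfv⟩
    have h1 := Finset.card_le_card this
    rw [Finset.card_pair hne] at h1
    have := hd v
    unfold deg at this
    omega

end EdgeList

open EdgeList

theorem Rearranged.simple {lo hi : ℕ} {m m' : Mem} (h : Rearranged lo hi m m')
    (hg : (ofMem lo hi m).Simple) : (ofMem lo hi m').Simple := by
  obtain ⟨ρ, h1, h2⟩ := h.perm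
  rw [h2]
  exact hg.perm h1

theorem Rearranged.isMaxDeg {lo hi D : ℕ} {m m' : Mem} (h : Rearranged lo hi m m')
    (hg : (ofMem lo hi m).IsMaxDeg D) : (ofMem lo hi m').IsMaxDeg D := by
  obtain ⟨ρ, h1, h2⟩ := h.perm
  rw [h2]
  exact hg.perm h1

theorem Rearranged.lt {lo hi n : ℕ} {m m' : Mem} (h : Rearranged lo hi m m')
    (hn : ∀ e, lo ≤ e ∧ e < hi → m .src e < n ∧ m .dst e < n) :
    ∀ e, lo ≤ e ∧ e < hi → m' .src e < n ∧ m' .dst e < n := by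
  obtain ⟨ρ, h1, h2⟩ := h.perm
  intro e he
  have h3 : ρ e ∈ (ofMem lo hi m).E := (perm_mem_E h1).2 (mem_E.2 he)
  have h4 := hn _ (mem_E.1 h3)
  have h5 : m' .src = m .src ∘ ρ := congrArg EdgeList.s h2
  have h6 : m' .dst = m .dst ∘ ρ := congrArg EdgeList.t h2
  rw [h5, h6]
  exact h4

/-! ### The Repair step and the recursion of Random-Euler-Color. -/

theorem sum_ofReal_le {n : ℕ} {A : ℝ} (hA : 0 ≤ A) (u : ℕ) :
    ∑ ℓ ∈ Finset.range u, (1 + ENNReal.ofReal (300 * min (n : ℝ) (A / ((ℓ + 1 : ℕ) : ℝ)))) =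
      ENNReal.ofReal (u + 300 * ∑ ℓ ∈ Finset.range u, min (n : ℝ) (A / ((ℓ + 1 : ℕ) : ℝ))) := by
  have h0 : ∀ ℓ : ℕ, 0 ≤ min (n : ℝ) (A / ((ℓ + 1 : ℕ) : ℝ)) := fun ℓ => by positivity
  rw [Finset.mul_sum, ENNReal.ofReal_add (by positivity)
    (Finset.sum_nonneg fun ℓ _ => mul_nonneg (by norm_num) (h0 ℓ)), ENNReal.ofReal_sum_of_nonneg
    fun ℓ _ => mul_nonneg (by norm_num) (h0 ℓ), Finset.sum_add_distrib]
  simp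

/-- Stated for any upper bound U on the number of uncolored edges, because the exact number after
Prune depends on the random colorings of the halves. -/
theorem repair_rspec {lo hi n U : ℕ} (hle : lo ≤ hi) (hg : (ofMem lo hi m).Simple)
    (hd : (ofMem lo hi m).IsMaxDeg d) (hd1 : 1 ≤ d)
    (hn : ∀ e, lo ≤ e ∧ e < hi → m .src e < n ∧ m .dst e < n)
    (hc : (ofMem lo hi m).Proper (d + 1) (m .col))
    (hU : ((ofMem lo hi m).unc (m .col)).card ≤ U) :
    RSpec (repair lo hi d) m (ENNReal.ofReal ((90 * (hi - lo : ℕ) + 2 + U : ℝ) +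
      300 * ∑ ℓ ∈ Finset.range U, min (n : ℝ) (((hi - lo : ℕ) : ℝ) * d / ((ℓ + 1 : ℕ) : ℝ))))
      fun _ m' => (m' .src = m .src ∧ m' .dst = m .dst) ∧ (ofMem lo hi m').Proper (d + 1) (m' .col) ∧
        (∀ e, lo ≤ e ∧ e < hi → m' .col e ≠ 0) ∧
        ∀ e, ¬(lo ≤ e ∧ e < hi) → m' .col e = m .col e := by
  have hn' : ∀ e ∈ (ofMem lo hi m).E, (ofMem lo hi m).s e < n ∧ (ofMem lo hi m).t e < n :=
    fun e he => hn e (mem_E.1 he)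
  have hdn : d < n := by
    obtain ⟨v, rfl⟩ := hd.2
    exact hg.deg_lt hn' (by omega)
  have hnn : ∀ ℓ : ℕ, 0 ≤ min (n : ℝ) (((hi - lo : ℕ) : ℝ) * d / ((ℓ + 1 : ℕ) : ℝ)) :=
    fun ℓ => by positivity
  unfold repair
  refine (RSpec.lift_bind (T₂ := 1 + ENNReal.ofReal ((U : ℝ) +
    300 * ∑ ℓ ∈ Finset.range U, min (n : ℝ) (((hi - lo : ℕ) : ℝ) * d / ((ℓ + 1 : ℕ) : ℝ))))
    (initRepair_spec (g := ofMem lo hi m) hg hle rfl rfl hd.1 hc rfl) (Q := fun _ m' =>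
        (m' .src = m .src ∧ m' .dst = m .dst) ∧ (ofMem lo hi m').Proper (d + 1) (m' .col) ∧
        (∀ e, lo ≤ e ∧ e < hi → m' .col e ≠ 0) ∧
        ∀ e, ¬(lo ≤ e ∧ e < hi) → m' .col e = m .col e) ?_).mono ?_ fun _ _ h => h
  · intro _ m1 h1
    refine (repairLoop_rspec hg hd.1 hd1 hdn hn' (hi - lo) _ m1 hc h1 ?_).mono ?_ ?_
    · refine (Finset.card_le_card (Finset.filter_subset _ _)).trans ?_
      exact (card_E (g := ofMem lo hi m)).le
    · gcongr 1 + ?_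
      refine (sum_ofReal_le (n := n) (A := ((hi - lo : ℕ) : ℝ) * d) (by positivity) _).le.trans ?_
      refine ENNReal.ofReal_le_ofReal ?_
      gcongr
    · rintro - m' ⟨c', e1, e2, e3, e4⟩
      have hs : m' .src = m .src := e1.ds.src
      have ht : m' .dst = m .dst := e1.ds.dst
      rw [e1.col]
      refine ⟨⟨hs, ht⟩, e2.congr_mem fun e _ => by rw [hs, ht]; exact ⟨rfl, rfl, rfl⟩,
        fun e he => e3 e (mem_E.2 he), fun e he => e4 e fun h => he (mem_E.1 h)⟩
  · rw [← ENNReal.ofReal_natCast, ← ENNReal.ofReal_one, ← ENNReal.ofReal_add (by norm_num),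
      ← ENNReal.ofReal_add (by positivity)]
    · refine ENNReal.ofReal_le_ofReal ?_
      change ((90 * (hi - lo) + 1 : ℕ) : ℝ) + _ ≤ _
      push_cast
      linarith
    · have := Finset.sum_nonneg fun ℓ (_ : ℓ ∈ Finset.range U) => hnn ℓ
      positivity
    · have := Finset.sum_nonneg fun ℓ (_ : ℓ ∈ Finset.range U) => hnn ℓ
      positivity

/-- The effect of Random-Euler-Color on the records `lo, …, hi - 1`. -/
structure Colored (lo hi : ℕ) (m : Mem) (q : ℕ) (m' : Mem) : Prop where
  rearranged : Rearranged lo hi m m'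
  frame : ∀ e, ¬(lo ≤ e ∧ e < hi) → m' .col e = m .col e
  le : ∀ D, (ofMem lo hi m).IsMaxDeg D → q ≤ D + 1
  proper : (ofMem lo hi m').Proper q (m' .col)
  colored : ∀ e, lo ≤ e ∧ e < hi → m' .col e ≠ 0

/-- Each inequality comes from the degree estimate at a vertex of maximum degree in one of the two
graphs. -/
theorem isMaxDeg_half {h : EdgeList} {d D : ℕ} (hg : g.IsMaxDeg d) (hh : h.IsMaxDeg D)
    (hv : ∀ v, |2 * (h.deg v : ℤ) - g.deg v| ≤ 3) : 2 * D ≤ d + 3 ∧ d ≤ 2 * D + 3 := by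
  obtain ⟨v, hv1⟩ := hg.2
  obtain ⟨w, hw1⟩ := hh.2
  have h1 := abs_le.1 (hv v)
  have h2 := abs_le.1 (hv w)
  have h3 := hg.1 w
  have h4 := hh.1 v
  omega

/-- Strong induction on the number of edges. The real number D stands in for the maximum degree, so
that the bound on the expected time depends on no random outcome and is halved exactly from level to
level. -/
theorem eulerColor_rspec {n : ℕ} (hn1 : 1 ≤ n) (k : ℕ) : ∀ (lo hi : ℕ) (m : Mem) (D : ℝ), hi - lo = k →
    lo < hi → (ofMem lo hi m).Simple → (∀ e, lo ≤ e ∧ e < hi → m .src e < n ∧ m .dst e < n) →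
    0 < D → (∀ d, (ofMem lo hi m).IsMaxDeg d → |(d : ℝ) - D| ≤ 3) →
    RSpec (eulerColor lo hi) m (ENNReal.ofReal (timeBound n k D)) (Colored lo hi m) := by
  induction k using Nat.strong_induction_on with
  | _ k ih =>
    intro lo hi m D hk hlt hg hn hD hdD
    obtain ⟨d, hd⟩ := exists_isMaxDeg (ofMem lo hi m)
    have hdk : d ≤ k := hk ▸ hd.le_card
    have hmax := maxDegree_spec (g := ofMem lo hi m) hg hlt.le rfl rfl
    have hdR : |(d : ℝ) - D| ≤ 3 := hdD d hd
    rw [eulerColor]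
    by_cases hd1 : d ≤ 1
    · refine (RSpec.lift_bind (T₂ := ((2 * (hi - lo) : ℕ) : ℝ≥0∞) + 0) hmax ?_).mono ?_ fun _ _ h => h
      · rintro d' m1 ⟨hd', -, hfr⟩
        obtain rfl := hd.unique hd'
        rw [dif_pos (Or.inl hd1)]
        refine RSpec.lift_bind (colorAll_spec hlt.le) ?_
        rintro - m2 ⟨hcol, hfr2⟩
        have hs : m2 .src = m .src := by rw [hfr2 _ (by decide), hfr _ (by decide)]
        have ht : m2 .dst = m .dst := by rw [hfr2 _ (by decide), hfr _ (by decide)]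
        refine RSpec.pure ⟨Rearranged.refl hs ht, fun e he => ?_, fun D _ => by omega, ?_, fun e he => ?_⟩
        · rw [hcol, if_neg he, hfr _ (by decide)]
        · refine proper_one (fun v => ?_) fun e he => by rw [hcol, if_pos he]
          rw [deg_congr (m := m) fun e _ => ⟨by rw [hs], by rw [ht]⟩]
          exact (hd.1 v).trans hd1
        · rw [hcol, if_pos he]
          omega
      · rw [add_zero, ← Nat.cast_add, ← ENNReal.ofReal_natCast]
        refine ENNReal.ofReal_le_ofReal (le_trans ?_ (timeBound_base hn1 D))
        change ((12 * (hi - lo) + 2 * (hi - lo) : ℕ) : ℝ) ≤ _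
        rw [hk]
        push_cast
        linarith
    -- At most four classes are eliminated, each with at most a (d+2)-th of the edges.
    set U := 4 * k / (d + 2) with hU
    set S := ∑ ℓ ∈ Finset.range U, min (n : ℝ) ((k : ℝ) * d / ((ℓ + 1 : ℕ) : ℝ)) with hS
    have hS0 : 0 ≤ S := Finset.sum_nonneg fun ℓ _ => by positivity
    have hUd : U * (d + 2) ≤ 4 * k := Nat.div_mul_le_self _ _
    have hUd' : (U : ℝ) * d ≤ 4 * k := by
      have : (U : ℝ) * (d + 2) ≤ 4 * k := by exact_mod_cast hUd
      have : (0 : ℝ) ≤ U := Nat.cast_nonneg _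
      linarith
    have hUk : U ≤ k := by
      have : U * 4 ≤ U * (d + 2) := Nat.mul_le_mul_left _ (by omega)
      omega
    set mid := lo + (hi - lo + 1) / 2 with hmid
    refine (RSpec.lift_bind (T₂ := ((65 * (hi - lo) + 1 : ℕ) : ℝ≥0∞) +
      (ENNReal.ofReal (timeBound n (mid - lo) (D / 2)) + (ENNReal.ofReal (timeBound n (hi - mid) (D / 2)) +
      (((3 * (hi - mid) : ℕ) : ℝ≥0∞) + (((48 * k + 104 : ℕ) : ℝ≥0∞) +
      (ENNReal.ofReal ((90 * (hi - lo : ℕ) + 2 + U : ℝ) + 300 * S) + 0))))))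
      hmax ?_).mono ?_ fun _ _ h => h
    · rintro d' m1 ⟨hd', hdeg1, hfr1⟩
      obtain rfl := hd.unique hd'
      rw [dif_neg (by omega)]
      have hs1 : m1 .src = m .src := hfr1 _ (by decide)
      have ht1 : m1 .dst = m .dst := hfr1 _ (by decide)
      have hg1 : ofMem lo hi m1 = ofMem lo hi m := by unfold ofMem; rw [hs1, ht1]
      rw [← hg1] at hg hdeg1 hd
      refine RSpec.lift_bind (partition_halves_spec hg hlt.le hdeg1) ?_
      rintro - m2 ⟨hre2, hcol2, hhalf⟩
      rw [← hmid] at hhalf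
      have hn2 := hre2.lt (n := n) (by rw [hs1, ht1]; exact hn)
      have hg2 := hre2.simple hg
      obtain ⟨d₁, hd₁⟩ := exists_isMaxDeg (ofMem lo mid m2)
      obtain ⟨d₂, hd₂⟩ := exists_isMaxDeg (ofMem mid hi m2)
      have b₁ := isMaxDeg_half hd hd₁ fun v => (hhalf v).1
      have b₂ := isMaxDeg_half hd hd₂ fun v => (hhalf v).2
      -- The tolerance 3 reproduces itself: d' is within 3/2 of d/2, and d/2 is within 3/2 of D/2.
      have hreal : ∀ d' : ℕ, 2 * d' ≤ d + 3 ∧ d ≤ 2 * d' + 3 → |(d' : ℝ) - D / 2| ≤ 3 := by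
        rintro d' ⟨h1, h2⟩
        have h1' : (2 * d' : ℝ) ≤ d + 3 := by exact_mod_cast h1
        have h2' : (d : ℝ) ≤ 2 * d' + 3 := by exact_mod_cast h2
        obtain ⟨h3, h4⟩ := abs_le.1 hdR
        rw [abs_le]
        constructor <;> linarith
      refine RSpec.bind (ih (mid - lo) (by omega) lo mid m2 (D / 2) rfl (by omega)
        (hg2.sub le_rfl (by omega)) (fun e he => hn2 e (by omega)) (by linarith)
        fun d' hd' => hreal d' (hd'.unique hd₁ ▸ b₁)) ?_
      rintro q₁ m3 h3
      have hre3 := h3.rearranged.mono (le_refl lo) (show mid ≤ hi by omega)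
      have hn3 := hre3.lt hn2
      have hg3 := hre3.simple hg2
      have hd₂' : (ofMem mid hi m3).IsMaxDeg d₂ := by
        have := deg_congr (lo := mid) (hi := hi) fun e he =>
          h3.rearranged.congr (lo' := mid) (hi' := hi) (Or.inr le_rfl) he
        unfold IsMaxDeg
        simp only [this]
        exact hd₂
      refine RSpec.bind (ih (hi - mid) (by omega) mid hi m3 (D / 2) rfl (by omega)
        (hg3.sub (by omega) le_rfl) (fun e he => hn3 e (by omega)) (by linarith)
        fun d' hd' => hreal d' (hd'.unique hd₂' ▸ b₂)) ?_
      rintro q₂ m4 h4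
      have hre4 := h4.rearranged.mono (show lo ≤ mid by omega) (le_refl hi)
      have hq₁ := h3.le d₁ hd₁
      have hq₂ := h4.le d₂ hd₂'
      have hcol4 : ∀ e, lo ≤ e ∧ e < hi → m4 .col e ≠ 0 := fun e he => by
        by_cases h : e < mid
        · rw [h4.frame e (by omega)]
          exact h3.colored e (by omega)
        · exact h4.colored e (by omega)
      have hp₁ : (ofMem lo mid m4).Proper q₁ (m4 .col) := h3.proper.congr_mem fun e he =>
        ⟨(h4.rearranged.congr (Or.inl le_rfl) he).1, (h4.rearranged.congr (Or.inl le_rfl) he).2,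
          h4.frame e (by omega)⟩
      refine RSpec.lift_bind (relabel_spec (by omega)) ?_
      rintro - m5 ⟨hcol5, hfr5⟩
      have hre5 : Rearranged lo hi m4 m5 := Rearranged.refl (hfr5 _ (by decide)) (hfr5 _ (by decide))
      have hp5 : (ofMem lo hi m5).Proper (q₁ + q₂) (m5 .col) := by
        have := hp₁.union h4.proper (fun e he => hcol4 e (by omega)) hcol5
        unfold ofMem at this ⊢
        rwa [hfr5 .src (by decide), hfr5 .dst (by decide)]
      have hunc5 : ((ofMem lo hi m5).unc (m5 .col)).card = 0 := by
        rw [Finset.card_eq_zero, unc, Finset.filter_eq_empty_iff]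
        intro e he
        have := hcol4 e (mem_E.1 he)
        rw [hcol5]
        split <;> omega
      -- The halves use at most d₁ + 1 and d₂ + 1 colors, and 2d₁, 2d₂ ≤ d + 3. So there are at most
      -- d + 5 ≤ k + 5 colors and at most four rounds.
      have hprune : Spec (prune lo hi (d + 1) (q₁ + q₂)) m5 (48 * k + 104) _ :=
        (prune_spec (k := d + 1) hlt.le hp5).mono (by
          change (q₁ + q₂ - (d + 1)) * (5 * (q₁ + q₂) + 7 * (hi - lo) + 1) ≤ _
          calc (q₁ + q₂ - (d + 1)) * (5 * (q₁ + q₂) + 7 * (hi - lo) + 1)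
              ≤ 4 * (5 * (k + 5) + 7 * k + 1) := by
                refine Nat.mul_le_mul (by omega) (by omega)
            _ = 48 * k + 104 := by ring) fun _ _ h => h
      refine RSpec.lift_bind hprune ?_
      rintro - m6 ⟨hp6, hunc6, hfrc6, hfr6⟩
      have hs6 : m6 .src = m5 .src := hfr6 _ (by decide) (by decide)
      have ht6 : m6 .dst = m5 .dst := hfr6 _ (by decide) (by decide)
      have hg6 : ofMem lo hi m6 = ofMem lo hi m5 := by unfold ofMem; rw [hs6, ht6]
      have hre6 : Rearranged lo hi m1 m6 :=
        (((hre2.trans hre3).trans hre4).trans hre5).trans (Rearranged.refl hs6 ht6)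
      rw [hunc5] at hunc6
      have hunc6' : ((ofMem lo hi m6).unc (m6 .col)).card ≤ U := by
        rw [hU, Nat.le_div_iff_mul_le (by omega), hg6]
        change (d + 2) * _ ≤ (d + 2) * 0 + (q₁ + q₂ - (d + 1)) * (hi - lo) at hunc6
        have : (q₁ + q₂ - (d + 1)) * (hi - lo) ≤ 4 * k := Nat.mul_le_mul (by omega) (by omega)
        rw [mul_comm]
        omega
      have hrep := repair_rspec (n := n) (U := U) hlt.le (hre6.simple hg) (hre6.isMaxDeg hd) (by omega)
        (hre6.lt (by rw [hs1, ht1]; exact hn)) (by rw [hg6]; exact hp6) hunc6'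
      rw [hk, ← hS, ← hk] at hrep
      refine RSpec.bind hrep ?_
      rintro - m7 ⟨⟨hs7, ht7⟩, hp7, hcol7, hfr7⟩
      have hre7 : Rearranged lo hi m m7 :=
        ((Rearranged.refl hs1 ht1).trans hre6).trans (Rearranged.refl hs7 ht7)
      refine RSpec.pure ⟨hre7, fun e he => ?_, fun D hD => ?_, hp7, hcol7⟩
      · rw [hfr7 e he, hfrc6 e fun h => he (mem_E.1 h), hcol5, if_neg (by omega), h4.frame e (by omega),
          h3.frame e (by omega), hcol2, hfr1 _ (by decide)]
      · rw [← hg1] at hD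
        rw [hD.unique hd]
    · have hd0 : (0 : ℝ) < d := by
        have : 0 < d := by omega
        exact_mod_cast this
      have hstep := timeBound_step (n := n) (k := k) (k₁ := mid - lo) (k₂ := hi - mid) hn1 (by omega)
        (by omega) (by omega) hd0 hD hdR hUd'
      rw [← hS] at hstep
      have t1 := timeBound_nonneg n (mid - lo) (D / 2)
      have t2 := timeBound_nonneg n (hi - mid) (D / 2)
      -- All linear work of this level; the additive constants are absorbed because d ≥ 2 forces k ≥
      -- 2.
      have hnat : 12 * (hi - lo) + (65 * (hi - lo) + 1) + 3 * (hi - mid) + (48 * k + 104) +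
        (90 * (hi - lo) + 2 + U) ≤ 300 * k := by omega
      have hnat' : ((12 * (hi - lo) : ℕ) : ℝ) + ((65 * (hi - lo) + 1 : ℕ) : ℝ) + ((3 * (hi - mid) : ℕ) : ℝ) +
        ((48 * k + 104 : ℕ) : ℝ) + (90 * (hi - lo : ℕ) + 2 + U : ℝ) ≤ 300 * k := by exact_mod_cast hnat
      change ((12 * (hi - lo) : ℕ) : ℝ≥0∞) + _ ≤ _
      simp only [← ENNReal.ofReal_natCast]
      rw [add_zero, ← ENNReal.ofReal_add (by positivity) (by positivity),
        ← ENNReal.ofReal_add (by positivity) (by positivity), ← ENNReal.ofReal_add t2 (by positivity),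
        ← ENNReal.ofReal_add t1 (by positivity), ← ENNReal.ofReal_add (by positivity) (by positivity),
        ← ENNReal.ofReal_add (by positivity) (by positivity)]
      refine ENNReal.ofReal_le_ofReal ?_
      linarith

variable {n lo hi k : ℕ} {G : SimpleGraph (Fin n)} {m m' : Mem}

/-! ### Edge records and graphs -/

theorem IsRecord.unique {i : ℕ} {e e' : Sym2 (Fin n)} (h : IsRecord m i e) (h' : IsRecord m i e') :
    e = e' := by
  obtain ⟨u, v, h1, h2, rfl⟩ := h
  obtain ⟨u', v', h1', h2', rfl⟩ := h'
  rw [Fin.ext (h1.symm.trans h1'), Fin.ext (h2.symm.trans h2')]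

theorem IsRecord.mem_iff {i : ℕ} {e : Sym2 (Fin n)} (h : IsRecord m i e) (v : Fin n) :
    v ∈ e ↔ (ofMem lo hi m).Inc i v := by
  obtain ⟨a, b, h1, h2, rfl⟩ := h
  unfold Inc ofMem
  dsimp only
  rw [Sym2.mem_iff, h1, h2, Fin.ext_iff, Fin.ext_iff]
  exact or_congr eq_comm eq_comm

theorem IsRecord.eq_of_swap {i j : ℕ} {e e' : Sym2 (Fin n)} (h : IsRecord m i e) (h' : IsRecord m j e')
    (hij : (m .src i = m .src j ∧ m .dst i = m .dst j) ∨ (m .src i = m .dst j ∧ m .dst i = m .src j)) :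
    e = e' := by
  obtain ⟨u, v, h1, h2, rfl⟩ := h
  obtain ⟨u', v', h1', h2', rfl⟩ := h'
  rw [h1, h2, h1', h2'] at hij
  rcases hij with ⟨e1, e2⟩ | ⟨e1, e2⟩
  · rw [Fin.ext e1, Fin.ext e2]
  · rw [Fin.ext e1, Fin.ext e2, Sym2.eq_swap]

namespace StoresGraph

/-- The index of the record of an edge. -/
noncomputable def idx (h : StoresGraph m lo hi G) (e : G.edgeSet) : ℕ :=
  (h.complete e e.2).choose

theorem idx_mem (h : StoresGraph m lo hi G) (e : G.edgeSet) : lo ≤ h.idx e ∧ h.idx e < hi :=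
  (h.complete e e.2).choose_spec.1.1

theorem idx_record (h : StoresGraph m lo hi G) (e : G.edgeSet) : IsRecord m (h.idx e) (e : Sym2 (Fin n)) :=
  (h.complete e e.2).choose_spec.1.2

theorem idx_eq (h : StoresGraph m lo hi G) {e : G.edgeSet} {i : ℕ} (hi' : lo ≤ i ∧ i < hi)
    (hr : IsRecord m i (e : Sym2 (Fin n))) : h.idx e = i :=
  ((h.complete e e.2).choose_spec.2 i ⟨hi', hr⟩).symm

theorem exists_idx (h : StoresGraph m lo hi G) {i : ℕ} (hi' : lo ≤ i ∧ i < hi) : ∃ e, h.idx e = i := by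
  obtain ⟨e, he, hr⟩ := h.sound i hi'.1 hi'.2
  exact ⟨⟨e, he⟩, h.idx_eq hi' hr⟩

theorem idx_inj (h : StoresGraph m lo hi G) {e f : G.edgeSet} (hef : h.idx e = h.idx f) : e = f :=
  Subtype.ext ((h.idx_record e).unique (hef ▸ h.idx_record f))

theorem idx_E (h : StoresGraph m lo hi G) (e : G.edgeSet) : h.idx e ∈ (ofMem lo hi m).E :=
  mem_E.2 (h.idx_mem e)

theorem inc_idx (h : StoresGraph m lo hi G) (e : G.edgeSet) (v : Fin n) :
    (ofMem lo hi m).Inc (h.idx e) v ↔ v ∈ (e : Sym2 (Fin n)) := ((h.idx_record e).mem_iff v).symm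

theorem lt (h : StoresGraph m lo hi G) {i : ℕ} (hi' : lo ≤ i ∧ i < hi) : m .src i < n ∧ m .dst i < n := by
  obtain ⟨e, -, u, v, h1, h2, -⟩ := h.sound i hi'.1 hi'.2
  rw [h1, h2]
  exact ⟨u.2, v.2⟩

theorem simple (h : StoresGraph m lo hi G) : (ofMem lo hi m).Simple where
  ne i hi' := by
    obtain ⟨e, he, u, v, h1, h2, rfl⟩ := h.sound i (mem_E.1 hi').1 (mem_E.1 hi').2
    change m .src i ≠ m .dst i
    rw [h1, h2]
    exact fun huv => G.ne_of_adj ((SimpleGraph.mem_edgeSet G).1 he) (Fin.ext huv)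
  inj i hi' j hj hij := by
    obtain ⟨e, he⟩ := h.exists_idx (mem_E.1 hi')
    obtain ⟨f, hf⟩ := h.exists_idx (mem_E.1 hj)
    have h1 := h.idx_record e
    have h2 := h.idx_record f
    rw [he] at h1
    rw [hf] at h2
    rw [← he, ← hf, Subtype.ext (h1.eq_of_swap h2 hij)]

theorem deg_eq (h : StoresGraph m lo hi G) (v : Fin n) :
    (ofMem lo hi m).deg v = (G.neighborSet v).ncard := by
  classical
  rw [Set.ncard_eq_toFinset_card', ← SimpleGraph.neighborFinset_def, SimpleGraph.card_neighborFinset_eq_degree,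
    ← SimpleGraph.card_incidenceFinset_eq_degree]
  symm
  refine Finset.card_bij (fun e he => h.idx ⟨e, ((SimpleGraph.mem_incidenceFinset G v e).1 he).1⟩) ?_ ?_ ?_
  · intro e he
    exact mem_star.2 ⟨h.idx_E _, (h.inc_idx _ v).2 ((SimpleGraph.mem_incidenceFinset G v e).1 he).2⟩
  · intro e he f hf hef
    exact congrArg Subtype.val (h.idx_inj hef)
  · intro i hi'
    obtain ⟨h1, h2⟩ := mem_star.1 hi'
    obtain ⟨e, rfl⟩ := h.exists_idx (mem_E.1 h1)
    exact ⟨e, (SimpleGraph.mem_incidenceFinset G v e).2 ⟨e.2, (h.inc_idx e v).1 h2⟩, rfl⟩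

theorem deg_of_le (h : StoresGraph m lo hi G) {v : ℕ} (hv : n ≤ v) : (ofMem lo hi m).deg v = 0 := by
  rw [deg, Finset.card_eq_zero, EdgeList.star, Finset.filter_eq_empty_iff]
  intro e he hev
  have := h.lt (mem_E.1 he)
  rcases hev with h | h
  · change m .src e = v at h; omega
  · change m .dst e = v at h; omega

theorem star_nonempty (h : StoresGraph m lo hi G) (v : Fin n) :
    ((ofMem lo hi m).star v).Nonempty ↔ (G.neighborSet v).Nonempty := by
  rw [← Finset.card_pos, ← Set.ncard_pos]
  exact iff_of_eq (congrArg (0 < ·) (h.deg_eq v))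

theorem lt_of_star (h : StoresGraph m lo hi G) {v : ℕ} (hv : ((ofMem lo hi m).star v).Nonempty) : v < n := by
  by_contra hn
  have := h.deg_of_le (not_lt.1 hn)
  have := Finset.card_pos.2 hv
  unfold deg at *
  omega

theorem isMaxDeg [DecidableRel G.Adj] (h : StoresGraph m lo hi G) : (ofMem lo hi m).IsMaxDeg G.maxDegree := by
  have hdeg : ∀ v : Fin n, (ofMem lo hi m).deg v = G.degree v := fun v => by
    rw [h.deg_eq, Set.ncard_eq_toFinset_card', ← SimpleGraph.neighborFinset_def,
      SimpleGraph.card_neighborFinset_eq_degree]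
  constructor
  · intro v
    by_cases hv : v < n
    · exact (hdeg ⟨v, hv⟩).le.trans (G.degree_le_maxDegree _)
    · rw [h.deg_of_le (not_lt.1 hv)]
      exact Nat.zero_le _
  · rcases Nat.eq_zero_or_pos n with rfl | hn
    · exact ⟨0, by rw [h.deg_of_le le_rfl, SimpleGraph.maxDegree_of_subsingleton]⟩
    · have : Nonempty (Fin n) := ⟨⟨0, hn⟩⟩
      obtain ⟨v, hv⟩ := G.exists_maximal_degree_vertex
      exact ⟨v, by rw [hdeg, hv]⟩

theorem rearranged (h : StoresGraph m lo hi G) (hr : Rearranged lo hi m m') : StoresGraph m' lo hi G := by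
  obtain ⟨ρ, h1, h2, h3⟩ := hr
  have hmem : ∀ i, (lo ≤ ρ i ∧ ρ i < hi) ↔ (lo ≤ i ∧ i < hi) := fun i => by
    have := perm_mem_E (g := ofMem lo hi m) (ρ := ρ) (fun e he => h1 e fun h => he (mem_E.2 h)) (e := i)
    rwa [mem_E, mem_E] at this
  have hrec : ∀ i (e : Sym2 (Fin n)), IsRecord m' i e ↔ IsRecord m (ρ i) e := fun i e => by
    unfold IsRecord
    rw [h2, h3]
    rfl
  refine ⟨h.le, fun i h4 h5 => ?_, fun e he => ?_⟩
  · have := (hmem i).2 ⟨h4, h5⟩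
    obtain ⟨e, he, hr⟩ := h.sound _ this.1 this.2
    exact ⟨e, he, (hrec i e).2 hr⟩
  · obtain ⟨j, ⟨hj, hjr⟩, huniq⟩ := h.complete e he
    refine ⟨ρ.symm j, ⟨(hmem _).1 (by rwa [ρ.apply_symm_apply]), ?_⟩, ?_⟩
    · rw [hrec, ρ.apply_symm_apply]
      exact hjr
    · rintro i ⟨hi', hir⟩
      rw [← huniq (ρ i) ⟨(hmem i).2 hi', (hrec i e).1 hir⟩, ρ.symm_apply_apply]

end StoresGraph

/-! ### Color fields and partial edge-colorings -/

/-- The color that a number stands for. -/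
def codeColor (k x : ℕ) : Option (Fin k) := if h : 0 < x ∧ x ≤ k then some ⟨x - 1, by omega⟩ else none

theorem colorCode_codeColor {x : ℕ} (hx : x ≤ k) : colorCode (codeColor k x) = x := by
  unfold codeColor
  split
  · change x - 1 + 1 = x
    omega
  · change 0 = x
    omega

theorem colorCode_inj {a b : Option (Fin k)} (h : colorCode a = colorCode b) : a = b := by
  cases a <;> cases b
  · rfl
  · simp [colorCode] at h
  · simp [colorCode] at h
  · simp only [colorCode, Nat.add_right_cancel_iff] at h
    rw [Fin.ext h]

theorem colorCode_eq_zero {a : Option (Fin k)} : colorCode a = 0 ↔ a = none := by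
  cases a <;> simp [colorCode]

theorem colorCode_le (a : Option (Fin k)) : colorCode a ≤ k := by
  cases a with
  | none => exact Nat.zero_le _
  | some γ => exact γ.2

/-- The partial edge-coloring given by the color fields of the records. -/
theorem StoresGraph.exists_coloring (h : StoresGraph m lo hi G)
    (hc : (ofMem lo hi m).Proper k (m .col)) :
    ∃ c : PartialEdgeColoring G k, StoresColoring m lo hi c := by
  have hcode : ∀ e, colorCode (codeColor k (m .col (h.idx e))) = m .col (h.idx e) :=
    fun e => colorCode_codeColor (hc.le _ (h.idx_E e))
  refine ⟨⟨fun e => codeColor k (m .col (h.idx e)), fun e f hef γ he hf => ?_⟩, h, fun i h1 h2 e hr => ?_⟩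
  · obtain ⟨hne, v, hve, hvf⟩ := SimpleGraph.lineGraph_adj_iff_exists.1 hef
    have e1 := hcode e
    have e2 := hcode f
    rw [he] at e1
    rw [hf] at e2
    refine hc.ne _ (h.idx_E e) _ (h.idx_E f) (fun h' => hne (h.idx_inj h')) v ((h.inc_idx e v).2 hve)
      ((h.inc_idx f v).2 hvf) ?_ ?_
    · rw [← e1]; simp [colorCode]
    · rw [← e1, ← e2]
  · rw [hcode, h.idx_eq ⟨h1, h2⟩ hr]

namespace StoresColoring

variable {c : PartialEdgeColoring G k}

theorem col_idx (h : StoresColoring m lo hi c) (e : G.edgeSet) :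
    m .col (h.toStoresGraph.idx e) = colorCode (c.color e) :=
  h.col _ (h.toStoresGraph.idx_mem e).1 (h.toStoresGraph.idx_mem e).2 e (h.toStoresGraph.idx_record e)

theorem proper (h : StoresColoring m lo hi c) : (ofMem lo hi m).Proper k (m .col) where
  le i hi' := by
    obtain ⟨e, rfl⟩ := h.toStoresGraph.exists_idx (mem_E.1 hi')
    rw [h.col_idx]
    exact colorCode_le _
  ne i hi' j hj hne v hiv hjv h0 := by
    obtain ⟨e, rfl⟩ := h.toStoresGraph.exists_idx (mem_E.1 hi')
    obtain ⟨f, rfl⟩ := h.toStoresGraph.exists_idx (mem_E.1 hj)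
    have hv : v < n := h.toStoresGraph.lt_of_star ⟨_, mem_star.2 ⟨hi', hiv⟩⟩
    rw [h.col_idx, h.col_idx]
    rw [h.col_idx, ne_eq, colorCode_eq_zero] at h0
    obtain ⟨γ, hγ⟩ := Option.ne_none_iff_exists'.1 h0
    intro heq
    refine c.proper e f (SimpleGraph.lineGraph_adj_iff_exists.2 ⟨fun h => hne (by rw [h]), ⟨v, hv⟩,
      (h.toStoresGraph.inc_idx e ⟨v, hv⟩).1 hiv, (h.toStoresGraph.inc_idx f ⟨v, hv⟩).1 hjv⟩) γ hγ ?_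
    rw [← colorCode_inj heq, hγ]

theorem isSome_iff (h : StoresColoring m lo hi c) (e : G.edgeSet) :
    (c.color e).isSome ↔ m .col (h.toStoresGraph.idx e) ≠ 0 := by
  rw [h.col_idx, ne_eq, colorCode_eq_zero, Option.isSome_iff_ne_none]

theorem card_unc (h : StoresColoring m lo hi c) : ((ofMem lo hi m).unc (m .col)).card = c.uncolored := by
  have : (((ofMem lo hi m).unc (m .col) : Finset ℕ) : Set ℕ) =
      h.toStoresGraph.idx '' {e | c.color e = none} := by
    ext i
    rw [Finset.mem_coe, mem_unc, Set.mem_image]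
    constructor
    · rintro ⟨h1, h2⟩
      obtain ⟨e, rfl⟩ := h.toStoresGraph.exists_idx (mem_E.1 h1)
      rw [h.col_idx, colorCode_eq_zero] at h2
      exact ⟨e, h2, rfl⟩
    · rintro ⟨e, he, rfl⟩
      exact ⟨h.toStoresGraph.idx_E e, by rw [h.col_idx]; exact colorCode_eq_zero.2 he⟩
  rw [← Set.ncard_coe_finset, this, Set.ncard_image_of_injective _ fun e f => h.toStoresGraph.idx_inj]
  rfl

theorem missing_iff (h : StoresColoring m lo hi c) (v : Fin n) (γ : Fin k) :
    c.Missing v γ ↔ (ofMem lo hi m).Miss (m .col) v (γ + 1) := by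
  have hγ : ∀ e, c.color e = some γ ↔ m .col (h.toStoresGraph.idx e) = γ + 1 := fun e => by
    rw [h.col_idx]
    exact ⟨fun h => by rw [h]; rfl, fun h => colorCode_inj (b := some γ) h⟩
  constructor
  · intro hm i hi' hiv
    obtain ⟨e, rfl⟩ := h.toStoresGraph.exists_idx (mem_E.1 hi')
    rw [ne_eq, ← hγ]
    exact hm e ((h.toStoresGraph.inc_idx e v).1 hiv)
  · intro hm e hev
    rw [ne_eq, hγ]
    exact hm _ (h.toStoresGraph.idx_E e) ((h.toStoresGraph.inc_idx e v).2 hev)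

/-- A number up to deg v + 1 is at most the maximum degree plus 1, hence it names one of the
available colors. -/
theorem muSet_eq [DecidableRel G.Adj] {c : PartialEdgeColoring G (G.maxDegree + 1)}
    (h : StoresColoring m lo hi c) (v : Fin n) :
    {x : ℕ | ∃ γ : Fin (G.maxDegree + 1), x = γ + 1 ∧ x ≤ (G.neighborSet v).ncard + 1 ∧ c.Missing v γ} =
      muSet (ofMem lo hi m) (m .col) v := by
  have hd := h.toStoresGraph.isMaxDeg.1 v
  ext x
  unfold muSet
  rw [Set.mem_ofPred_eq, Set.mem_ofPred_eq, h.toStoresGraph.deg_eq]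
  rw [h.toStoresGraph.deg_eq] at hd
  constructor
  · rintro ⟨γ, rfl, h1, h2⟩
    exact ⟨⟨by omega, h1⟩, (h.missing_iff v γ).1 h2⟩
  · rintro ⟨⟨h1, h2⟩, h3⟩
    refine ⟨⟨x - 1, by omega⟩, by simp only; omega, h2, (h.missing_iff v _).2 ?_⟩
    rwa [show x - 1 + 1 = x by omega]

end StoresColoring

/-! ### The data structures -/

/-- The bridge between the specification for graphs and the proof on raw indices, where the array of
color fields itself plays the role of the coloring. -/
theorem repairState_iff [DecidableRel G.Adj] {c : PartialEdgeColoring G (G.maxDegree + 1)} :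
    RepairState m lo hi G.maxDegree c ↔
      StoresColoring m lo hi c ∧ RS (ofMem lo hi m) G.maxDegree (m .col) m := by
  constructor
  · intro h
    have hS := h.toStoresColoring
    have hG := hS.toStoresGraph
    refine ⟨hS, ⟨rfl, rfl, fun e he h0 v hev => ?_, ⟨fun v hv => ?_, fun v _ => hG.isMaxDeg.1 v,
      fun v _ x hx => hx.1, fun v hv => ?_⟩, ?_⟩, rfl⟩
    · have := h.dict e (mem_E.1 he).1 (mem_E.1 he).2 h0
      rcases hev with rfl | rfl
      · exact this.1
      · exact this.2
    · obtain ⟨v, rfl⟩ : ∃ u : Fin n, v = u := ⟨⟨v, hG.lt_of_star hv⟩, rfl⟩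
      rw [h.deg v ((hG.star_nonempty v).1 hv), hG.deg_eq]
    · obtain ⟨v, rfl⟩ : ∃ u : Fin n, v = u := ⟨⟨v, hG.lt_of_star hv⟩, rfl⟩
      have := h.mu v ((hG.star_nonempty v).1 hv)
      rwa [hS.muSet_eq] at this
    · convert h.unc using 1
      ext e
      rw [Set.mem_ofPred_eq, Set.mem_ofPred_eq, mem_unc, mem_E, and_assoc]
      rfl
  · rintro ⟨hS, hR⟩
    have hG := hS.toStoresGraph
    refine ⟨hS, fun v hv => ?_, fun i h1 h2 h0 => ?_, fun v hv => ?_, ?_⟩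
    · rw [hR.ds.mu.deg v ((hG.star_nonempty v).2 hv), hG.deg_eq]
    · have hiE : i ∈ (ofMem lo hi m).E := mem_E.2 ⟨h1, h2⟩
      exact ⟨hR.ds.dict i hiE h0 _ (inc_s i), hR.ds.dict i hiE h0 _ (inc_t i)⟩
    · rw [hS.muSet_eq]
      exact hR.ds.mu.mu v ((hG.star_nonempty v).2 hv)
    · convert hR.ds.unc using 1
      ext e
      rw [Set.mem_ofPred_eq, Set.mem_ofPred_eq, mem_unc, mem_E, and_assoc]
      rfl

theorem RSpec.exec {α : Type} {p : Rand α} {T : ℝ≥0∞} {Q : α → Mem → Prop} (h : RSpec p m T Q) :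
    (∀ ω ∈ (exec p m).support, Q ω.1 ω.2.mem) ∧ expectedTime p m ≤ T := by
  refine ⟨(h 0).1, ?_⟩
  have := (h 0).2
  rw [Nat.cast_zero, zero_add] at this
  exact this

end EdgeColoringRAM

/-! ### The two claims for graphs and partial edge-colorings. -/

open EdgeColoringRAM EdgeColoringRAM.EdgeList in
theorem mainTheorem4 :
    -- Random-Euler-Color
    (∃ C : ℝ, ∀ (n m : ℕ) (G : SimpleGraph (Fin n)) [DecidableRel G.Adj] (mem : Mem),
      0 < m → StoresGraph mem 0 m G →
        (∀ ω ∈ (exec (randomEulerColor m) mem).support,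
          ∃ c : PartialEdgeColoring G (G.maxDegree + 1),
            c.IsComplete ∧ StoresColoring ω.2.mem 0 m c) ∧
        expectedTime (randomEulerColor m) mem ≤ ENNReal.ofReal (C * (m * Real.sqrt n))) ∧
    -- Random-Color-One
    (∃ C : ℝ, ∀ (n lo hi : ℕ) (G : SimpleGraph (Fin n)) [DecidableRel G.Adj]
      (c : PartialEdgeColoring G (G.maxDegree + 1)) (mem : Mem),
      0 < c.uncolored → RepairState mem lo hi G.maxDegree c →
        (∀ ω ∈ (exec (randomColorOne lo hi G.maxDegree) mem).support,
          ∃ c' : PartialEdgeColoring G (G.maxDegree + 1),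
            (∀ e, (c.color e).isSome → (c'.color e).isSome) ∧
            c'.uncolored + 1 = c.uncolored ∧
            RepairState ω.2.mem lo hi G.maxDegree c') ∧
        expectedTime (randomColorOne lo hi G.maxDegree) mem ≤
          ENNReal.ofReal (C * min (n : ℝ) (((hi - lo : ℕ) : ℝ) * G.maxDegree / c.uncolored))) := by
  constructor
  · refine ⟨206000, fun n m G _ mem hm h => ?_⟩
    have hg := h.simple
    have hn1 : 1 ≤ n := by have := (h.lt ⟨Nat.zero_le 0, hm⟩).1; omega
    have hsq := hg.card_le_sq fun e he => h.lt (mem_E.1 he)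
    -- The recursion is started with D one above the maximum degree: it has to be positive, and a
    -- deviation of 1 is within the tolerance.
    have hD : ∀ d, (ofMem 0 m mem).IsMaxDeg d → |(d : ℝ) - (G.maxDegree + 1)| ≤ 3 := fun d hd => by
      rw [hd.unique h.isMaxDeg]
      norm_num
    have hcol : RSpec (randomEulerColor m) mem (ENNReal.ofReal (timeBound n m (G.maxDegree + 1)) + 0)
        fun _ m' => Colored 0 m mem (G.maxDegree + 1) m' :=
      RSpec.bind (eulerColor_rspec hn1 m 0 m mem _ rfl hm hg (fun e he => h.lt he) (by positivity) hD)
        fun q m' hq => RSpec.pure ⟨hq.rearranged, hq.frame, fun D hD => by rw [hD.unique h.isMaxDeg],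
          hq.proper.mono (hq.le _ h.isMaxDeg), hq.colored⟩
    refine ⟨fun ω hω => ?_, hcol.exec.2.trans ?_⟩
    · have hC := hcol.exec.1 ω hω
      have hS := h.rearranged hC.rearranged
      obtain ⟨c, hc⟩ := hS.exists_coloring hC.proper
      exact ⟨c, fun e => (hc.isSome_iff e).2 (hC.colored _ (hc.toStoresGraph.idx_mem e)), hc⟩
    · rw [add_zero]
      exact ENNReal.ofReal_le_ofReal (timeBound_le hn1 hsq _)
  · refine ⟨300, fun n lo hi G _ c mem hc h => ?_⟩
    obtain ⟨hS, hR⟩ := repairState_iff.1 h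
    have hG := hS.toStoresGraph
    have hunc := hS.card_unc
    have hne : ((ofMem lo hi mem).unc (mem .col)).Nonempty := Finset.card_pos.1 (hunc ▸ hc)
    have hnE : ∀ e ∈ (ofMem lo hi mem).E, (ofMem lo hi mem).s e < n ∧ (ofMem lo hi mem).t e < n :=
      fun e he => hG.lt (mem_E.1 he)
    have hd1 : 1 ≤ G.maxDegree := by
      obtain ⟨e, he⟩ := hne
      exact le_trans (Finset.card_pos.2 ⟨e, mem_star.2 ⟨(mem_unc.1 he).1, inc_s e⟩⟩) (hG.isMaxDeg.1 _)
    have hdn : G.maxDegree < n := by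
      obtain ⟨v, hv⟩ := hG.isMaxDeg.2
      rw [← hv]
      exact hG.simple.deg_lt hnE (by omega)
    have hspec := (randomColorOne_rspec hG.simple hS.proper hR hne hG.isMaxDeg.1 hd1 hdn hnE).exec
    rw [hunc] at hspec
    refine ⟨fun ω hω => ?_, hspec.2⟩
    obtain ⟨c', e₀, he₀, hR', hp', h0, -⟩ := hspec.1 ω hω
    have hs : ω.2.mem .src = mem .src := hR'.ds.src
    have ht : ω.2.mem .dst = mem .dst := hR'.ds.dst
    have hgm : ofMem lo hi ω.2.mem = ofMem lo hi mem := by unfold ofMem; rw [hs, ht]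
    have hcol := hR'.col
    -- The raw coloring returned by the specification is the final array of color fields, from which
    -- the new partial edge-coloring of the graph is read off.
    subst hcol
    rw [← hgm] at hR' hp'
    have hG' := hG.rearranged (Rearranged.refl hs ht)
    obtain ⟨c', hS'⟩ := hG'.exists_coloring hp'
    refine ⟨c', fun e he => ?_, ?_, repairState_iff.2 ⟨hS', hR'⟩⟩
    · rw [hS'.isSome_iff, ne_eq, h0, not_and_or]
      rw [hS.isSome_iff] at he
      refine Or.inl ?_
      have : hS'.toStoresGraph.idx e = hS.toStoresGraph.idx e := by
        refine hS'.toStoresGraph.idx_eq (hG.idx_mem e) ?_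
        have := hG.idx_record e
        unfold IsRecord at this ⊢
        rwa [hs, ht]
      rwa [this]
    · rw [← hunc, ← hS'.card_unc, hgm]
      have : (ofMem lo hi mem).unc (ω.2.mem .col) = ((ofMem lo hi mem).unc (mem .col)).erase e₀ := by
        ext e
        rw [mem_unc, Finset.mem_erase, mem_unc, h0]
        tauto
      rw [this, Finset.card_erase_add_one he₀]
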